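/- **Theorem (Geodesic equation for the Sobolev metric $G^s$).** Let $n\ge 1$ and $s\in\mathbb R$, let $\mathcal F f(\xi)=(2\pi)^{-n/2}\int_{\mathbb R^n}e^{-i\langle x,\xi\rangle}f(x)\,dx$, and let $A_s=\mathcal F^{-1}(1+|\xi|^2)^s\mathcal F$, acting on scalar functions and tempered distributions, and componentwise on vector fields. Let $\mathrm{Diff}_c(\mathbb R^n)$ be the group of smooth diffeomorphisms of $\mathbb R^n$ that equal the identity off a compact set, with the right-invariant metric $$G^s_\varphi(X,Y)=\langle X\circ\varphi^{-1},Y\circ\varphi^{-1}\rangle_{H^s},\qquad \langle v,w\rangle_{H^s}=\int_{\mathbb R^n}\langle A_{s/2}v,A_{s/2}w\rangle\,dx .$$ 1. For every $k\in\mathbb R$, $A_s$ maps $H^{k+2s}(\mathbb R^n)$ bijectively onto $H^k(\mathbb R^n)$, and $A_s$ induces $G^s$: $G^s_\varphi(X,Y)=\int_{\mathbb R^n}\langle A_s(X\circ\varphi^{-1}),Y\circ\varphi^{-1}\rangle\,dx$ for $\varphi\in\mathrm{Diff}_c(\mathbb R^n)$ and all smooth compactly supported $X,Y:\mathbb R^n\to\mathbb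 R^n$. 2. Let $J\subseteq\mathbb R$ be an open interval and $\varphi:J\to\mathrm{Diff}_c(\mathbb R^n)$ a smooth curve (jointly smooth in $(t,x)$, with $\varphi(t,\cdot)-\mathrm{id}$ supported in a fixed compact set for $t$ in a compact subset of $J$). Put $u(t,\cdot)=\partial_t\varphi(t,\cdot)\circ\varphi(t,\cdot)^{-1}$ and $m=A_su$. Then $\varphi$ is a geodesic of $G^s$ (that is, for every $[c,d]\subset J$ it is a critical point of the energy $\frac12\int_c^d G^s_\varphi(\partial_t\varphi,\partial_t\varphi)\,dt$ under smooth variations with fixed end points) if and only if on $J\times\mathbb R^n$, for $k=1,\dots,n$, $$\partial_t m^k=-\sum_{i=1}^n\Big(m^i\,\partial_ku^i+(\partial_im^k)\,u^i+m^k\,\partial_iu^i\Big).$$ 3. The relation $u^k=A_s^{-1}m^k$ is a convolution with an explicit kernel: for all real Schwartz functions $u,m$ one has $m=A_su$ if and only if $$u=\begin{cases}\displaystyle(2\pi)^{-\frac n2}\,\frac{2^{1-s}|\cdot|^{s-\frac n2}}{\Gamma(s)}K_{s-\frac n2}(|\cdot|)\star m,& s>\frac{n-1}4,\\[2ex]\displaystyle(2\pi)^{-\frac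 n2}\,|\cdot|^{1-\frac n2}\int_0^\infty J_{\frac n2-1}(r|\cdot|)\,\frac{r^{n/2}}{(1+r^2)^s}\,dr\star m,& s\le\frac{n-1}4,\end{cases}$$ and this relation holds in particular between the components of $u(t,\cdot)$ and $m(t,\cdot)$ in part 2. Here $\star$ is ordinary convolution $f\star g(x)=\int f(y)g(x-y)\,dy$, and the integral exists absolutely for every $x$. In the second case the radial integral does not converge pointwise; $\int_0^\infty dr$ means $\lim_{R\to\infty}\int_0^R dr$ as a tempered distribution, so that $u(x)$ is the limit as $R\to\infty$ of the convolution of $m$ with the kernel for $[0,R]$. The Bessel functions are, for $r>0$ and real orders, $$J_\alpha(r)=\frac1\pi\int_0^\pi\cos(\alpha t-r\sin t)\,dt-\frac{\sin(\alpha\pi)}\pi\int_0^\infty e^{-r\sinh t-\alpha t}\,dt,\qquad K_\nu(r)=\int_0^\infty e^{-r\cosh t}\cosh(\nu t)\,dt .$$ 4. For $\nu>-\frac12$ and $r>0$, $K_\nu$ is also given by the convergent improper integral $$K_\nu(r)=\frac{\Gamma(\nu+\frac12)(2r)^\nu}{\sqrt\pi}\int_0^\infty\frac{\cos t}{(t^2+r^2)^{\nu+\frac12}}\,dt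 .$$ -/

import Mathlib

open MeasureTheory Set Filter Topology
open scoped ContDiff Manifold SchwartzMap FourierTransform Convolution

noncomputable section

namespace SobolevDiff

/-- The Euclidean space `ℝⁿ`. -/
abbrev E (n : ℕ) : Type := EuclideanSpace ℝ (Fin n)

/-! ### The operator `A_s` -/

/-- The symbol of `A_s = 𝓕⁻¹ (1 + |ξ|²)ˢ 𝓕`. Mathlib's Fourier transform has the phase
`exp (-2 π i ⟨x, ξ⟩)`, so that the frequency variable `ξ` of the unitary convention
`(2π)^(-n/2) ∫ exp (-i ⟨x, ξ⟩) f(x) dx` is `2 π` times the variable used here. -/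
def symbol (n : ℕ) (s : ℝ) (ξ : E n) : ℝ := (1 + (2 * Real.pi * ‖ξ‖) ^ 2) ^ s

/-- `A_s = 𝓕⁻¹ (1 + |ξ|²)ˢ 𝓕` on tempered distributions. -/
def opDist (n : ℕ) (s : ℝ) : 𝓢'(E n, ℂ) →L[ℂ] 𝓢'(E n, ℂ) :=
  TemperedDistribution.fourierMultiplierCLM ℂ (fun ξ : E n => ((symbol n s ξ : ℝ) : ℂ))

/-- `A_s = 𝓕⁻¹ (1 + |ξ|²)ˢ 𝓕` on complex-valued (Schwartz) functions. -/
def opC {n : ℕ} (s : ℝ) (f : E n → ℂ) : E n → ℂ :=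
  𝓕⁻ (fun ξ : E n => ((symbol n s ξ : ℝ) : ℂ) * 𝓕 f ξ)

/-- `A_s` on real-valued (Schwartz) functions. The symbol is even, so `A_s` of a real function is
real (`op_ofReal`), and taking the real part only changes the type. -/
def op {n : ℕ} (s : ℝ) (f : E n → ℝ) : E n → ℝ :=
  fun x => (opC s (fun y => (f y : ℂ)) x).re

theorem symbol_temperate (n : ℕ) (s : ℝ) : (symbol n s).HasTemperateGrowth := by
  have h := (Function.hasTemperateGrowth_one_add_norm_sq_rpow (E n) s).comp
    (((2 * Real.pi) • ContinuousLinearMap.id ℝ (E n)).hasTemperateGrowth)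
  have e : symbol n s = (fun x : E n => (1 + ‖x‖ ^ 2) ^ s) ∘
      ⇑((2 * Real.pi) • ContinuousLinearMap.id ℝ (E n)) := by
    funext ξ
    simp [symbol, norm_smul, abs_of_pos Real.pi_pos]
  rw [e]
  exact h

theorem symbolC_temperate (n : ℕ) (s : ℝ) :
    (fun ξ : E n => ((symbol n s ξ : ℝ) : ℂ)).HasTemperateGrowth := by
  have := symbol_temperate n s
  fun_prop

/-- On Schwartz functions `opC` is the Fourier multiplier of Mathlib; in particular `A_s` maps
Schwartz functions to Schwartz functions. -/
theorem opC_schwartz {n : ℕ} (s : ℝ) (f : 𝓢(E n, ℂ)) :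
    opC s f = SchwartzMap.fourierMultiplierCLM ℂ (fun ξ : E n => ((symbol n s ξ : ℝ) : ℂ)) f := by
  rw [SchwartzMap.fourierMultiplierCLM_apply, SchwartzMap.fourierInv_coe]
  unfold opC
  congr 1
  ext ξ
  rw [SchwartzMap.smulLeftCLM_apply_apply (symbolC_temperate n s), SchwartzMap.fourier_coe]
  simp

/-- The operators on functions and on tempered distributions agree. -/
theorem opDist_schwartz {n : ℕ} (s : ℝ) (f : 𝓢(E n, ℂ)) :
    ∃ g : 𝓢(E n, ℂ), opC s f = g ∧ opDist n s (f : 𝓢'(E n, ℂ)) = (g : 𝓢'(E n, ℂ)) :=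
  ⟨_, opC_schwartz s f, TemperedDistribution.fourierMultiplierCLM_toTemperedDistributionCLM_eq
    (symbolC_temperate n s) f⟩

theorem op_ofReal {n : ℕ} (s : ℝ) (f : E n → ℝ) (x : E n) :
    ((op s f x : ℝ) : ℂ) = opC s (fun y => (f y : ℂ)) x := by
  have hF : ∀ ξ : E n, starRingEnd ℂ (𝓕 (fun y => (f y : ℂ)) ξ) = 𝓕 (fun y => (f y : ℂ)) (-ξ) := by
    intro ξ
    rw [Real.fourier_eq', Real.fourier_eq', ← integral_conj]
    congr 1
    ext v
    simp [← Complex.exp_conj, map_ofNat]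
  apply Complex.conj_eq_iff_re.mp
  unfold opC
  rw [Real.fourierInv_eq', ← integral_conj, ← integral_neg_eq_self]
  congr 1
  ext v
  simp [← Complex.exp_conj, hF, symbol, map_ofNat]

/-! ### The group `Diff_c(ℝⁿ)` and the metric `Gˢ` -/

/-- `Diff_c(ℝⁿ)`: smooth diffeomorphisms which equal the identity off some compact set. -/
def DiffC (n : ℕ) : Type :=
  {φ : Diffeomorph 𝓘(ℝ, E n) 𝓘(ℝ, E n) (E n) (E n) ∞ // HasCompactSupport (fun x => φ x - x)}

/-- Smooth compactly supported maps `ℝⁿ → ℝⁿ`: the Lie algebra `𝔛_c(ℝⁿ)`, and also every tangent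
space `T_φ Diff_c(ℝⁿ)`. -/
def IsTestField {n : ℕ} (X : E n → E n) : Prop := ContDiff ℝ ∞ X ∧ HasCompactSupport X

/-- Smooth families in `Diff_c(ℝⁿ)` over an open subset `U` of a parameter space: jointly smooth,
and supported in a fixed compact set while the parameter ranges over a compact set. -/
structure IsSmoothFamily {n : ℕ} {P : Type*} [NormedAddCommGroup P] [NormedSpace ℝ P]
    (U : Set P) (φ : P → DiffC n) : Prop where
  smooth : ContDiffOn ℝ ∞ (fun q : P × E n => (φ q.1).1 q.2) (U ×ˢ univ)
  support : ∀ K ⊆ U, IsCompact K → ∃ L : Set (E n), IsCompact L ∧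
    ∀ p ∈ K, ∀ x ∉ L, (φ p).1 x = x

/-- The inner product `⟨X, Y⟩_{Hˢ}` belonging to the norm
`‖X‖²_{Hˢ} = ‖𝓕⁻¹ (1 + |ξ|²)^(s/2) 𝓕 X‖²_{L²}`. -/
def innerH {n : ℕ} (s : ℝ) (X Y : E n → E n) : ℝ :=
  ∑ k, ∫ x, op (s / 2) (fun y => X y k) x * op (s / 2) (fun y => Y y k) x

/-- The right-invariant Sobolev metric `Gˢ_φ(X, Y) = ⟨X ∘ φ⁻¹, Y ∘ φ⁻¹⟩_{Hˢ}`. -/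
def metricG {n : ℕ} (s : ℝ) (φ : DiffC n) (X Y : E n → E n) : ℝ :=
  innerH s (X ∘ φ.1.symm) (Y ∘ φ.1.symm)

/-- The tangent vector `∂_t φ(t, ·) ∈ T_{φ(t)} Diff_c(ℝⁿ)` of a curve. -/
def tangent {n : ℕ} (φ : ℝ → DiffC n) (t : ℝ) : E n → E n :=
  fun x => deriv (fun τ => (φ τ).1 x) t

/-- The (right-trivialized) velocity field `u(t, ·) = ∂_t φ(t, ·) ∘ φ(t, ·)⁻¹`. -/
def velocity {n : ℕ} (φ : ℝ → DiffC n) (t : ℝ) : E n → E n :=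
  tangent φ t ∘ (φ t).1.symm

/-- The `Gˢ`-energy of the curve `φ` on `[c, d]`. -/
def energy {n : ℕ} (s c d : ℝ) (φ : ℝ → DiffC n) : ℝ :=
  (1 / 2) * ∫ t in c..d, metricG s (φ t) (tangent φ t) (tangent φ t)

/-- Geodesics of `Gˢ` on an open interval `J`: smooth curves which are critical points of the
energy on each compact subinterval, under smooth variations with fixed end points. -/
def IsGeodesic {n : ℕ} (s : ℝ) (J : Set ℝ) (φ : ℝ → DiffC n) : Prop :=
  IsSmoothFamily J φ ∧
  ∀ c d : ℝ, c < d → Icc c d ⊆ J → ∀ δ : ℝ, 0 < δ → ∀ Φ : ℝ × ℝ → DiffC n,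
    IsSmoothFamily (Ioo (-δ) δ ×ˢ J) Φ →
    (∀ t ∈ J, Φ (0, t) = φ t) →
    (∀ ε ∈ Ioo (-δ) δ, Φ (ε, c) = φ c ∧ Φ (ε, d) = φ d) →
    HasDerivAt (fun ε => energy s c d (fun t => Φ (ε, t))) 0 0

/-! ### The momentum equation -/

/-- The momentum `m(t, ·)ᵏ = A_s u(t, ·)ᵏ` of the curve `φ`. -/
def momentum {n : ℕ} (s : ℝ) (φ : ℝ → DiffC n) (t : ℝ) (k : Fin n) : E n → ℝ :=
  op s (fun y => velocity φ t y k)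

/-- The partial derivative `∂_i f`. -/
def pd {n : ℕ} (i : Fin n) (f : E n → ℝ) (x : E n) : ℝ :=
  fderiv ℝ f x (EuclideanSpace.single i 1)

/-- The equations `mᵏ_t = - ∑ᵢ (mⁱ ∂_k uⁱ + (∂_i mᵏ) uⁱ + mᵏ ∂_i uⁱ)`, `k = 1, …, n`, on `J × ℝⁿ`. -/
def MomentumEquation {n : ℕ} (J : Set ℝ) (u : ℝ → E n → E n) (m : ℝ → Fin n → E n → ℝ) : Prop :=
  ∀ t ∈ J, ∀ (k : Fin n) (x : E n),
    HasDerivAt (fun τ => m τ k x)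
      (-∑ i, (m t i x * pd k (fun y => u t y i) x +
        (pd i (m t k) x * u t x i + m t k x * pd i (fun y => u t y i) x))) t

/-! ### Bessel functions and kernels -/

/-- The Bessel function `J_α(r)` of the first kind, `r > 0`. -/
def besselJ (α r : ℝ) : ℝ :=
  1 / Real.pi * (∫ t in (0 : ℝ)..Real.pi, Real.cos (α * t - r * Real.sin t)) -
    Real.sin (α * Real.pi) / Real.pi *
      ∫ t in Ioi (0 : ℝ), Real.exp (-(r * Real.sinh t) - α * t)

/-- The modified Bessel function `K_ν(r)` of the second kind, `r > 0`, of arbitrary real order. -/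
def besselK (ν r : ℝ) : ℝ :=
  ∫ t in Ioi (0 : ℝ), Real.exp (-(r * Real.cosh t)) * Real.cosh (ν * t)

/-- The kernel `(2π)^(-n/2) 2^(1-s) |x|^(s-n/2) K_{s-n/2}(|x|) / Γ(s)`. -/
def kernelK (n : ℕ) (s : ℝ) (x : E n) : ℝ :=
  (2 * Real.pi) ^ (-((n : ℝ) / 2)) *
    ((2 : ℝ) ^ (1 - s) * ‖x‖ ^ (s - (n : ℝ) / 2) / Real.Gamma s *
      besselK (s - (n : ℝ) / 2) ‖x‖)

/-- The Hankel transform kernel with the radial integral extended over `[0, R]`: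
`(2π)^(-n/2) |x|^(1-n/2) ∫_0^R J_{n/2-1}(r |x|) r^(n/2) (1 + r²)^(-s) dr`. -/
def kernelJ (n : ℕ) (s R : ℝ) (x : E n) : ℝ :=
  (2 * Real.pi) ^ (-((n : ℝ) / 2)) *
    (‖x‖ ^ (1 - (n : ℝ) / 2) *
      ∫ r in (0 : ℝ)..R,
        besselJ ((n : ℝ) / 2 - 1) (r * ‖x‖) * (r ^ ((n : ℝ) / 2) / (1 + r ^ 2) ^ s))

/-- `u` is the convolution of `m` with the explicit kernel: the `K`-kernel for `s > (n-1)/4`, and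
the Hankel transform kernel otherwise. In the second case the improper radial integral
`∫_0^∞ = lim_{R → ∞} ∫_0^R` does not converge pointwise; the kernel is its limit as a tempered
distribution, so that the convolution with `m` is the limit of the convolutions of `m` with the
kernels for `[0, R]`. -/
def IsKernelConvolution {n : ℕ} (s : ℝ) (u m : E n → ℝ) : Prop :=
  (((n : ℝ) - 1) / 4 < s → ∀ x,
    ConvolutionExistsAt (kernelK n s) m x (ContinuousLinearMap.mul ℝ ℝ) volume ∧
    u x = (kernelK n s ⋆[ContinuousLinearMap.mul ℝ ℝ, volume] m) x) ∧
  (s ≤ ((n : ℝ) - 1) / 4 → ∀ x,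
    (∀ R > 0, ConvolutionExistsAt (kernelJ n s R) m x (ContinuousLinearMap.mul ℝ ℝ) volume) ∧
    Tendsto (fun R => (kernelJ n s R ⋆[ContinuousLinearMap.mul ℝ ℝ, volume] m) x) atTop
      (𝓝 (u x)))

end SobolevDiff

end

noncomputable section

namespace SobolevDiff

/-! ### The operators `A_s` on Sobolev spaces -/

/-! Mapping properties. The symbols multiply, so `A_s A_t = A_{s+t}` and `A_{-s}` inverts `A_s`. On
Sobolev spaces the symbol differs from the Bessel potential weight of order `2s` only by a bounded
multiplier. Since the symbol is even, `A_s` is symmetric for the real `L²` pairing, and moving one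
factor `A_{s/2}` across gives the formula for `Gˢ`.

Geodesics. For a two-parameter family `Φ(ε, t)` put `u = ∂_tΦ ∘ Φ⁻¹` and `h = ∂_εΦ ∘ Φ⁻¹`. Symmetry
of second derivatives gives `∂_ε u = ∂_t h + dh·u - du·h` (`rightField_curvature`). By symmetry of
`A_s` the energy has derivative `∫ ⟨m, ∂_ε u⟩ dt`. Integrating by parts in space (`pairSum_bracket`)
and in time (`integral_pairSum_velocityVariation`) turns this into `-∫ ⟨defect, h⟩ dt`, where
`defect` is the difference of the two sides of the momentum equation (`first_variation`). The
variations `φ + ε η(t) w ∘ φ` realize every `h = η(t) w(y)`, so the fundamental lemma of the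
calculus of variations gives the equivalence. As `A_s` is nonlocal, pointwise differentiation in `t`
does not suffice: smooth families with locally common compact support are shown to be continuous and
differentiable into Schwartz space, where `A_s` is continuous
(`IsSmoothCompact.hasDerivAt_schwartz`).

Kernels. For `s > 0` the symbol of `A_{-s}` is a Gamma integral of Gaussians, whose Fourier
transforms are heat kernels. Integrating these yields the `K`-kernel (`kernelK_convolution`), and `s
> (n-1)/4` implies `s > 0`. For the Hankel kernel the symbol is cut off at frequency `R`. Its
Fourier transform is radial; slicing by hyperplanes and polar coordinates reduce it to Poisson's
integral, which is matched with `besselJ` by induction from the orders `0` and `1/2` (`poisson_eq`).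
The factor `𝓕 m` dominates the limit `R → ∞`. Both kernels thus compute `A_{-s} m`, and
invertibility of `A_s` on Schwartz functions gives the equivalence.

Basset's formula. Writing `(t² + r²)^(-ν-1/2)` as a Gamma integral and exchanging integrals leaves a
Fourier integral of a Gaussian and then the heat kernel representation of `K_ν`. The limit passes
through because the truncated cosine integrals are bounded by `1` (`abs_integral_cos_gaussian_le`).
-/

theorem symbol_pos (n : ℕ) (s : ℝ) (ξ : E n) : 0 < symbol n s ξ := by
  unfold symbol; positivity

theorem symbol_add (n : ℕ) (s t : ℝ) (ξ : E n) :
    symbol n s ξ * symbol n t ξ = symbol n (s + t) ξ := by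
  unfold symbol
  rw [Real.rpow_add (by positivity)]

theorem symbol_zero (n : ℕ) (ξ : E n) : symbol n 0 ξ = 1 := by simp [symbol]

theorem symbol_neg_arg (n : ℕ) (s : ℝ) (ξ : E n) : symbol n s (-ξ) = symbol n s ξ := by
  simp [symbol]

theorem opDist_opDist (n : ℕ) (s t : ℝ) (f : 𝓢'(E n, ℂ)) :
    opDist n s (opDist n t f) = opDist n (s + t) f := by
  unfold opDist
  rw [TemperedDistribution.fourierMultiplierCLM_fourierMultiplierCLM_apply
    (symbolC_temperate n t) (symbolC_temperate n s)]
  congr 2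
  ext ξ
  simp only [Pi.mul_apply]
  rw [← symbol_add n s t ξ]
  push_cast
  ring

theorem opDist_zero (n : ℕ) (f : 𝓢'(E n, ℂ)) : opDist n 0 f = f := by
  unfold opDist
  simp [symbol_zero]

/-- The Sobolev weight lacks the factor `2π` carried by the symbol. The quotient of the two bases
lies between `1` and `(2π)²`, so its powers are bounded. -/
theorem rpow_quotient_bound (n : ℕ) (s : ℝ) :
    ∃ C, ∀ x : E n, ‖((symbol n s x * (1 + ‖x‖ ^ 2) ^ (-s) : ℝ) : ℂ)‖ ≤ C := by
  have hpi := Real.pi_gt_three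
  set c : ℝ := (2 * Real.pi) ^ 2 with hc
  have hc1 : 1 ≤ c := by rw [hc]; nlinarith
  refine ⟨c ^ |s|, fun x => ?_⟩
  have hx : 0 < 1 + ‖x‖ ^ 2 := by positivity
  set q : ℝ := (1 + (2 * Real.pi * ‖x‖) ^ 2) / (1 + ‖x‖ ^ 2) with hq
  have hq1 : 1 ≤ q := by
    rw [hq, le_div_iff₀ hx, mul_pow, ← hc]
    nlinarith [sq_nonneg ‖x‖]
  have hqc : q ≤ c := by
    rw [hq, div_le_iff₀ hx, mul_pow, ← hc]
    nlinarith [sq_nonneg ‖x‖]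
  have h : symbol n s x * (1 + ‖x‖ ^ 2) ^ (-s) = q ^ s := by
    rw [hq, Real.div_rpow (by positivity) hx.le, Real.rpow_neg hx.le]
    rfl
  rw [h, Complex.norm_real, Real.norm_eq_abs, abs_of_nonneg (by positivity)]
  -- As `q ≥ 1`, passing to `|s|` treats both signs of `s` at once.
  calc q ^ s ≤ q ^ |s| := Real.rpow_le_rpow_of_exponent_le hq1 (le_abs_self s)
    _ ≤ c ^ |s| := Real.rpow_le_rpow (by linarith) hqc (abs_nonneg s)

/-- `A_s` factors as the Bessel potential of order `2s`, which shifts the Sobolev order, followed by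
the bounded multiplier of `rpow_quotient_bound`. -/
theorem memSobolev_opDist (n : ℕ) (s k : ℝ) {f : 𝓢'(E n, ℂ)}
    (hf : TemperedDistribution.MemSobolev (k + 2 * s) 2 f) :
    TemperedDistribution.MemSobolev k 2 (opDist n s f) := by
  have ht : (fun x : E n => ((symbol n s x * (1 + ‖x‖ ^ 2) ^ (-s) : ℝ) : ℂ)).HasTemperateGrowth := by
    have := symbol_temperate n s
    have h2 := Function.hasTemperateGrowth_one_add_norm_sq_rpow (E n) (-s)
    fun_prop
  have h1 : TemperedDistribution.MemSobolev k 2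
      (TemperedDistribution.besselPotential (E n) ℂ (2 * s) f) := by
    rw [TemperedDistribution.memSobolev_besselPotential_iff, add_comm]
    exact hf
  have h2 := h1.fourierMultiplierCLM_of_bounded ht (rpow_quotient_bound n s)
  suffices e : opDist n s f = TemperedDistribution.fourierMultiplierCLM ℂ
      (fun x : E n => ((symbol n s x * (1 + ‖x‖ ^ 2) ^ (-s) : ℝ) : ℂ))
      (TemperedDistribution.besselPotential (E n) ℂ (2 * s) f) by
    rw [e]; exact h2
  unfold opDist TemperedDistribution.besselPotential
  rw [TemperedDistribution.fourierMultiplierCLM_fourierMultiplierCLM_apply (by fun_prop) ht]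
  congr 2
  ext x
  have hx : 0 < 1 + ‖x‖ ^ 2 := by positivity
  simp only [Pi.mul_apply, ← Complex.ofReal_mul, Complex.ofReal_inj]
  rw [mul_left_comm, ← Real.rpow_add hx]
  simp

theorem bijOn_opDist (n : ℕ) (s k : ℝ) : BijOn (opDist n s)
      {f | TemperedDistribution.MemSobolev (k + 2 * s) 2 f}
      {f | TemperedDistribution.MemSobolev k 2 f} := by
  have inv : ∀ (s : ℝ) (f : 𝓢'(E n, ℂ)), opDist n (-s) (opDist n s f) = f := by
    intro s f
    rw [opDist_opDist, neg_add_cancel, opDist_zero]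
  refine ⟨fun f hf => memSobolev_opDist n s k hf, fun f _ g _ h => ?_, fun g hg => ?_⟩
  · rw [← inv s f, ← inv s g, h]
  · refine ⟨opDist n (-s) g, memSobolev_opDist n (-s) (k + 2 * s) ?_, ?_⟩
    · have : k + 2 * s + 2 * -s = k := by ring
      rw [this]; exact hg
    · have := inv (-s) g
      rwa [neg_neg] at this

/-! ### The operators `A_s` on real Schwartz functions -/

/-- The complexification of a real Schwartz function. -/
def toC {n : ℕ} : 𝓢(E n, ℝ) →L[ℝ] 𝓢(E n, ℂ) := SchwartzMap.postcompCLM Complex.ofRealCLM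

theorem toC_apply {n : ℕ} (f : 𝓢(E n, ℝ)) (x : E n) : toC f x = (f x : ℂ) := rfl

/-- The Fourier multiplier `A_s` on complex Schwartz functions. -/
def opSC {n : ℕ} (s : ℝ) : 𝓢(E n, ℂ) →L[ℂ] 𝓢(E n, ℂ) :=
  SchwartzMap.fourierMultiplierCLM ℂ (fun ξ : E n => ((symbol n s ξ : ℝ) : ℂ))

/-- `A_s` on real Schwartz functions. -/
def opS {n : ℕ} (s : ℝ) : 𝓢(E n, ℝ) →L[ℝ] 𝓢(E n, ℝ) :=
  (SchwartzMap.postcompCLM Complex.reCLM) ∘L ((opSC s).restrictScalars ℝ) ∘L toC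

theorem opS_coe {n : ℕ} (s : ℝ) (f : 𝓢(E n, ℝ)) : (opS s f : E n → ℝ) = op s f := by
  ext x
  unfold op
  have := opC_schwartz s (toC f)
  rw [show (fun y => (f y : ℂ)) = toC f from rfl, this]
  rfl

theorem toC_opS {n : ℕ} (s : ℝ) (f : 𝓢(E n, ℝ)) : toC (opS s f) = opSC s (toC f) := by
  ext x
  rw [toC_apply, opS_coe, op_ofReal, show (fun y => (f y : ℂ)) = toC f from rfl, opC_schwartz]
  rfl

theorem toC_injective {n : ℕ} : Function.Injective (toC (n := n)) := by
  intro f g h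
  ext x
  have := DFunLike.congr_fun h x
  simpa [toC_apply] using this

theorem opSC_opSC {n : ℕ} (s t : ℝ) (f : 𝓢(E n, ℂ)) : opSC s (opSC t f) = opSC (s + t) f := by
  unfold opSC
  rw [SchwartzMap.fourierMultiplierCLM_fourierMultiplierCLM_apply
    (symbolC_temperate n s) (symbolC_temperate n t)]
  congr 1
  congr 1
  ext ξ
  simp only [Pi.mul_apply, ← Complex.ofReal_mul, symbol_add]

theorem opS_opS {n : ℕ} (s t : ℝ) (f : 𝓢(E n, ℝ)) : opS s (opS t f) = opS (s + t) f := by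
  apply toC_injective
  rw [toC_opS, toC_opS, toC_opS, opSC_opSC]

theorem opS_zero {n : ℕ} (f : 𝓢(E n, ℝ)) : opS 0 f = f := by
  apply toC_injective
  rw [toC_opS]
  unfold opSC
  simp [symbol_zero]

theorem opS_eq_iff {n : ℕ} (s : ℝ) (f g : 𝓢(E n, ℝ)) : g = opS s f ↔ f = opS (-s) g := by
  constructor
  · rintro rfl; rw [opS_opS, neg_add_cancel, opS_zero]
  · rintro rfl; rw [opS_opS, add_neg_cancel, opS_zero]

/-- The pairing is bilinear, without conjugation. Parseval turns the left side into the integral of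
symbol times `𝓕 f` times `𝓕⁻ g`, and the substitution `ξ ↦ -ξ` exchanges `f` and `g` because the
symbol is even. -/
theorem integral_opSC_mul {n : ℕ} (s : ℝ) (f g : 𝓢(E n, ℂ)) :
    ∫ x, opSC s f x * g x = ∫ x, f x * opSC s g x := by
  have key : ∀ f g : 𝓢(E n, ℂ), ∫ x, opSC s f x * g x =
      ∫ ξ, ((symbol n s ξ : ℝ) : ℂ) * 𝓕 f ξ * 𝓕⁻ g ξ := by
    intro f g
    unfold opSC
    rw [SchwartzMap.fourierMultiplierCLM_apply, SchwartzMap.integral_fourierInv_mul_eq]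
    congr 1
    ext ξ
    rw [SchwartzMap.smulLeftCLM_apply_apply (symbolC_temperate n s)]
    simp
  rw [key]
  have : ∫ x, f x * opSC s g x = ∫ x, opSC s g x * f x := by simp_rw [mul_comm]
  rw [this, key, ← integral_neg_eq_self]
  congr 1
  ext ξ
  have e1 : ∀ f : 𝓢(E n, ℂ), 𝓕⁻ f ξ = 𝓕 f (-ξ) := fun f => SchwartzMap.fourierInv_apply_eq f ▸ rfl
  have e2 : ∀ f : 𝓢(E n, ℂ), 𝓕 f ξ = 𝓕⁻ f (-ξ) := fun f => by
    rw [SchwartzMap.fourierInv_apply_eq]; simp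
  rw [symbol_neg_arg, ← e1, e2]
  ring

theorem integral_opS_mul {n : ℕ} (s : ℝ) (f g : 𝓢(E n, ℝ)) :
    ∫ x, opS s f x * g x = ∫ x, f x * opS s g x := by
  have := integral_opSC_mul s (toC f) (toC g)
  simp only [← toC_opS, toC_apply, ← Complex.ofReal_mul, integral_complex_ofReal] at this
  exact_mod_cast this

theorem integral_opS_half_mul {n : ℕ} (s : ℝ) (f g : 𝓢(E n, ℝ)) :
    ∫ x, opS (s / 2) f x * opS (s / 2) g x = ∫ x, opS s f x * g x := by
  rw [← integral_opS_mul, opS_opS, add_halves]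

/-! ### The metric in terms of `A_s` -/

/-- The components of a test field as real Schwartz functions. -/
def IsTestField.comp {n : ℕ} {X : E n → E n} (hX : IsTestField X) (k : Fin n) : 𝓢(E n, ℝ) :=
  HasCompactSupport.toSchwartzMap (f := fun y => X y k)
    (hX.2.comp_left (g := fun v : E n => v k) rfl)
    (by have := hX.1; fun_prop)

theorem innerH_eq {n : ℕ} (s : ℝ) {X Y : E n → E n} (hX : IsTestField X) (hY : IsTestField Y) :
    innerH s X Y = ∑ k, ∫ x, opS s (hX.comp k) x * hY.comp k x := by
  unfold innerH
  refine Finset.sum_congr rfl fun k _ => ?_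
  rw [← integral_opS_half_mul, opS_coe, opS_coe]
  rfl

theorem IsTestField.comp_symm {n : ℕ} {X : E n → E n} (hX : IsTestField X) (φ : DiffC n) :
    IsTestField (X ∘ φ.1.symm) :=
  ⟨hX.1.comp φ.1.symm.contMDiff.contDiff, hX.2.comp_homeomorph φ.1.symm.toHomeomorph⟩

theorem metricG_eq {n : ℕ} (s : ℝ) (φ : DiffC n) (X Y : E n → E n) (hX : IsTestField X)
    (hY : IsTestField Y) :
    metricG s φ X Y = ∑ k, ∫ x, op s (fun y => X (φ.1.symm y) k) x * Y (φ.1.symm x) k := by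
  unfold metricG
  rw [innerH_eq s (hX.comp_symm φ) (hY.comp_symm φ)]
  refine Finset.sum_congr rfl fun k _ => ?_
  rw [opS_coe]
  rfl

/-! ### Smooth families of compactly supported functions as maps into Schwartz space -/

section Families

universe u
variable {P : Type*} [NormedAddCommGroup P] [NormedSpace ℝ P]
  {X : Type u} [NormedAddCommGroup X] [NormedSpace ℝ X]
  {V : Type u} [NormedAddCommGroup V] [NormedSpace ℝ V]

/-- Jointly smooth functions on `U × X` which are, locally uniformly in the parameter, supported in
a compact set. -/
structure IsSmoothCompact (U : Set P) (f : P × X → V) : Prop where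
  smooth : ContDiffOn ℝ ∞ f (U ×ˢ univ)
  support : ∀ p ∈ U, ∃ L : Set X, IsCompact L ∧ ∀ᶠ q in 𝓝 p, ∀ x ∉ L, f (q, x) = 0

/-- The partial derivative in the space variable. -/
def dX (f : P × X → V) (q : P × X) : X →L[ℝ] V :=
  (fderiv ℝ f q).comp (ContinuousLinearMap.inr ℝ P X)

/-- The partial derivative in a direction of the parameter space. -/
def dP (v : P) (f : P × X → V) (q : P × X) : V := fderiv ℝ f q (v, 0)

variable {U : Set P} {f : P × X → V}

theorem prod_univ_mem_nhds (hU : IsOpen U) {q : P × X} (hq : q.1 ∈ U) :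
    (U ×ˢ univ : Set (P × X)) ∈ 𝓝 q :=
  (hU.prod isOpen_univ).mem_nhds ⟨hq, mem_univ _⟩

theorem contDiffAt_family (hf : ContDiffOn ℝ ∞ f (U ×ˢ univ)) (hU : IsOpen U)
    {q : P × X} (hq : q.1 ∈ U) : ContDiffAt ℝ ∞ f q :=
  hf.contDiffAt (prod_univ_mem_nhds hU hq)

theorem hasFDerivAt_dX (hf : ContDiffOn ℝ ∞ f (U ×ˢ univ)) (hU : IsOpen U) {p : P} (hp : p ∈ U)
    (x : X) : HasFDerivAt (fun y => f (p, y)) (dX f (p, x)) x := by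
  have h := (contDiffAt_family hf hU (q := (p, x)) hp).differentiableAt
    (by simp) |>.hasFDerivAt
  exact h.comp x (hasFDerivAt_prodMk_right p x)

theorem hasDerivAt_dP (hf : ContDiffOn ℝ ∞ f (U ×ˢ univ)) (hU : IsOpen U) {p v : P} {t : ℝ}
    (hp : p + t • v ∈ U) (x : X) :
    HasDerivAt (fun τ : ℝ => f (p + τ • v, x)) (dP v f (p + t • v, x)) t := by
  have h := (contDiffAt_family hf hU (q := (p + t • v, x)) hp).differentiableAt
    (by simp) |>.hasFDerivAt
  have h2 : HasDerivAt (fun τ : ℝ => (p + τ • v, x)) (v, (0 : X)) t := by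
    have h3 : HasDerivAt (fun τ : ℝ => p + τ • v) v t := by
      simpa using ((hasDerivAt_id t).smul_const v).const_add p
    exact h3.prodMk (hasDerivAt_const t x)
  exact h.comp_hasDerivAt t h2

theorem dX_contDiffOn (hf : ContDiffOn ℝ ∞ f (U ×ˢ univ)) (hU : IsOpen U) :
    ContDiffOn ℝ ∞ (dX f) (U ×ˢ univ) := by
  have := hf.fderiv_of_isOpen (m := ∞) (hU.prod isOpen_univ) (by simp)
  exact this.clm_comp contDiffOn_const

theorem dP_contDiffOn (hf : ContDiffOn ℝ ∞ f (U ×ˢ univ)) (hU : IsOpen U) (v : P) :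
    ContDiffOn ℝ ∞ (dP v f) (U ×ˢ univ) := by
  have := hf.fderiv_of_isOpen (m := ∞) (hU.prod isOpen_univ) (by simp)
  exact this.clm_apply contDiffOn_const

theorem fderiv_eq_zero_of_support {L : Set X} (hL : IsCompact L) {p : P}
    (h : ∀ᶠ q in 𝓝 p, ∀ x ∉ L, f (q, x) = 0) : ∀ x ∉ L, fderiv ℝ f (p, x) = 0 := by
  intro x hx
  have h1 : f =ᶠ[𝓝 (p, x)] fun _ => 0 := by
    rw [nhds_prod_eq]
    filter_upwards [h.prod_mk (hL.isClosed.isOpen_compl.mem_nhds hx)] with q hq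
    exact hq.1 q.2 hq.2
  rw [h1.fderiv_eq]
  simp

theorem IsSmoothCompact.dX (hf : IsSmoothCompact U f) (hU : IsOpen U) :
    IsSmoothCompact U (dX f) where
  smooth := dX_contDiffOn hf.smooth hU
  support p hp := by
    obtain ⟨L, hL, h⟩ := hf.support p hp
    refine ⟨L, hL, h.eventually_nhds.mono fun q hq x hx => ?_⟩
    simp [SobolevDiff.dX, fderiv_eq_zero_of_support hL hq x hx]

theorem IsSmoothCompact.dP (hf : IsSmoothCompact U f) (hU : IsOpen U) (v : P) :
    IsSmoothCompact U (dP v f) where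
  smooth := dP_contDiffOn hf.smooth hU v
  support p hp := by
    obtain ⟨L, hL, h⟩ := hf.support p hp
    refine ⟨L, hL, h.eventually_nhds.mono fun q hq x hx => ?_⟩
    simp [SobolevDiff.dP, fderiv_eq_zero_of_support hL hq x hx]

/-- This is the symmetry of the second derivative; it lets parameter derivatives pass through the
inductions on space derivatives. -/
theorem dP_dX (hf : ContDiffOn ℝ ∞ f (U ×ˢ univ)) (hU : IsOpen U) (v : P) {q : P × X}
    (hq : q.1 ∈ U) : dP v (dX f) q = dX (dP v f) q := by
  have hc := contDiffAt_family hf hU hq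
  have hs := hc.isSymmSndFDerivAt (by simpa using (mod_cast le_top : ((2 : ℕ∞) : WithTop ℕ∞) ≤ ∞))
  have hd : DifferentiableAt ℝ (fderiv ℝ f) q :=
    (hc.fderiv_right (m := 1) (mod_cast le_top : ((2 : ℕ∞) : WithTop ℕ∞) ≤ ∞)).differentiableAt (by simp)
  ext w
  have e1 : dP v (dX f) q w = fderiv ℝ (fderiv ℝ f) q (v, 0) (0, w) := by
    unfold dP dX
    rw [fderiv_clm_comp hd (by fun_prop)]
    simp
  have e2 : dX (dP v f) q w = fderiv ℝ (fderiv ℝ f) q (0, w) (v, 0) := by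
    unfold dP dX
    rw [fderiv_clm_apply hd (by fun_prop)]
    simp
  rw [e1, e2]
  exact hs.eq _ _

theorem IsSmoothCompact.hasCompactSupport (hf : IsSmoothCompact U f) {p : P} (hp : p ∈ U) :
    HasCompactSupport fun x => f (p, x) := by
  obtain ⟨L, hL, h⟩ := hf.support p hp
  exact HasCompactSupport.intro hL fun x hx => h.self_of_nhds x hx

theorem contDiff_slice (hf : ContDiffOn ℝ ∞ f (U ×ˢ univ)) {p : P} (hp : p ∈ U) :
    ContDiff ℝ ∞ fun x => f (p, x) := by
  rw [← contDiffOn_univ]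
  exact hf.comp (by fun_prop : ContDiffOn ℝ ∞ (fun x : X => (p, x)) univ) fun x _ => ⟨hp, mem_univ _⟩

theorem IsSmoothCompact.sub {g : P × X → V} (hf : IsSmoothCompact U f)
    (hg : IsSmoothCompact U g) : IsSmoothCompact U (fun q => f q - g q) where
  smooth := hf.smooth.sub hg.smooth
  support p hp := by
    obtain ⟨L, hL, h⟩ := hf.support p hp
    obtain ⟨M, hM, h'⟩ := hg.support p hp
    refine ⟨L ∪ M, hL.union hM, ?_⟩
    filter_upwards [h, h'] with q h1 h2 x hx
    rw [h1 x fun a => hx (Or.inl a), h2 x fun a => hx (Or.inr a), sub_zero]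

theorem IsSmoothCompact.freeze (hf : IsSmoothCompact U f) {p : P} (hp : p ∈ U) :
    IsSmoothCompact U (fun q => f (p, q.2)) where
  smooth := ((contDiff_slice hf.smooth hp).comp contDiff_snd).contDiffOn
  support r _ := by
    obtain ⟨L, hL, h⟩ := hf.support p hp
    exact ⟨L, hL, Eventually.of_forall fun q x hx => h.self_of_nhds x hx⟩

/-! ### Smooth compactly supported families in the Schwartz topology -/

/-- For `l = 0` this is continuity on a compact set of `x`, off which the family vanishes. For
higher `l` the family is replaced by its space derivative, whose slice at `p` vanishes too; hence
`V` is quantified inside the induction and shares the universe of `X`. -/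
theorem IsSmoothCompact.eventually_small (hU : IsOpen U) {p : P} (hp : p ∈ U) (l : ℕ) :
    ∀ {V : Type u} [NormedAddCommGroup V] [NormedSpace ℝ V] {f : P × X → V},
    IsSmoothCompact U f → (∀ x, f (p, x) = 0) → ∀ ε > 0,
    ∀ᶠ q in 𝓝 p, ∀ x, ‖iteratedFDeriv ℝ l (fun y => f (q, y)) x‖ ≤ ε := by
  induction l with
  | zero =>
    intro V _ _ f hf h0 ε hε
    obtain ⟨L, hL, h⟩ := hf.support p hp
    have h1 : ∀ᶠ q in 𝓝 p, ∀ x ∈ L, ‖f (q, x)‖ ≤ ε := by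
      refine hL.eventually_forall_of_forall_eventually fun x _ => ?_
      have hc : ContinuousAt f (p, x) :=
        (contDiffAt_family hf.smooth hU (q := (p, x)) hp).continuousAt
      have h2 : Tendsto (fun z => ‖f z‖) (𝓝 (p, x)) (𝓝 0) := by
        simpa [h0] using hc.norm.tendsto
      exact (h2.eventually_lt_const hε).mono fun z hz => hz.le
    filter_upwards [h, h1] with q hq hq1 x
    rw [norm_iteratedFDeriv_zero]
    by_cases hx : x ∈ L
    · exact hq1 x hx
    · rw [hq x hx, norm_zero]; exact hε.le
  | succ l ih =>
    intro V _ _ f hf h0 ε hε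
    have h1 := ih (hf.dX hU) (fun x => by
      rw [← (hasFDerivAt_dX hf.smooth hU hp x).fderiv]
      simp [h0]) ε hε
    filter_upwards [h1, hU.mem_nhds hp] with q hq hqU x
    rw [← norm_iteratedFDeriv_fderiv]
    have : fderiv ℝ (fun y => f (q, y)) = fun y => SobolevDiff.dX f (q, y) := by
      ext1 y
      exact (hasFDerivAt_dX hf.smooth hU hqU y).fderiv
    rw [this]
    exact hq x

/-- For `l = 0` the mean value inequality in `τ` applies: the remainder has derivative `dP v f` at
the moving parameter minus its value at `p`, which is uniformly small by `eventually_small`. Higher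
`l` follow by passing to `dX f`, using `dP_dX`. -/
theorem IsSmoothCompact.eventually_taylor (hU : IsOpen U) {p : P} (hp : p ∈ U) (v : P) (l : ℕ) :
    ∀ {V : Type u} [NormedAddCommGroup V] [NormedSpace ℝ V] {f : P × X → V},
    IsSmoothCompact U f → ∀ ε > 0, ∀ᶠ τ in 𝓝 (0 : ℝ), ∀ x,
      ‖iteratedFDeriv ℝ l (fun y => f (p + τ • v, y) - f (p, y) - τ • SobolevDiff.dP v f (p, y)) x‖
        ≤ ε * |τ| := by
  have hcont : Tendsto (fun τ : ℝ => p + τ • v) (𝓝 0) (𝓝 p) := by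
    have : Continuous fun τ : ℝ => p + τ • v := by fun_prop
    simpa using this.tendsto 0
  induction l with
  | zero =>
    intro V _ _ f hf ε hε
    have h1 := IsSmoothCompact.eventually_small hU hp 0
      ((hf.dP hU v).sub ((hf.dP hU v).freeze hp)) (by simp) ε hε
    have h2 := hcont.eventually (h1.and (hU.mem_nhds hp))
    obtain ⟨r, hr, hball⟩ := Metric.eventually_nhds_iff_ball.mp h2
    filter_upwards [Metric.ball_mem_nhds (0 : ℝ) hr] with τ hτ x
    rw [norm_iteratedFDeriv_zero]
    have := (convex_ball (0 : ℝ) r).norm_image_sub_le_of_norm_hasDerivWithin_le (𝕜 := ℝ)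
      (f := fun σ : ℝ => f (p + σ • v, x) - σ • SobolevDiff.dP v f (p, x))
      (f' := fun σ => SobolevDiff.dP v f (p + σ • v, x) - SobolevDiff.dP v f (p, x))
      (C := ε) (x := 0) (y := τ) (fun σ hσ => by
        have h3 := hasDerivAt_dP hf.smooth hU (hball σ hσ).2 x
        have h4 := h3.sub ((hasDerivAt_id σ).smul_const (SobolevDiff.dP v f (p, x)))
        rw [one_smul] at h4
        exact h4.hasDerivWithinAt) (fun σ hσ => by
        have := (hball σ hσ).1 x
        rwa [norm_iteratedFDeriv_zero] at this) (Metric.mem_ball_self hr) hτ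
    simp only [zero_smul, add_zero, sub_zero, Real.norm_eq_abs] at this
    convert this using 2
    abel
  | succ l ih =>
    intro V _ _ f hf ε hε
    have h1 := ih (hf.dX hU) ε hε
    filter_upwards [h1, hcont.eventually (hU.mem_nhds hp)] with τ hτ hτU x
    rw [← norm_iteratedFDeriv_fderiv]
    convert hτ x using 3
    ext1 y
    rw [dP_dX hf.smooth hU v (q := (p, y)) hp]
    exact (((hasFDerivAt_dX hf.smooth hU hτU y).sub (hasFDerivAt_dX hf.smooth hU hp y)).sub
      ((hasFDerivAt_dX (hf.dP hU v).smooth hU hp y).const_smul τ)).fderiv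

/-- On a common compact support the polynomial weights of the Schwartz seminorms are bounded, so
uniform convergence of each derivative is enough. -/
theorem tendsto_schwartz_zero {ι : Type*} {l : Filter ι} {S : ι → 𝓢(X, V)} {L : Set X}
    (hL : IsCompact L) (hS : ∀ᶠ i in l, ∀ x ∉ L, S i x = 0)
    (h : ∀ k, ∀ ε > 0, ∀ᶠ i in l, ∀ x, ‖iteratedFDeriv ℝ k (S i) x‖ ≤ ε) :
    Tendsto S l (𝓝 0) := by
  rw [(schwartz_withSeminorms ℝ X V).tendsto_nhds]
  rintro ⟨k, m⟩ ε hε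
  obtain ⟨R, hR⟩ := hL.isBounded.exists_norm_le
  set R' := max R 0 with hR'
  have hR0 : 0 ≤ R' := le_max_right _ _
  -- The summand `1` keeps the denominator positive when `R' ^ k = 0`; the half gives the strict
  -- inequality.
  set δ := ε / 2 / (R' ^ k + 1) with hδ
  have hδ0 : 0 < δ := by positivity
  filter_upwards [hS, h m δ hδ0] with i h1 h2
  rw [sub_zero]
  refine lt_of_le_of_lt (SchwartzMap.seminorm_le_bound ℝ k m (S i) (M := ε / 2) (by positivity)
    fun x => ?_) (by linarith)
  by_cases hx : x ∈ L
  · have h3 : ‖x‖ ^ k ≤ R' ^ k :=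
      pow_le_pow_left₀ (norm_nonneg _) ((hR x hx).trans (le_max_left _ _)) k
    calc ‖x‖ ^ k * ‖iteratedFDeriv ℝ m (S i) x‖ ≤ R' ^ k * δ := by
          gcongr; exact h2 x
      _ ≤ (R' ^ k + 1) * δ := by gcongr; linarith
      _ = ε / 2 := by rw [hδ]; field_simp
  · have h3 : (S i : X → V) =ᶠ[𝓝 x] fun _ => 0 := by
      filter_upwards [hL.isClosed.isOpen_compl.mem_nhds hx] with y hy
      exact h1 y hy
    have h4 := (h3.iteratedFDeriv ℝ m).self_of_nhds
    rw [h4]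
    simp; positivity

/-- A family of Schwartz functions which is given by a smooth compactly supported family. -/
def IsFamily (U : Set P) (f : P × X → V) (S : P → 𝓢(X, V)) : Prop :=
  ∀ p ∈ U, ∀ x, S p x = f (p, x)

theorem IsSmoothCompact.continuousAt_schwartz (hf : IsSmoothCompact U f) (hU : IsOpen U)
    {S : P → 𝓢(X, V)} (hS : IsFamily U f S) {p : P} (hp : p ∈ U) : ContinuousAt S p := by
  have hfz := hf.freeze hp
  have hsub := hf.sub hfz
  obtain ⟨L, hL, h⟩ := hsub.support p hp
  have key : Tendsto (fun q => S q - S p) (𝓝 p) (𝓝 0) := by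
    have hUp := hU.mem_nhds hp
    refine tendsto_schwartz_zero hL ?_ ?_
    · filter_upwards [h, hUp] with q hq hqU x hx
      rw [sub_apply, hS q hqU, hS p hp]
      exact hq x hx
    · intro k ε hε
      filter_upwards [IsSmoothCompact.eventually_small hU hp k hsub (by simp) ε hε, hUp]
        with q hq hqU x
      convert hq x using 3
      ext y
      rw [sub_apply, hS q hqU, hS p hp]
  have := key.add_const (S p)
  simpa [ContinuousAt] using this

/-- Schwartz space is not normed, so the derivative is taken after a continuous linear map `T` into
a normed space. The difference quotients themselves converge in the Schwartz topology, by
`eventually_taylor`. -/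
theorem IsSmoothCompact.hasDerivAt_schwartz (hf : IsSmoothCompact U f) (hU : IsOpen U)
    {S S' : P → 𝓢(X, V)} {v : P} (hS : IsFamily U f S) (hS' : IsFamily U (SobolevDiff.dP v f) S')
    {W : Type*} [NormedAddCommGroup W] [NormedSpace ℝ W] (T : 𝓢(X, V) →L[ℝ] W) {p : P} {t : ℝ}
    (hp : p + t • v ∈ U) :
    HasDerivAt (fun τ : ℝ => T (S (p + τ • v))) (T (S' (p + t • v))) t := by
  set p' := p + t • v with hp'
  have hcont : Tendsto (fun τ : ℝ => p' + τ • v) (𝓝 0) (𝓝 p') := by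
    have : Continuous fun τ : ℝ => p' + τ • v := by fun_prop
    simpa using this.tendsto 0
  have key : Tendsto (fun τ : ℝ => τ⁻¹ • (S (p' + τ • v) - S p') - S' p') (𝓝[≠] 0) (𝓝 0) := by
    obtain ⟨L, hL, h⟩ := hf.support p' hp
    obtain ⟨M, hM, h'⟩ := (hf.dP hU v).support p' hp
    have hUp : ∀ᶠ τ : ℝ in 𝓝[≠] 0, p' + τ • v ∈ U :=
      (hcont.eventually (hU.mem_nhds hp)).filter_mono nhdsWithin_le_nhds
    refine tendsto_schwartz_zero (hL.union hM) ?_ ?_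
    · filter_upwards [(hcont.eventually h).filter_mono nhdsWithin_le_nhds, hUp] with τ hτ hτU x hx
      simp only [sub_apply, smul_apply]
      rw [hS _ hτU, hS _ hp, hS' _ hp, hτ x fun a => hx (Or.inl a),
        h.self_of_nhds x fun a => hx (Or.inl a), h'.self_of_nhds x fun a => hx (Or.inr a)]
      simp
    · intro k ε hε
      filter_upwards [(IsSmoothCompact.eventually_taylor hU hp v k hf ε hε).filter_mono
        nhdsWithin_le_nhds, hUp, self_mem_nhdsWithin] with τ hτ hτU hτ0 x
      have hτ0' : τ ≠ 0 := hτ0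
      have e : (τ⁻¹ • (S (p' + τ • v) - S p') - S' p' : 𝓢(X, V)) =
          τ⁻¹ • (S (p' + τ • v) - S p' - τ • S' p') := by
        rw [smul_sub _ _ (τ • S' p'), smul_smul, inv_mul_cancel₀ hτ0', one_smul]
      have e2 : ((S (p' + τ • v) - S p' - τ • S' p' : 𝓢(X, V)) : X → V) =
          fun y => f (p' + τ • v, y) - f (p', y) - τ • SobolevDiff.dP v f (p', y) := by
        ext y
        simp only [sub_apply, smul_apply]
        rw [hS _ hτU, hS _ hp, hS' _ hp]
      rw [e]
      have e3 : ((τ⁻¹ • (S (p' + τ • v) - S p' - τ • S' p') : 𝓢(X, V)) : X → V) =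
          τ⁻¹ • ((S (p' + τ • v) - S p' - τ • S' p' : 𝓢(X, V)) : X → V) := rfl
      rw [e3, iteratedFDeriv_const_smul_apply ((SchwartzMap.smooth _ k).contDiffAt), norm_smul, e2,
        norm_inv, Real.norm_eq_abs]
      have : 0 < |τ| := abs_pos.mpr hτ0'
      rw [inv_mul_le_iff₀ this, mul_comm]
      exact hτ x
  have key2 : Tendsto (fun τ : ℝ => τ⁻¹ • (T (S (p' + τ • v)) - T (S p'))) (𝓝[≠] 0)
      (𝓝 (T (S' p'))) := by
    have h1 := (T.continuous.tendsto 0).comp key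
    have h2 := h1.add_const (T (S' p'))
    simpa [Function.comp_def] using h2
  rw [hasDerivAt_iff_tendsto_slope_zero]
  refine key2.congr fun τ => ?_
  rw [hp', add_assoc, ← add_smul]

end Families

/-! ### Smooth families of diffeomorphisms -/

theorem exists_equiv_of_injective {X : Type*} [NormedAddCommGroup X] [NormedSpace ℝ X]
    [FiniteDimensional ℝ X] (A : X →L[ℝ] X) (hA : Function.Injective A) :
    ∃ e : X ≃L[ℝ] X, (e : X →L[ℝ] X) = A := by
  refine ⟨(LinearEquiv.ofInjectiveEndo (A : X →ₗ[ℝ] X) hA).toContinuousLinearEquiv, ?_⟩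
  ext x
  rfl

section Families

variable {n : ℕ} {P : Type*} [NormedAddCommGroup P] [NormedSpace ℝ P] {U : Set P}
  {Φ : P → DiffC n}

/-- The evaluation map `(p, x) ↦ Φ_p(x)` of a family of diffeomorphisms. -/
def evalMap (Φ : P → DiffC n) (q : P × E n) : E n := (Φ q.1).1 q.2

/-- The map `(p, y) ↦ Φ_p⁻¹(y)`. -/
def invMap (Φ : P → DiffC n) (q : P × E n) : E n := (Φ q.1).1.symm q.2

theorem evalMap_invMap (Φ : P → DiffC n) (p : P) (y : E n) :
    evalMap Φ (p, invMap Φ (p, y)) = y := (Φ p).1.apply_symm_apply y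

theorem invMap_evalMap (Φ : P → DiffC n) (p : P) (x : E n) :
    invMap Φ (p, evalMap Φ (p, x)) = x := (Φ p).1.symm_apply_apply x

/-- The displacement `(p, x) ↦ Φ_p(x) - x`. -/
def displacement (Φ : P → DiffC n) (q : P × E n) : E n := evalMap Φ q - q.2

/-- The right-trivialized derivative `(p, y) ↦ ∂_v Φ_p (Φ_p⁻¹(y))` in the direction `v` of the
parameter. -/
def rightField (Φ : P → DiffC n) (v : P) (q : P × E n) : E n :=
  dP v (displacement Φ) (q.1, invMap Φ q)

theorem displacement_isSmoothCompact [FiniteDimensional ℝ P] (hΦ : IsSmoothFamily U Φ)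
    (hU : IsOpen U) : IsSmoothCompact U (displacement Φ) where
  smooth := hΦ.smooth.sub contDiffOn_snd
  support p hp := by
    have : ProperSpace P := FiniteDimensional.proper ℝ P
    obtain ⟨K, hK, hpK, hKU⟩ := exists_compact_subset hU hp
    obtain ⟨L, hL, h⟩ := hΦ.support K hKU hK
    refine ⟨L, hL, ?_⟩
    filter_upwards [mem_interior_iff_mem_nhds.mp hpK] with q hq x hx
    simp [displacement, evalMap, h q hq x hx]

/-- The derivative of the inverse diffeomorphism is a left inverse. -/
theorem dX_evalMap_injective (hΦ : IsSmoothFamily U Φ) (hU : IsOpen U) {p : P} (hp : p ∈ U)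
    (x : E n) : Function.Injective (dX (evalMap Φ) (p, x)) := by
  have h1 : HasFDerivAt (fun y => evalMap Φ (p, y)) (dX (evalMap Φ) (p, x)) x :=
    hasFDerivAt_dX hΦ.smooth hU hp x
  have h2 : DifferentiableAt ℝ (fun y => invMap Φ (p, y)) (evalMap Φ (p, x)) :=
    ((Φ p).1.symm.contMDiff.contDiff.differentiable (by simp)) _
  have h3 : HasFDerivAt ((fun y => invMap Φ (p, y)) ∘ (fun y => evalMap Φ (p, y))) _ x :=
    h2.hasFDerivAt.comp x h1
  have h4 : (fun y => invMap Φ (p, y)) ∘ (fun y => evalMap Φ (p, y)) = id := by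
    ext1 y; exact invMap_evalMap Φ p y
  rw [h4] at h3
  have h5 := h3.unique (hasFDerivAt_id x)
  intro a b hab
  have ha := DFunLike.congr_fun h5 a
  have hb := DFunLike.congr_fun h5 b
  simp only [ContinuousLinearMap.comp_apply, ContinuousLinearMap.id_apply] at ha hb
  rw [← ha, ← hb, hab]

/-- The inverse function theorem is applied to `(p, x) ↦ (p, Φ_p(x))`, whose derivative is block
triangular and hence injective. Each `Φ_p` is injective, so the local inverse agrees with the global
`(p, y) ↦ (p, Φ_p⁻¹(y))`. -/
theorem invMap_contDiffOn [FiniteDimensional ℝ P] (hΦ : IsSmoothFamily U Φ) (hU : IsOpen U) :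
    ContDiffOn ℝ ∞ (invMap Φ) (U ×ˢ univ) := by
  have : CompleteSpace P := FiniteDimensional.complete ℝ P
  rintro ⟨p, y⟩ ⟨hp, -⟩
  apply ContDiffAt.contDiffWithinAt
  set x := invMap Φ (p, y) with hx
  let G : P × E n → P × E n := fun q => (q.1, evalMap Φ q)
  have hF : ContDiffAt ℝ ∞ (evalMap Φ) (p, x) := contDiffAt_family hΦ.smooth hU hp
  have hG : ContDiffAt ℝ ∞ G (p, x) := contDiffAt_fst.prodMk hF
  have hG' : HasFDerivAt G ((ContinuousLinearMap.fst ℝ P (E n)).prod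
      (fderiv ℝ (evalMap Φ) (p, x))) (p, x) :=
    hasFDerivAt_fst.prodMk (hF.differentiableAt (by simp)).hasFDerivAt
  obtain ⟨e, he⟩ := exists_equiv_of_injective _ (show Function.Injective
      ((ContinuousLinearMap.fst ℝ P (E n)).prod (fderiv ℝ (evalMap Φ) (p, x))) by
    rw [injective_iff_map_eq_zero]
    rintro ⟨v, w⟩ h
    have h1 : v = 0 := congrArg Prod.fst h
    subst h1
    have h2 : dX (evalMap Φ) (p, x) w = 0 := congrArg Prod.snd h
    have h3 : w = 0 := dX_evalMap_injective hΦ hU hp x (by rw [h2, map_zero])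
    rw [h3]; rfl)
  rw [← he] at hG'
  have hinv := hG.to_localInverse hG' (by simp)
  have hr := (hG.hasStrictFDerivAt' hG' (by simp)).eventually_right_inverse
  have hGx : G (p, x) = (p, y) := by
    simp only [G, hx, evalMap_invMap]
  rw [hGx] at hinv hr
  refine (contDiffAt_snd.comp _ hinv).congr_of_eventuallyEq ?_
  filter_upwards [hr] with q hq
  have h1 := congrArg Prod.fst hq
  have h2 := congrArg Prod.snd hq
  simp only [G] at h1 h2
  change invMap Φ q = (hG.localInverse hG' _ q).2
  set z := hG.localInverse hG' (by simp) q with hz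
  have h3 : invMap Φ (q.1, evalMap Φ (q.1, z.2)) = z.2 := invMap_evalMap Φ q.1 z.2
  rw [← h3]
  have h4 : evalMap Φ (q.1, z.2) = q.2 := by
    rw [← h2, ← h1]; rfl
  rw [h4]

/-- Off the common support the diffeomorphisms near `p` fix `x`, hence so do their inverses, and the
parameter derivative of the displacement vanishes there. -/
theorem rightField_isSmoothCompact [FiniteDimensional ℝ P] (hΦ : IsSmoothFamily U Φ)
    (hU : IsOpen U) (v : P) : IsSmoothCompact U (rightField Φ v) where
  smooth := by
    have h1 := ((displacement_isSmoothCompact hΦ hU).dP hU v).smooth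
    exact h1.comp (contDiffOn_fst.prodMk (invMap_contDiffOn hΦ hU)) fun q hq => ⟨hq.1, mem_univ _⟩
  support p hp := by
    have hd := displacement_isSmoothCompact hΦ hU
    obtain ⟨L, hL, h⟩ := hd.support p hp
    refine ⟨L, hL, ?_⟩
    filter_upwards [h, h.eventually_nhds] with q hq hq' x hx
    have h1 : evalMap Φ (q, x) = x := sub_eq_zero.mp (hq x hx)
    have h2 : invMap Φ (q, x) = x := by
      conv_lhs => rw [← h1]
      exact invMap_evalMap Φ q x
    simp only [rightField, h2]
    simp [dP, fderiv_eq_zero_of_support hL hq' x hx]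

theorem dP_displacement (hΦ : IsSmoothFamily U Φ) (hU : IsOpen U) (v : P) {q : P × E n}
    (hq : q.1 ∈ U) : dP v (displacement Φ) q = dP v (evalMap Φ) q := by
  have h1 : DifferentiableAt ℝ (evalMap Φ) q :=
    (contDiffAt_family hΦ.smooth hU hq).differentiableAt (by simp)
  unfold dP displacement
  rw [fderiv_fun_sub h1 differentiableAt_snd, sub_apply, fderiv_snd]
  simp

theorem rightField_evalMap (hΦ : IsSmoothFamily U Φ) (hU : IsOpen U) (v : P) {p : P}
    (hp : p ∈ U) (x : E n) :
    rightField Φ v (p, evalMap Φ (p, x)) = dP v (evalMap Φ) (p, x) := by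
  unfold rightField
  simp only [invMap_evalMap]
  exact dP_displacement hΦ hU v hp

/-- The right-trivialized derivatives of a family of diffeomorphisms satisfy the zero curvature
equation. -/
theorem rightField_curvature [FiniteDimensional ℝ P] (hΦ : IsSmoothFamily U Φ) (hU : IsOpen U)
    (a b : P) {p : P} (hp : p ∈ U) (y : E n) :
    dP a (rightField Φ b) (p, y) + dX (rightField Φ b) (p, y) (rightField Φ a (p, y)) =
      dP b (rightField Φ a) (p, y) + dX (rightField Φ a) (p, y) (rightField Φ b (p, y)) := by
  -- Differentiating `rightField Φ b (p, Φ_p(x)) = ∂_b Φ_p(x)` in the direction `a` by the chain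
  -- rule produces the left side of the claim; the outcome `∂_a ∂_b Φ` is symmetric in `a` and `b`.
  have key : ∀ a b : P, ∀ x : E n, dP a (rightField Φ b) (p, evalMap Φ (p, x)) +
      dX (rightField Φ b) (p, evalMap Φ (p, x)) (rightField Φ a (p, evalMap Φ (p, x))) =
      dP a (dP b (evalMap Φ)) (p, x) := by
    intro a b x
    have hF : DifferentiableAt ℝ (evalMap Φ) (p, x) :=
      (contDiffAt_family hΦ.smooth hU (q := (p, x)) hp).differentiableAt (by simp)
    have hV : DifferentiableAt ℝ (rightField Φ b) (p, evalMap Φ (p, x)) :=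
      (contDiffAt_family (rightField_isSmoothCompact hΦ hU b).smooth hU
        (q := (p, evalMap Φ (p, x))) hp).differentiableAt (by simp)
    have h1 : HasFDerivAt (fun q : P × E n => rightField Φ b (q.1, evalMap Φ q)) _ (p, x) :=
      HasFDerivAt.comp (g := rightField Φ b) (f := fun q : P × E n => (q.1, evalMap Φ q)) (p, x)
        hV.hasFDerivAt (hasFDerivAt_fst.prodMk hF.hasFDerivAt)
    have h2 : (fun q : P × E n => rightField Φ b (q.1, evalMap Φ q)) =ᶠ[𝓝 (p, x)]
        dP b (evalMap Φ) := by
      filter_upwards [prod_univ_mem_nhds hU (q := (p, x)) hp] with q hq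
      exact rightField_evalMap hΦ hU b hq.1 q.2
    have h3 := (h2.hasFDerivAt_iff.mp h1).fderiv
    rw [rightField_evalMap hΦ hU a hp]
    conv_rhs => unfold dP
    change _ = fderiv ℝ (dP b (evalMap Φ)) (p, x) (a, 0)
    rw [h3]
    simp only [dP, dX, ContinuousLinearMap.comp_apply, ContinuousLinearMap.prod_apply,
      ContinuousLinearMap.inr_apply, ContinuousLinearMap.coe_fst']
    rw [← map_add]
    simp
  have hsymm : ∀ x, dP a (dP b (evalMap Φ)) (p, x) = dP b (dP a (evalMap Φ)) (p, x) := by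
    intro x
    have hc := contDiffAt_family hΦ.smooth hU (q := (p, x)) hp
    have hs := hc.isSymmSndFDerivAt
      (by simpa using (mod_cast le_top : ((2 : ℕ∞) : WithTop ℕ∞) ≤ ∞))
    have hd : DifferentiableAt ℝ (fderiv ℝ (evalMap Φ)) (p, x) :=
      (hc.fderiv_right (m := 1) (mod_cast le_top : ((2 : ℕ∞) : WithTop ℕ∞) ≤ ∞)).differentiableAt
        (by simp)
    unfold dP
    rw [fderiv_clm_apply hd (by fun_prop), fderiv_clm_apply hd (by fun_prop)]
    simp
    exact hs.eq _ _
  have hy := evalMap_invMap Φ p y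
  rw [← hy, key a b, key b a, hsymm]

end Families

/-! ### Perturbations of the identity -/

/-- With `C` a Lipschitz constant of `w` and `|a| C < 1`, the map is a perturbation of the identity
with Lipschitz constant below `1`, hence a homeomorphism. Its derivative is injective by the same
estimate: `v = -a w'(x) v` forces `‖v‖ ≤ |a| C ‖v‖`. -/
theorem exists_diffC_add_smul {n : ℕ} {w : E n → E n} (hw : IsTestField w) :
    ∃ r > 0, ∀ a : ℝ, |a| < r → ∃ ψ : DiffC n, ∀ x, ψ.1 x = x + a • w x := by
  obtain ⟨C, hC⟩ := hw.1.lipschitzWith_of_hasCompactSupport hw.2 (by simp)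
  refine ⟨1 / (C + 1), by positivity, fun a ha => ?_⟩
  have haC : |a| * C < 1 := by
    rw [lt_div_iff₀ (by positivity)] at ha
    nlinarith [abs_nonneg a]
  set f : E n → E n := fun x => x + a • w x with hf
  have hfs : ContDiff ℝ ∞ f := contDiff_id.add (hw.1.const_smul a)
  have happ : ApproximatesLinearOn f ((ContinuousLinearEquiv.refl ℝ (E n) : E n ≃L[ℝ] E n) :
      E n →L[ℝ] E n) univ (‖a‖₊ * C) := by
    intro x _ y _
    have h1 : f x - f y - (x - y) = a • (w x - w y) := by
      simp only [hf, smul_sub]; abel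
    have h2 : ‖w x - w y‖ ≤ C * ‖x - y‖ := by
      simpa [dist_eq_norm] using hC.dist_le_mul x y
    simp only [ContinuousLinearEquiv.coe_refl, ContinuousLinearMap.coe_id', id_eq]
    rw [h1, norm_smul, Real.norm_eq_abs]
    calc |a| * ‖w x - w y‖ ≤ |a| * (C * ‖x - y‖) := by gcongr
      _ = _ := by simp [mul_assoc]
  -- For `n = 0` the identity has norm `0`, whose inverse is `0`, so the strict inequality is
  -- available only in the nontrivial case.
  have hsmall : Subsingleton (E n) ∨ (‖a‖₊ * C : NNReal) <
      ‖((ContinuousLinearEquiv.refl ℝ (E n)).symm : E n →L[ℝ] E n)‖₊⁻¹ := by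
    rcases subsingleton_or_nontrivial (E n) with h | h
    · exact Or.inl h
    · right
      rw [← NNReal.coe_lt_coe]
      simpa using haC
  let e : E n ≃ₜ E n := happ.toHomeomorph f hsmall
  have he : ∀ x, e x = f x := fun x => rfl
  have hder : ∀ x, ∃ e' : E n ≃L[ℝ] E n, HasFDerivAt e (e' : E n →L[ℝ] E n) x := by
    intro x
    have hd : HasFDerivAt f (ContinuousLinearMap.id ℝ (E n) + a • fderiv ℝ w x) x :=
      (hasFDerivAt_id x).add
        ((hw.1.differentiable (by simp) x).hasFDerivAt.const_smul a)
    obtain ⟨e', he'⟩ := exists_equiv_of_injective _ (show Function.Injective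
        (ContinuousLinearMap.id ℝ (E n) + a • fderiv ℝ w x) by
      rw [injective_iff_map_eq_zero]
      intro v hv
      by_contra hv0
      have hv1 : 0 < ‖v‖ := norm_pos_iff.mpr hv0
      have h1 : v = -(a • fderiv ℝ w x v) := eq_neg_of_add_eq_zero_left hv
      have h2 : ‖fderiv ℝ w x v‖ ≤ C * ‖v‖ :=
        (ContinuousLinearMap.le_opNorm _ _).trans (by
          gcongr; exact norm_fderiv_le_of_lipschitz ℝ hC)
      have h3 : ‖v‖ ≤ |a| * (C * ‖v‖) := by
        calc ‖v‖ = |a| * ‖fderiv ℝ w x v‖ := by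
              conv_lhs => rw [h1]
              rw [norm_neg, norm_smul, Real.norm_eq_abs]
          _ ≤ _ := by gcongr
      nlinarith)
    exact ⟨e', he' ▸ hd⟩
  choose e' he' using hder
  refine ⟨⟨⟨e.toEquiv, hfs.contMDiff, (e.contDiff_symm he' hfs).contMDiff⟩, ?_⟩, fun x => rfl⟩
  have : (fun x => f x - x) = fun x => a • w x := by ext1 x; simp [hf]
  change HasCompactSupport fun x => f x - x
  rw [this]
  exact hw.2.smul_left (f := fun _ => a)

/-- The composition `ψ ∘ φ` in `Diff_c(ℝⁿ)`. -/
def DiffC.trans {n : ℕ} (φ ψ : DiffC n) : DiffC n :=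
  ⟨φ.1.trans ψ.1, by
    have h1 : HasCompactSupport fun x => ψ.1 (φ.1 x) - φ.1 x :=
      ψ.2.comp_homeomorph φ.1.toHomeomorph
    have h2 : (fun x => (φ.1.trans ψ.1) x - x) =
        (fun x => ψ.1 (φ.1 x) - φ.1 x) + fun x => φ.1 x - x := by
      ext1 x
      simp
    rw [h2]
    exact h1.add φ.2⟩

theorem DiffC.trans_apply {n : ℕ} (φ ψ : DiffC n) (x : E n) : (φ.trans ψ).1 x = ψ.1 (φ.1 x) := rfl

theorem DiffC.ext {n : ℕ} {φ ψ : DiffC n} (h : ∀ x, φ.1 x = ψ.1 x) : φ = ψ :=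
  Subtype.ext (Diffeomorph.ext h)

/-- Variations of a curve in `Diff_c(ℝⁿ)` with prescribed variation field `η(t) w(y)`. -/
theorem exists_variation {n : ℕ} {J : Set ℝ} {φ : ℝ → DiffC n}
    (hφ : IsSmoothFamily J φ) {η : ℝ → ℝ} (hη : ContDiff ℝ ∞ η) (hηc : HasCompactSupport η)
    {w : E n → E n} (hw : IsTestField w) :
    ∃ δ > 0, ∃ Φ : ℝ × ℝ → DiffC n, IsSmoothFamily (Ioo (-δ) δ ×ˢ J) Φ ∧
      ∀ ε ∈ Ioo (-δ) δ, ∀ t x, (Φ (ε, t)).1 x = (φ t).1 x + (ε * η t) • w ((φ t).1 x) := by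
  obtain ⟨r, hr, hψ⟩ := exists_diffC_add_smul hw
  obtain ⟨M, hM⟩ := hη.continuous.bounded_above_of_compact_support hηc
  have hM0 : 0 ≤ M := (norm_nonneg _).trans (hM 0)
  have : Nonempty (DiffC n) := ⟨φ 0⟩
  choose! ψ hψ using hψ
  -- With `|η| ≤ M`, this choice keeps `|ε η(t)| < r` for all `t` simultaneously.
  set δ := r / (M + 1) with hδ
  have hδ0 : 0 < δ := by positivity
  have hsmall : ∀ ε ∈ Ioo (-δ) δ, ∀ t, |ε * η t| < r := by
    intro ε hε t
    have h1 : |ε| < δ := abs_lt.mpr hε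
    rw [hδ, lt_div_iff₀ (by positivity)] at h1
    rw [abs_mul]
    have h2 : |η t| ≤ M := hM t
    nlinarith [abs_nonneg ε]
  refine ⟨δ, hδ0, fun p => (φ p.2).trans (ψ (p.1 * η p.2)), ⟨?_, ?_⟩, ?_⟩
  · have h1 : ContDiffOn ℝ ∞ (fun q : (ℝ × ℝ) × E n => (φ q.1.2).1 q.2)
        ((Ioo (-δ) δ ×ˢ J) ×ˢ univ) :=
      hφ.smooth.comp (f := fun q : (ℝ × ℝ) × E n => (q.1.2, q.2))
        (by fun_prop) fun q hq => ⟨hq.1.2, mem_univ _⟩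
    have h2 : ContDiffOn ℝ ∞ (fun q : (ℝ × ℝ) × E n => (φ q.1.2).1 q.2 +
        (q.1.1 * η q.1.2) • w ((φ q.1.2).1 q.2)) ((Ioo (-δ) δ ×ˢ J) ×ˢ univ) := by
      have h3 : ContDiffOn ℝ ∞ (fun q : (ℝ × ℝ) × E n => q.1.1 * η q.1.2)
        ((Ioo (-δ) δ ×ˢ J) ×ˢ univ) := ContDiff.contDiffOn (by fun_prop)
      exact h1.add (h3.fun_smul (hw.1.comp_contDiffOn h1))
    -- The diffeomorphisms `ψ` are chosen without any regularity in the parameter, but their values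
    -- are given by the explicit formula, which is jointly smooth.
    refine h2.congr fun q hq => ?_
    rw [DiffC.trans_apply, hψ _ (hsmall q.1.1 hq.1.1 q.1.2)]
  · intro K hK hKc
    obtain ⟨L, hL, h⟩ := hφ.support (Prod.snd '' K)
      (by rintro _ ⟨q, hq, rfl⟩; exact (hK hq).2) (hKc.image continuous_snd)
    refine ⟨L ∪ tsupport w, hL.union hw.2, fun p hp x hx => ?_⟩
    rw [DiffC.trans_apply, hψ _ (hsmall p.1 (hK hp).1 p.2),
      h p.2 (mem_image_of_mem _ hp) x fun a => hx (Or.inl a),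
      image_eq_zero_of_notMem_tsupport fun a => hx (Or.inr a)]
    simp
  · intro ε hε t x
    rw [DiffC.trans_apply, hψ _ (hsmall ε hε t)]

open scoped LineDeriv

/-! ### The pairing of vector-valued Schwartz functions -/

/-- Real Schwartz functions as elements of `L²`. -/
def toL2 {n : ℕ} : 𝓢(E n, ℝ) →L[ℝ] Lp ℝ 2 (volume : Measure (E n)) :=
  SchwartzMap.toLpCLM ℝ ℝ 2 volume

theorem inner_toL2 {n : ℕ} (f g : 𝓢(E n, ℝ)) :
    inner ℝ (toL2 f) (toL2 g) = ∫ x, f x * g x := by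
  rw [L2.inner_def]
  apply integral_congr_ae
  filter_upwards [f.coeFn_toLp 2 volume, g.coeFn_toLp 2 volume] with x hf hg
  change inner ℝ ((f.toLp 2 volume : E n → ℝ) x) ((g.toLp 2 volume : E n → ℝ) x) = _
  rw [hf, hg]
  simp [mul_comm]

/-- The `L²` pairing of vector-valued Schwartz functions. -/
def pairSum {n : ℕ} (f g : Fin n → 𝓢(E n, ℝ)) : ℝ := ∑ k, ∫ x, f k x * g k x

/-- Products of Schwartz functions. -/
def mulS {n : ℕ} (f g : 𝓢(E n, ℝ)) : 𝓢(E n, ℝ) :=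
  SchwartzMap.pairing (ContinuousLinearMap.mul ℝ ℝ) f g

theorem mulS_apply {n : ℕ} (f g : 𝓢(E n, ℝ)) (x : E n) : mulS f g x = f x * g x := rfl

/-- Partial derivatives of Schwartz functions. -/
def pdS {n : ℕ} (i : Fin n) (f : 𝓢(E n, ℝ)) : 𝓢(E n, ℝ) := ∂_{EuclideanSpace.single i (1 : ℝ)} f

theorem pdS_apply {n : ℕ} (i : Fin n) (f : 𝓢(E n, ℝ)) (x : E n) : pdS i f x = pd i f x :=
  SchwartzMap.lineDerivOp_apply_eq_fderiv _ f x

theorem pdS_mulS {n : ℕ} (i : Fin n) (f g : 𝓢(E n, ℝ)) (x : E n) :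
    pdS i (mulS f g) x = pdS i f x * g x + f x * pdS i g x := by
  simp only [pdS_apply, pd]
  have h : (mulS f g : E n → ℝ) = fun x => f x * g x := rfl
  rw [h, ((f.hasFDerivAt x).fun_mul (g.hasFDerivAt x)).fderiv]
  simp
  ring

theorem integral_mul_pdS {n : ℕ} (i : Fin n) (f g : 𝓢(E n, ℝ)) :
    ∫ x, f x * pdS i g x = -∫ x, pdS i f x * g x :=
  SchwartzMap.integral_mul_lineDerivOp_right_eq_neg_left f g _

/-- The transport terms of the momentum equation. -/
def flux {n : ℕ} (m u : Fin n → 𝓢(E n, ℝ)) (k : Fin n) : 𝓢(E n, ℝ) :=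
  ∑ i, (mulS (m i) (pdS k (u i)) + (mulS (pdS i (m k)) (u i) + mulS (m k) (pdS i (u i))))

theorem flux_apply {n : ℕ} (m u : Fin n → 𝓢(E n, ℝ)) (k : Fin n) (x : E n) :
    flux m u k x = ∑ i, (m i x * pd k (u i) x + (pd i (m k) x * u i x + m k x * pd i (u i) x)) := by
  simp [flux, sum_apply, mulS_apply, pdS_apply]

theorem integral_mulS_add {n : ℕ} (a b c : 𝓢(E n, ℝ)) :
    ∫ x, (a + b) x * c x = (∫ x, a x * c x) + ∫ x, b x * c x := by
  have h := integral_add (mulS a c).integrable (mulS b c).integrable (μ := volume)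
  simp only [mulS_apply, ← add_mul] at h
  exact h

theorem integral_mulS_sum {n : ℕ} {ι : Type*} (s : Finset ι) (a : ι → 𝓢(E n, ℝ)) (c : 𝓢(E n, ℝ)) :
    ∫ x, (∑ i ∈ s, a i) x * c x = ∑ i ∈ s, ∫ x, a i x * c x := by
  have h := integral_finsetSum (μ := volume) s fun i _ => (mulS (a i) c).integrable
  simp only [mulS_apply, ← Finset.sum_mul] at h
  rw [← h]
  simp [sum_apply]

/-- The transport terms `∂_i hᵏ uⁱ` are integrated by parts, which moves the derivative onto `mᵏ
uⁱ`; in the remaining terms the summation indices are renamed. Thus `flux` is, up to sign, the `L²`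
transpose of the bracket with `u`. -/
theorem pairSum_bracket {n : ℕ} (m u h b : Fin n → 𝓢(E n, ℝ))
    (hb : ∀ k x, b k x = ∑ i, (pd i (h k) x * u i x - pd i (u k) x * h i x)) :
    pairSum m b = -pairSum (flux m u) h := by
  have h1 : ∀ k, ∫ x, m k x * b k x =
      ∑ i, (-(∫ x, (pdS i (m k) x * u i x + m k x * pdS i (u i) x) * h k x)
        - ∫ x, m k x * pdS i (u k) x * h i x) := by
    intro k
    have e1 : ∀ i, ∫ x, mulS (m k) (u i) x * pdS i (h k) x =
        -∫ x, (pdS i (m k) x * u i x + m k x * pdS i (u i) x) * h k x := by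
      intro i
      rw [integral_mul_pdS]
      simp_rw [pdS_mulS]
    simp_rw [← e1]
    have e2 : ∀ i, (∫ x, mulS (m k) (u i) x * pdS i (h k) x) -
        ∫ x, m k x * pdS i (u k) x * h i x =
        ∫ x, (mulS (mulS (m k) (u i)) (pdS i (h k)) - mulS (mulS (m k) (pdS i (u k))) (h i)) x := by
      intro i
      exact (integral_sub (mulS (mulS (m k) (u i)) (pdS i (h k))).integrable
        (mulS (mulS (m k) (pdS i (u k))) (h i)).integrable).symm
    simp_rw [e2]
    rw [← integral_finsetSum _ fun i _ => SchwartzMap.integrable _]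
    congr 1
    ext x
    rw [hb, Finset.mul_sum]
    refine Finset.sum_congr rfl fun i _ => ?_
    simp only [sub_apply, mulS_apply, pdS_apply]
    ring
  have h2 : ∀ k, ∫ x, flux m u k x * h k x =
      ∑ i, ((∫ x, m i x * pdS k (u i) x * h k x) +
        ∫ x, (pdS i (m k) x * u i x + m k x * pdS i (u i) x) * h k x) := by
    intro k
    unfold flux
    rw [integral_mulS_sum]
    refine Finset.sum_congr rfl fun i _ => ?_
    rw [integral_mulS_add]
    rfl
  unfold pairSum
  simp_rw [h1, h2]
  simp only [Finset.sum_add_distrib, Finset.sum_sub_distrib, Finset.sum_neg_distrib]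
  -- Only the term `mᵏ ∂_i uᵏ hⁱ` occurs in `flux` with `i` and `k` interchanged.
  rw [Finset.sum_comm (f := fun k i => ∫ x, m k x * pdS i (u k) x * h i x)]
  ring

/-! ### Families of vector fields -/

section Families

variable {n : ℕ} {P : Type*} [NormedAddCommGroup P] [NormedSpace ℝ P] {U : Set P}
  {f g : P × E n → E n}

open Classical in
/-- The Schwartz functions given by a smooth compactly supported family. -/
def IsSmoothCompact.family {f : P × E n → ℝ} (hf : IsSmoothCompact U f) (p : P) : 𝓢(E n, ℝ) :=
  if h : p ∈ U then (hf.hasCompactSupport h).toSchwartzMap (contDiff_slice hf.smooth h) else 0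

theorem IsSmoothCompact.isFamily {f : P × E n → ℝ} (hf : IsSmoothCompact U f) :
    IsFamily U f hf.family := by
  intro p hp x
  unfold IsSmoothCompact.family
  rw [dif_pos hp]
  rfl

theorem IsSmoothCompact.component (hf : IsSmoothCompact U f) (k : Fin n) :
    IsSmoothCompact U (fun q => f q k) where
  smooth := by have := hf.smooth; fun_prop
  support p hp := by
    obtain ⟨L, hL, h⟩ := hf.support p hp
    refine ⟨L, hL, h.mono fun q hq x hx => ?_⟩
    rw [hq x hx]; rfl

theorem dP_component (hf : IsSmoothCompact U f) (hU : IsOpen U) (v : P) (k : Fin n) {q : P × E n}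
    (hq : q.1 ∈ U) : dP v (fun q => f q k) q = dP v f q k := by
  have h : DifferentiableAt ℝ f q := (contDiffAt_family hf.smooth hU hq).differentiableAt (by simp)
  have h2 := (EuclideanSpace.proj (𝕜 := ℝ) k : E n →L[ℝ] ℝ).hasFDerivAt.comp q h.hasFDerivAt
  unfold dP
  exact DFunLike.congr_fun h2.fderiv (v, 0)

/-- The components of a family of vector fields as families of Schwartz functions. -/
def IsSmoothCompact.fam (hf : IsSmoothCompact U f) (p : P) (k : Fin n) : 𝓢(E n, ℝ) :=
  (hf.component k).family p

theorem IsSmoothCompact.fam_apply (hf : IsSmoothCompact U f) {p : P} (hp : p ∈ U) (k : Fin n)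
    (x : E n) : hf.fam p k x = f (p, x) k := (hf.component k).isFamily p hp x

theorem IsSmoothCompact.isFamily_dP (hf : IsSmoothCompact U f) (hU : IsOpen U) (v : P)
    (k : Fin n) : IsFamily U (SobolevDiff.dP v (fun q => f q k)) (fun p => (hf.dP hU v).fam p k) := by
  intro p hp x
  rw [dP_component hf hU v k hp]
  exact (hf.dP hU v).fam_apply hp k x

theorem pd_fam (hf : IsSmoothCompact U f) (hU : IsOpen U) {p : P} (hp : p ∈ U) (i k : Fin n)
    (x : E n) : pd i (hf.fam p k) x = dX f (p, x) (EuclideanSpace.single i 1) k := by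
  have h1 : (hf.fam p k : E n → ℝ) = fun y => f (p, y) k := by
    ext y; exact hf.fam_apply hp k y
  have h2 := (EuclideanSpace.proj (𝕜 := ℝ) k : E n →L[ℝ] ℝ).hasFDerivAt.comp x
    (hasFDerivAt_dX hf.smooth hU hp x)
  unfold pd
  rw [h1]
  exact DFunLike.congr_fun h2.fderiv (EuclideanSpace.single i 1)

theorem IsSmoothCompact.add (hf : IsSmoothCompact U f) (hg : IsSmoothCompact U g) :
    IsSmoothCompact U (fun q => f q + g q) where
  smooth := hf.smooth.add hg.smooth
  support p hp := by
    obtain ⟨L, hL, h⟩ := hf.support p hp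
    obtain ⟨M, hM, h'⟩ := hg.support p hp
    refine ⟨L ∪ M, hL.union hM, ?_⟩
    filter_upwards [h, h'] with q h1 h2 x hx
    rw [h1 x fun a => hx (Or.inl a), h2 x fun a => hx (Or.inr a), add_zero]

theorem IsSmoothCompact.dX_apply (hf : IsSmoothCompact U f) (hU : IsOpen U)
    (hg : IsSmoothCompact U g) : IsSmoothCompact U (fun q => SobolevDiff.dX f q (g q)) where
  smooth := (hf.dX hU).smooth.clm_apply hg.smooth
  support p hp := by
    obtain ⟨L, hL, h⟩ := hg.support p hp
    refine ⟨L, hL, h.mono fun q hq x hx => ?_⟩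
    rw [hq x hx, map_zero]

theorem dX_apply_component (f : P × E n → E n) (q : P × E n) (w : E n) (k : Fin n) :
    dX f q w k = ∑ i, dX f q (EuclideanSpace.single i 1) k * w i := by
  conv_lhs => rw [← (EuclideanSpace.basisFun (Fin n) ℝ).sum_repr w]
  simp [mul_comm]

theorem pairSum_eq_inner (a b : Fin n → 𝓢(E n, ℝ)) :
    pairSum a b = ∑ k, inner ℝ (toL2 (a k)) (toL2 (b k)) := by
  simp_rw [inner_toL2]; rfl

theorem continuousOn_pairSum (hf : IsSmoothCompact U f) (hg : IsSmoothCompact U g)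
    (hU : IsOpen U) (A : 𝓢(E n, ℝ) →L[ℝ] 𝓢(E n, ℝ)) :
    ContinuousOn (fun p => pairSum (fun k => A (hf.fam p k)) (hg.fam p)) U := by
  simp_rw [pairSum_eq_inner]
  refine continuousOn_finsetSum _ fun k _ => ContinuousOn.inner (𝕜 := ℝ) ?_ ?_
  · intro p hp
    have h := (hf.component k).continuousAt_schwartz hU (hf.component k).isFamily hp
    exact (((toL2 ∘L A).continuous.continuousAt).comp h).continuousWithinAt
  · intro p hp
    have h := (hg.component k).continuousAt_schwartz hU (hg.component k).isFamily hp
    exact ((toL2.continuous.continuousAt).comp h).continuousWithinAt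

theorem hasDerivAt_pairSum (hf : IsSmoothCompact U f) (hg : IsSmoothCompact U g)
    (hU : IsOpen U) (A : 𝓢(E n, ℝ) →L[ℝ] 𝓢(E n, ℝ)) {p v : P} {t : ℝ} (hp : p + t • v ∈ U) :
    HasDerivAt (fun τ : ℝ => pairSum (fun k => A (hf.fam (p + τ • v) k)) (hg.fam (p + τ • v)))
      (pairSum (fun k => A ((hf.dP hU v).fam (p + t • v) k)) (hg.fam (p + t • v)) +
        pairSum (fun k => A (hf.fam (p + t • v) k)) ((hg.dP hU v).fam (p + t • v))) t := by
  simp_rw [pairSum_eq_inner]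
  rw [← Finset.sum_add_distrib]
  refine HasDerivAt.fun_sum fun k _ => ?_
  have h1 := (hf.component k).hasDerivAt_schwartz hU (hf.component k).isFamily
    (hf.isFamily_dP hU v k) (toL2 ∘L A) hp
  have h2 := (hg.component k).hasDerivAt_schwartz hU (hg.component k).isFamily
    (hg.isFamily_dP hU v k) toL2 hp
  have h3 := h1.inner ℝ h2
  rw [add_comm]
  exact h3

end Families

/-! ### The Euler–Arnold equation -/

section EulerArnold

variable {n : ℕ} {J : Set ℝ} {u h : ℝ × E n → E n}

/-- The momentum of a time-dependent vector field. -/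
def mom (s : ℝ) (hu : IsSmoothCompact J u) (t : ℝ) (k : Fin n) : 𝓢(E n, ℝ) := opS s (hu.fam t k)

/-- The amount by which a time-dependent vector field fails to satisfy the momentum equation. -/
def defect (s : ℝ) (hJ : IsOpen J) (hu : IsSmoothCompact J u) (t : ℝ) (k : Fin n) : 𝓢(E n, ℝ) :=
  mom s (hu.dP hJ 1) t k + flux (mom s hu t) (hu.fam t) k

/-- The variation of the velocity `u` induced by the variation field `h`. -/
def velocityVariation (u h : ℝ × E n → E n) (q : ℝ × E n) : E n :=
  dP 1 h q + (dX h q (u q) - dX u q (h q))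

theorem bracket_isSmoothCompact (hJ : IsOpen J) (hu : IsSmoothCompact J u)
    (hh : IsSmoothCompact J h) : IsSmoothCompact J (fun q => dX h q (u q) - dX u q (h q)) :=
  (hh.dX_apply hJ hu).sub (hu.dX_apply hJ hh)

theorem velocityVariation_isSmoothCompact (hJ : IsOpen J) (hu : IsSmoothCompact J u)
    (hh : IsSmoothCompact J h) : IsSmoothCompact J (velocityVariation u h) :=
  (hh.dP hJ 1).add (bracket_isSmoothCompact hJ hu hh)

theorem pairSum_add_left (a b c : Fin n → 𝓢(E n, ℝ)) :
    pairSum (fun k => a k + b k) c = pairSum a c + pairSum b c := by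
  unfold pairSum
  rw [← Finset.sum_add_distrib]
  exact Finset.sum_congr rfl fun k _ => integral_mulS_add _ _ _

theorem pairSum_comm (a b : Fin n → 𝓢(E n, ℝ)) : pairSum a b = pairSum b a := by
  unfold pairSum
  simp_rw [mul_comm]

theorem pairSum_add_right (a b c : Fin n → 𝓢(E n, ℝ)) :
    pairSum a (fun k => b k + c k) = pairSum a b + pairSum a c := by
  rw [pairSum_comm, pairSum_add_left, pairSum_comm b, pairSum_comm c]

theorem pairSum_flux (s : ℝ) (hJ : IsOpen J) (hu : IsSmoothCompact J u)
    (hh : IsSmoothCompact J h) {t : ℝ} (ht : t ∈ J) :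
    pairSum (mom s hu t) ((bracket_isSmoothCompact hJ hu hh).fam t) =
      -pairSum (flux (mom s hu t) (hu.fam t)) (hh.fam t) := by
  refine pairSum_bracket _ _ _ _ fun k x => ?_
  rw [IsSmoothCompact.fam_apply _ ht, PiLp.sub_apply, dX_apply_component h, dX_apply_component u,
    ← Finset.sum_sub_distrib]
  refine Finset.sum_congr rfl fun i _ => ?_
  rw [pd_fam hh hJ ht, pd_fam hu hJ ht, hu.fam_apply ht, hh.fam_apply ht]

/-- The bracket contributes `-⟨flux, h⟩`. Adding and subtracting `⟨∂_t m, h⟩` completes `⟨m, ∂_t h⟩`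
to a total time derivative and leaves the defect. -/
theorem pairSum_velocityVariation (s : ℝ) (hJ : IsOpen J) (hu : IsSmoothCompact J u)
    (hh : IsSmoothCompact J h) {t : ℝ} (ht : t ∈ J) :
    pairSum (mom s hu t) ((velocityVariation_isSmoothCompact hJ hu hh).fam t) =
      pairSum (mom s (hu.dP hJ 1) t) (hh.fam t) + pairSum (mom s hu t) ((hh.dP hJ 1).fam t) -
        pairSum (defect s hJ hu t) (hh.fam t) := by
  have h1 : (velocityVariation_isSmoothCompact hJ hu hh).fam t =
      fun k => (hh.dP hJ 1).fam t k + (bracket_isSmoothCompact hJ hu hh).fam t k := by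
    ext k x
    rw [add_apply, IsSmoothCompact.fam_apply _ ht, IsSmoothCompact.fam_apply _ ht,
      IsSmoothCompact.fam_apply _ ht]
    rfl
  rw [h1, pairSum_add_right, pairSum_flux s hJ hu hh ht]
  change _ = _ - pairSum (fun k => mom s (hu.dP hJ 1) t k + flux (mom s hu t) (hu.fam t) k) _
  rw [pairSum_add_left]
  ring

theorem hasDerivAt_pairSum_mom (s : ℝ) (hJ : IsOpen J) (hu : IsSmoothCompact J u)
    (hh : IsSmoothCompact J h) {t : ℝ} (ht : t ∈ J) :
    HasDerivAt (fun τ => pairSum (mom s hu τ) (hh.fam τ))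
      (pairSum (mom s (hu.dP hJ 1) t) (hh.fam t) +
        pairSum (mom s hu t) ((hh.dP hJ 1).fam t)) t := by
  have := hasDerivAt_pairSum hu hh hJ (opS s) (p := 0) (v := 1) (t := t) (by simpa using ht)
  simp only [smul_eq_mul, mul_one, zero_add] at this
  exact this

theorem continuousOn_pairSum_mom (s : ℝ) (hJ : IsOpen J) (hu : IsSmoothCompact J u)
    (hh : IsSmoothCompact J h) : ContinuousOn (fun t => pairSum (mom s hu t) (hh.fam t)) J :=
  continuousOn_pairSum hu hh hJ (opS s)

/-- Continuity is read off from `pairSum_velocityVariation`, whose other terms are pairings of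
smooth families; no continuity of `flux` in `t` has to be proved. -/
theorem continuousOn_pairSum_defect (s : ℝ) (hJ : IsOpen J) (hu : IsSmoothCompact J u)
    (hh : IsSmoothCompact J h) :
    ContinuousOn (fun t => pairSum (defect s hJ hu t) (hh.fam t)) J := by
  have h1 := ((continuousOn_pairSum_mom s hJ (hu.dP hJ 1) hh).add
    (continuousOn_pairSum_mom s hJ hu (hh.dP hJ 1))).sub
    (continuousOn_pairSum_mom s hJ hu (velocityVariation_isSmoothCompact hJ hu hh))
  refine h1.congr fun t ht => ?_
  simp only [Pi.sub_apply, Pi.add_apply]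
  rw [pairSum_velocityVariation s hJ hu hh ht]
  ring

/-- The total derivative integrates to the values of `⟨m, h⟩` at the end points, where `h` vanishes.
-/
theorem integral_pairSum_velocityVariation (s : ℝ) (hJ : IsOpen J) (hu : IsSmoothCompact J u)
    (hh : IsSmoothCompact J h) {c d : ℝ} (hcd : c < d) (hcdJ : Icc c d ⊆ J)
    (hc : ∀ x, h (c, x) = 0) (hd : ∀ x, h (d, x) = 0) :
    ∫ t in c..d, pairSum (mom s hu t) ((velocityVariation_isSmoothCompact hJ hu hh).fam t) =
      -∫ t in c..d, pairSum (defect s hJ hu t) (hh.fam t) := by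
  have hz : ∀ t ∈ J, (∀ x, h (t, x) = 0) → pairSum (mom s hu t) (hh.fam t) = 0 := by
    intro t ht h0
    unfold pairSum
    refine Finset.sum_eq_zero fun k _ => ?_
    simp [hh.fam_apply ht, h0]
  have hIcc : uIcc c d = Icc c d := uIcc_of_le hcd.le
  have hint : ∀ {f : ℝ → ℝ}, ContinuousOn f J → IntervalIntegrable f volume c d := fun hf =>
    (hf.mono (hIcc ▸ hcdJ)).intervalIntegrable
  have hFTC := intervalIntegral.integral_eq_sub_of_hasDerivAt (a := c) (b := d)
    (f := fun τ => pairSum (mom s hu τ) (hh.fam τ))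
    (fun t ht => hasDerivAt_pairSum_mom s hJ hu hh (hcdJ (hIcc ▸ ht)))
    (hint ((continuousOn_pairSum_mom s hJ (hu.dP hJ 1) hh).add
      (continuousOn_pairSum_mom s hJ hu (hh.dP hJ 1))))
  rw [hz c (hcdJ (left_mem_Icc.mpr hcd.le)) hc, hz d (hcdJ (right_mem_Icc.mpr hcd.le)) hd,
    sub_zero] at hFTC
  have h1 : ∫ t in c..d, pairSum (mom s hu t) ((velocityVariation_isSmoothCompact hJ hu hh).fam t) =
      ∫ t in c..d, ((pairSum (mom s (hu.dP hJ 1) t) (hh.fam t) +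
        pairSum (mom s hu t) ((hh.dP hJ 1).fam t)) - pairSum (defect s hJ hu t) (hh.fam t)) :=
    intervalIntegral.integral_congr fun t ht =>
      pairSum_velocityVariation s hJ hu hh (hcdJ (hIcc ▸ ht))
  rw [h1, intervalIntegral.integral_sub
    (hint ((continuousOn_pairSum_mom s hJ (hu.dP hJ 1) hh).fun_add
      (continuousOn_pairSum_mom s hJ hu (hh.dP hJ 1))))
    (hint (continuousOn_pairSum_defect s hJ hu hh)), hFTC, zero_sub]

end EulerArnold

/-! ### The first variation of the energy -/

theorem velocity_eq_rightField {n : ℕ} {P : Type*} [NormedAddCommGroup P] [NormedSpace ℝ P]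
    {U : Set P} {Φ : P → DiffC n} (hΦ : IsSmoothFamily U Φ) (hU : IsOpen U) {p v : P} {t : ℝ}
    (hp : p + t • v ∈ U) (y : E n) :
    velocity (fun τ => Φ (p + τ • v)) t y = rightField Φ v (p + t • v, y) := by
  have h1 := (hasDerivAt_dP (f := evalMap Φ) hΦ.smooth hU hp (invMap Φ (p + t • v, y))).deriv
  have h2 := rightField_evalMap hΦ hU v hp (invMap Φ (p + t • v, y))
  rw [evalMap_invMap] at h2
  rw [h2, ← h1]
  rfl

theorem innerH_eq_pairSum {n : ℕ} (s : ℝ) {X : E n → E n} (S : Fin n → 𝓢(E n, ℝ))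
    (hX : IsTestField X) (hS : ∀ k x, S k x = X x k) :
    innerH s X X = pairSum (fun k => opS s (S k)) S := by
  rw [innerH_eq s hX hX]
  have : ∀ k, hX.comp k = S k := fun k => by ext x; exact (hS k x).symm
  simp_rw [this]
  rfl

theorem IsSmoothCompact.isTestField {n : ℕ} {P : Type*} [NormedAddCommGroup P] [NormedSpace ℝ P]
    {U : Set P} {f : P × E n → E n} (hf : IsSmoothCompact U f) {p : P} (hp : p ∈ U) :
    IsTestField fun x => f (p, x) := ⟨contDiff_slice hf.smooth hp, hf.hasCompactSupport hp⟩

theorem velocity_eq_curve {n : ℕ} {J : Set ℝ} {φ : ℝ → DiffC n} (hφ : IsSmoothFamily J φ)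
    (hJ : IsOpen J) {t : ℝ} (ht : t ∈ J) (y : E n) :
    velocity φ t y = rightField φ 1 (t, y) := by
  have := velocity_eq_rightField hφ hJ (p := 0) (v := 1) (t := t) (by simpa using ht) y
  simpa using this

section Variation

variable {n : ℕ} {J : Set ℝ} {δ : ℝ} {Φ : ℝ × ℝ → DiffC n}

theorem isOpen_strip (hJ : IsOpen J) : IsOpen (Ioo (-δ) δ ×ˢ J) := isOpen_Ioo.prod hJ

theorem velocity_eq_strip (hΦ : IsSmoothFamily (Ioo (-δ) δ ×ˢ J) Φ) (hJ : IsOpen J) {ε t : ℝ}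
    (hε : ε ∈ Ioo (-δ) δ) (ht : t ∈ J) (y : E n) :
    velocity (fun τ => Φ (ε, τ)) t y = rightField Φ (0, 1) ((ε, t), y) := by
  have := velocity_eq_rightField hΦ (isOpen_strip hJ) (p := (ε, 0)) (v := (0, 1)) (t := t)
    (by simpa using ⟨hε, ht⟩) y
  simpa using this

theorem energy_eq (s : ℝ) (hΦ : IsSmoothFamily (Ioo (-δ) δ ×ˢ J) Φ) (hJ : IsOpen J)
    {c d : ℝ} (hcd : c < d) (hcdJ : Icc c d ⊆ J) {ε : ℝ} (hε : ε ∈ Ioo (-δ) δ)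
    (hu : IsSmoothCompact (Ioo (-δ) δ ×ˢ J) (rightField Φ (0, 1))) :
    energy s c d (fun t => Φ (ε, t)) =
      (1 / 2) * ∫ t in c..d, pairSum (fun k => opS s (hu.fam (ε, t) k)) (hu.fam (ε, t)) := by
  unfold energy
  congr 1
  refine intervalIntegral.integral_congr fun t ht => ?_
  rw [uIcc_of_le hcd.le] at ht
  have hp : (ε, t) ∈ Ioo (-δ) δ ×ˢ J := ⟨hε, hcdJ ht⟩
  have hv : (fun y => rightField Φ (0, 1) ((ε, t), y)) = velocity (fun τ => Φ (ε, τ)) t := by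
    ext1 y
    exact (velocity_eq_strip hΦ hJ hε (hcdJ ht) y).symm
  have h := hu.isTestField hp
  change innerH s (velocity (fun τ => Φ (ε, τ)) t) (velocity (fun τ => Φ (ε, τ)) t) = _
  rw [← hv]
  exact innerH_eq_pairSum s _ h fun k x => hu.fam_apply hp k x

theorem pairSum_opS_left (s : ℝ) (a b : Fin n → 𝓢(E n, ℝ)) :
    pairSum (fun k => opS s (a k)) b = pairSum a (fun k => opS s (b k)) :=
  Finset.sum_congr rfl fun _ _ => integral_opS_mul s _ _

/-- Symmetry of `A_s` makes the two terms of the product rule equal, which cancels the factor `1/2`.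
Differentiation under the integral is dominated by a constant, since the derivative is continuous on
a compact rectangle. -/
theorem hasDerivAt_energy (s : ℝ) (hΦ : IsSmoothFamily (Ioo (-δ) δ ×ˢ J) Φ) (hJ : IsOpen J)
    (hδ : 0 < δ) {c d : ℝ} (hcd : c < d) (hcdJ : Icc c d ⊆ J)
    (hu : IsSmoothCompact (Ioo (-δ) δ ×ˢ J) (rightField Φ (0, 1))) :
    HasDerivAt (fun ε => energy s c d (fun t => Φ (ε, t)))
      (∫ t in c..d, pairSum (fun k => opS s (hu.fam (0, t) k))
        ((hu.dP (isOpen_strip hJ) (1, 0)).fam (0, t))) 0 := by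
  have hU := isOpen_strip (δ := δ) hJ
  set F : ℝ → ℝ → ℝ := fun ε t => pairSum (fun k => opS s (hu.fam (ε, t) k)) (hu.fam (ε, t))
    with hF
  set F' : ℝ → ℝ → ℝ := fun ε t => 2 * pairSum (fun k => opS s (hu.fam (ε, t) k))
    ((hu.dP hU (1, 0)).fam (ε, t)) with hF'
  have hder : ∀ ε ∈ Ioo (-δ) δ, ∀ t ∈ J, HasDerivAt (fun e => F e t) (F' ε t) ε := by
    intro ε hε t ht
    have h := hasDerivAt_pairSum hu hu hU (opS s) (p := (0, t)) (v := (1, 0)) (t := ε)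
      (by simpa using ⟨hε, ht⟩)
    simp only [Prod.smul_mk, smul_eq_mul, mul_one, mul_zero, Prod.mk_add_mk, zero_add,
      add_zero] at h
    convert h using 1
    rw [hF']
    simp only
    rw [pairSum_opS_left s ((hu.dP hU (1, 0)).fam (ε, t)), pairSum_comm ((hu.dP hU (1, 0)).fam (ε, t))]
    ring
  have hcF : ContinuousOn (fun p : ℝ × ℝ => F p.1 p.2) (Ioo (-δ) δ ×ˢ J) :=
    continuousOn_pairSum hu hu hU (opS s)
  have hcF' : ContinuousOn (fun p : ℝ × ℝ => F' p.1 p.2) (Ioo (-δ) δ ×ˢ J) :=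
    (continuousOn_pairSum hu (hu.dP hU (1, 0)) hU (opS s)).const_mul 2
  have h0 : (0 : ℝ) ∈ Ioo (-δ) δ := ⟨by linarith, hδ⟩
  have hsub : Icc (-(δ / 2)) (δ / 2) ×ˢ Icc c d ⊆ Ioo (-δ) δ ×ˢ J :=
    prod_mono (fun x hx => ⟨by linarith [hx.1], by linarith [hx.2]⟩) hcdJ
  obtain ⟨C, hC⟩ := (isCompact_Icc.prod isCompact_Icc).exists_bound_of_continuousOn
    (hcF'.mono hsub)
  have hIcc : uIcc c d = Icc c d := uIcc_of_le hcd.le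
  have hint : ∀ {G : ℝ → ℝ → ℝ}, ContinuousOn (fun p : ℝ × ℝ => G p.1 p.2) (Ioo (-δ) δ ×ˢ J) →
      ∀ ε ∈ Ioo (-δ) δ, IntervalIntegrable (G ε) volume c d := by
    intro G hG ε hε
    apply ContinuousOn.intervalIntegrable
    rw [hIcc]
    exact hG.comp (f := fun t => (ε, t)) (by fun_prop) fun t ht => ⟨hε, hcdJ ht⟩
  have hnhds : Icc (-(δ / 2)) (δ / 2) ∈ 𝓝 (0 : ℝ) := Icc_mem_nhds (by linarith) (by linarith)
  have hmain := (intervalIntegral.hasDerivAt_integral_of_dominated_loc_of_deriv_le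
    (μ := volume) (a := c) (b := d) (F := F) (F' := F') (x₀ := 0)
    (s := Icc (-(δ / 2)) (δ / 2)) (bound := fun _ => C) hnhds
    (by
      filter_upwards [Ioo_mem_nhds h0.1 h0.2] with ε hε
      exact (intervalIntegrable_iff.mp (hint hcF ε hε)).aestronglyMeasurable)
    (hint hcF 0 h0) (intervalIntegrable_iff.mp (hint hcF' 0 h0)).aestronglyMeasurable
    (Eventually.of_forall fun t ht ε hε =>
      hC (ε, t) ⟨hε, hIcc ▸ uIoc_subset_uIcc ht⟩)
    intervalIntegrable_const
    (Eventually.of_forall fun t ht ε hε => hder ε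
      ⟨by linarith [hε.1], by linarith [hε.2]⟩ t (hcdJ (hIcc ▸ uIoc_subset_uIcc ht)))).2
  have h2 := hmain.const_mul (1 / 2)
  have h3 : (1 / 2) * ∫ t in c..d, F' 0 t = ∫ t in c..d,
      pairSum (fun k => opS s (hu.fam (0, t) k)) ((hu.dP hU (1, 0)).fam (0, t)) := by
    rw [hF', intervalIntegral.integral_const_mul]
    ring
  rw [h3] at h2
  refine h2.congr_of_eventuallyEq ?_
  filter_upwards [Ioo_mem_nhds h0.1 h0.2] with ε hε
  exact energy_eq s hΦ hJ hcd hcdJ hε hu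

theorem slice_isSmoothCompact {f : (ℝ × ℝ) × E n → E n}
    (hf : IsSmoothCompact (Ioo (-δ) δ ×ˢ J) f) (hδ : 0 < δ) :
    IsSmoothCompact J (fun q => f ((0, q.1), q.2)) where
  smooth := hf.smooth.comp (f := fun q : ℝ × E n => (((0 : ℝ), q.1), q.2)) (by fun_prop)
    fun q hq => ⟨⟨⟨by simpa using hδ, hδ⟩, hq.1⟩, mem_univ _⟩
  support t ht := by
    obtain ⟨L, hL, h⟩ := hf.support (0, t) ⟨⟨by simpa using hδ, hδ⟩, ht⟩
    refine ⟨L, hL, ?_⟩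
    have : Tendsto (fun τ : ℝ => ((0 : ℝ), τ)) (𝓝 t) (𝓝 (0, t)) := by
      have : Continuous fun τ : ℝ => ((0 : ℝ), τ) := by fun_prop
      exact this.tendsto t
    exact this.eventually h

/-- The first variation of the energy in terms of the defect in the momentum equation. -/
theorem first_variation (s : ℝ) (hJ : IsOpen J) {φ : ℝ → DiffC n} (hφ : IsSmoothFamily J φ)
    (hΦ : IsSmoothFamily (Ioo (-δ) δ ×ˢ J) Φ) (hδ : 0 < δ) (h0 : ∀ t ∈ J, Φ (0, t) = φ t)
    {c d : ℝ} (hcd : c < d) (hcdJ : Icc c d ⊆ J)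
    (hfix : ∀ ε ∈ Ioo (-δ) δ, Φ (ε, c) = φ c ∧ Φ (ε, d) = φ d)
    (hu : IsSmoothCompact J (rightField φ 1))
    (hh : IsSmoothCompact J fun q => rightField Φ (1, 0) ((0, q.1), q.2)) :
    HasDerivAt (fun ε => energy s c d (fun t => Φ (ε, t)))
      (-∫ t in c..d, pairSum (defect s hJ hu t) (hh.fam t)) 0 := by
  have hU := isOpen_strip (δ := δ) hJ
  have hu2 := rightField_isSmoothCompact hΦ hU (0, 1)
  have hv2 := rightField_isSmoothCompact hΦ hU (1, 0)
  have hz : (0 : ℝ) ∈ Ioo (-δ) δ := ⟨by linarith, hδ⟩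
  -- The curves `Φ(0, ·)` and `φ` agree only on `J`; as `J` is open, this still identifies their
  -- time derivatives.
  have hu0 : ∀ t ∈ J, ∀ y, rightField Φ (0, 1) ((0, t), y) = rightField φ 1 (t, y) := by
    intro t ht y
    rw [← velocity_eq_strip hΦ hJ hz ht, ← velocity_eq_curve hφ hJ ht]
    have : (fun x => deriv (fun τ => (Φ (0, τ)).1 x) t) = fun x => deriv (fun τ => (φ τ).1 x) t := by
      ext1 x
      apply Filter.EventuallyEq.deriv_eq
      filter_upwards [hJ.mem_nhds ht] with τ hτ
      rw [h0 τ hτ]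
    change (fun x => deriv (fun τ => (Φ (0, τ)).1 x) t) ((Φ (0, t)).1.symm y) = _
    rw [this, h0 t ht]
    rfl
  -- At a fixed end point the family is constant in `ε`, so its variation field vanishes.
  have hend : ∀ e ∈ J, (∀ ε ∈ Ioo (-δ) δ, Φ (ε, e) = φ e) →
      ∀ x, rightField Φ (1, 0) ((0, e), x) = 0 := by
    intro e he hΦe x
    have hp : ((0 : ℝ), e) ∈ Ioo (-δ) δ ×ˢ J := ⟨hz, he⟩
    have h1 := rightField_evalMap hΦ hU (1, 0) hp (invMap Φ ((0, e), x))
    rw [evalMap_invMap] at h1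
    rw [h1]
    have h2 := hasDerivAt_dP (f := evalMap Φ) hΦ.smooth hU (p := (0, e)) (v := (1, 0)) (t := 0)
      (by simpa using hp) (invMap Φ ((0, e), x))
    simp only [Prod.smul_mk, smul_eq_mul, mul_one, mul_zero, Prod.mk_add_mk, zero_add,
      add_zero] at h2
    refine h2.unique ?_
    refine (hasDerivAt_const (0 : ℝ) (evalMap φ (e, invMap Φ ((0, e), x)))).congr_of_eventuallyEq ?_
    filter_upwards [Ioo_mem_nhds hz.1 hz.2] with ε hε
    simp [evalMap, hΦe ε hε]
  have hE := hasDerivAt_energy s hΦ hJ hδ hcd hcdJ hu2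
  rw [← integral_pairSum_velocityVariation s hJ hu hh hcd hcdJ
    (hend c (hcdJ (left_mem_Icc.mpr hcd.le)) fun ε hε => (hfix ε hε).1)
    (hend d (hcdJ (right_mem_Icc.mpr hcd.le)) fun ε hε => (hfix ε hε).2)]
  convert hE using 1
  refine intervalIntegral.integral_congr fun t ht => ?_
  rw [uIcc_of_le hcd.le] at ht
  have htJ := hcdJ ht
  have hp : ((0 : ℝ), t) ∈ Ioo (-δ) δ ×ˢ J := ⟨hz, htJ⟩
  have e1 : mom s hu t = fun k => opS s (hu2.fam (0, t) k) := by
    ext1 k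
    unfold mom
    congr 1
    ext x
    rw [hu.fam_apply htJ, hu2.fam_apply hp, hu0 t htJ]
  -- The zero curvature equation in the directions `∂_ε` and `∂_t` identifies `∂_ε u` at `ε = 0`
  -- with `velocityVariation`.
  have e2 : (velocityVariation_isSmoothCompact hJ hu hh).fam t =
      (hu2.dP hU (1, 0)).fam (0, t) := by
    ext k x
    rw [IsSmoothCompact.fam_apply _ htJ, IsSmoothCompact.fam_apply _ hp]
    refine congrArg (fun v : E n => v k) ?_
    have hcurv := rightField_curvature hΦ hU (1, 0) (0, 1) hp x
    have d1 : dX (rightField Φ (0, 1)) ((0, t), x) = dX (rightField φ 1) (t, x) := by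
      refine (hasFDerivAt_dX hu2.smooth hU hp x).unique ?_
      have : (fun y => rightField Φ (0, 1) ((0, t), y)) = fun y => rightField φ 1 (t, y) := by
        ext1 y; exact hu0 t htJ y
      rw [this]
      exact hasFDerivAt_dX hu.smooth hJ htJ x
    have d2 : dX (rightField Φ (1, 0)) ((0, t), x) =
        dX (fun q : ℝ × E n => rightField Φ (1, 0) ((0, q.1), q.2)) (t, x) :=
      (hasFDerivAt_dX hv2.smooth hU hp x).unique (hasFDerivAt_dX hh.smooth hJ htJ x)
    have d3 : dP (0, 1) (rightField Φ (1, 0)) ((0, t), x) =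
        dP 1 (fun q : ℝ × E n => rightField Φ (1, 0) ((0, q.1), q.2)) (t, x) := by
      have g1 := hasDerivAt_dP hv2.smooth hU (p := (0, 0)) (v := (0, 1)) (t := t)
        (by simpa using hp) x
      have g2 := hasDerivAt_dP hh.smooth hJ (p := 0) (v := 1) (t := t) (by simpa using htJ) x
      simp only [Prod.smul_mk, smul_eq_mul, mul_one, mul_zero, Prod.mk_add_mk, zero_add,
        add_zero] at g1 g2
      exact g1.unique g2
    rw [d1, d2, d3, hu0 t htJ] at hcurv
    unfold velocityVariation
    rw [← add_sub_assoc, ← hcurv]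
    simp
  rw [e1, e2]

end Variation

/-! ### The geodesic equation -/

section Geodesic

variable {n : ℕ} {J : Set ℝ} {φ : ℝ → DiffC n}

theorem fam_velocity (hφ : IsSmoothFamily J φ) (hJ : IsOpen J)
    (hu : IsSmoothCompact J (rightField φ 1)) {t : ℝ} (ht : t ∈ J) (k : Fin n) :
    (hu.fam t k : E n → ℝ) = fun y => velocity φ t y k := by
  ext y
  rw [hu.fam_apply ht, velocity_eq_curve hφ hJ ht]

theorem momentum_eq_mom (s : ℝ) (hφ : IsSmoothFamily J φ) (hJ : IsOpen J)
    (hu : IsSmoothCompact J (rightField φ 1)) {t : ℝ} (ht : t ∈ J) (k : Fin n) :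
    momentum s φ t k = mom s hu t k := by
  unfold momentum mom
  rw [opS_coe, fam_velocity hφ hJ hu ht]

/-- Evaluation at `x` after `A_s` is a continuous functional on Schwartz space, so it commutes with
the time derivative of the family. -/
theorem hasDerivAt_momentum (s : ℝ) (hφ : IsSmoothFamily J φ) (hJ : IsOpen J)
    (hu : IsSmoothCompact J (rightField φ 1)) {t : ℝ} (ht : t ∈ J) (k : Fin n) (x : E n) :
    HasDerivAt (fun τ => momentum s φ τ k x) (mom s (hu.dP hJ 1) t k x) t := by
  let T : 𝓢(E n, ℝ) →L[ℝ] ℝ := (BoundedContinuousFunction.evalCLM ℝ x) ∘L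
    (SchwartzMap.toBoundedContinuousFunctionCLM ℝ (E n) ℝ) ∘L opS s
  have h := (hu.component k).hasDerivAt_schwartz hJ (hu.component k).isFamily
    (hu.isFamily_dP hJ 1 k) T (p := 0) (t := t) (by simpa using ht)
  simp only [smul_eq_mul, mul_one, zero_add] at h
  refine HasDerivAt.congr_of_eventuallyEq (f := fun τ => mom s hu τ k x) h ?_
  filter_upwards [hJ.mem_nhds ht] with τ hτ
  rw [momentum_eq_mom s hφ hJ hu hτ]

theorem momentumEquation_iff (s : ℝ) (hφ : IsSmoothFamily J φ) (hJ : IsOpen J)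
    (hu : IsSmoothCompact J (rightField φ 1)) :
    MomentumEquation J (velocity φ) (momentum s φ) ↔
      ∀ t ∈ J, ∀ k x, defect s hJ hu t k x = 0 := by
  unfold MomentumEquation
  refine forall₂_congr fun t ht => forall₂_congr fun k x => ?_
  have h1 := hasDerivAt_momentum s hφ hJ hu ht k x
  have h2 : ∑ i, (momentum s φ t i x * pd k (fun y => velocity φ t y i) x +
      (pd i (momentum s φ t k) x * velocity φ t x i +
        momentum s φ t k x * pd i (fun y => velocity φ t y i) x)) =
      flux (mom s hu t) (hu.fam t) k x := by
    rw [flux_apply]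
    refine Finset.sum_congr rfl fun i _ => ?_
    rw [fam_velocity hφ hJ hu ht, momentum_eq_mom s hφ hJ hu ht, momentum_eq_mom s hφ hJ hu ht]
  rw [h2]
  change _ ↔ (mom s (hu.dP hJ 1) t k + flux (mom s hu t) (hu.fam t) k) x = 0
  rw [add_apply]
  constructor
  · intro h
    rw [h1.unique h]; ring
  · intro h
    rw [← eq_neg_of_add_eq_zero_left h]
    exact h1

theorem isTestField_single {n : ℕ} {ρ : E n → ℝ} (hρ : ContDiff ℝ ∞ ρ) (hρc : HasCompactSupport ρ)
    (k : Fin n) : IsTestField fun x => ρ x • (EuclideanSpace.single k 1 : E n) :=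
  ⟨hρ.smul contDiff_const, hρc.smul_right⟩

theorem isSmoothCompact_const {n : ℕ} {J : Set ℝ} {w : E n → E n} (hw : IsTestField w) :
    IsSmoothCompact J fun q : ℝ × E n => w q.2 where
  smooth := (hw.1.comp contDiff_snd).contDiffOn
  support _ _ := ⟨tsupport w, hw.2, Eventually.of_forall fun _ _ hx =>
    image_eq_zero_of_notMem_tsupport hx⟩

theorem pairSum_single {n : ℕ} (a b : Fin n → 𝓢(E n, ℝ)) (ρ : E n → ℝ) (k : Fin n) (c : ℝ)
    (hb : ∀ i x, b i x = (c • ρ x • (EuclideanSpace.single k 1 : E n)) i) :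
    pairSum a b = c * ∫ x, ρ x * a k x := by
  unfold pairSum
  rw [Finset.sum_eq_single k]
  · rw [← integral_const_mul]
    congr 1
    ext x
    rw [hb]
    simp
    ring
  · intro i _ hi
    have : ∀ x, b i x = 0 := by
      intro x
      rw [hb]
      simp [hi]
    simp [this]
  · simp

/-- A curve is a geodesic precisely if it satisfies the momentum equation. -/
theorem isGeodesic_iff_momentumEquation (s : ℝ) (hJ : IsOpen J) (hφ : IsSmoothFamily J φ) :
    IsGeodesic s J φ ↔ MomentumEquation J (velocity φ) (momentum s φ) := by
  have hu := rightField_isSmoothCompact hφ hJ 1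
  rw [momentumEquation_iff s hφ hJ hu]
  constructor
  · rintro ⟨-, hgeo⟩
    -- The fundamental lemma is used twice: here in time, with variation fields `η(t) ρ(x) e_k` and
    -- `ρ` fixed; afterwards in space, by varying `ρ`.
    have key : ∀ t ∈ J, ∀ k, ∀ ρ : E n → ℝ, ContDiff ℝ ∞ ρ → HasCompactSupport ρ →
        ∫ x, ρ x * defect s hJ hu t k x = 0 := by
      intro t ht k ρ hρ hρc
      set w : E n → E n := fun x => ρ x • (EuclideanSpace.single k 1 : E n) with hw
      have hwt : IsTestField w := isTestField_single hρ hρc k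
      set G : ℝ → ℝ := fun τ => ∫ x, ρ x * defect s hJ hu τ k x with hG
      have hGc : ContinuousOn G J := by
        refine (continuousOn_pairSum_defect s hJ hu (isSmoothCompact_const hwt)).congr
          fun τ hτ => ?_
        have := pairSum_single (defect s hJ hu τ) ((isSmoothCompact_const (J := J) hwt).fam τ) ρ k 1
          fun i x => by rw [IsSmoothCompact.fam_apply _ hτ, one_smul]
        rw [one_mul] at this
        exact this.symm
      obtain ⟨r, hr, hball⟩ := Metric.isOpen_iff.mp hJ t ht
      set c := t - r / 2
      set d := t + r / 2
      have hcd : c < d := by simp only [c, d]; linarith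
      have hcdJ : Icc c d ⊆ J := by
        intro τ hτ
        apply hball
        rw [Metric.mem_ball, Real.dist_eq, abs_lt]
        constructor <;> simp only [c, d, mem_Icc] at hτ <;> linarith [hτ.1, hτ.2]
      have hae : ∀ᵐ τ, τ ∈ Ioo c d → G τ = 0 := by
        refine isOpen_Ioo.ae_eq_zero_of_integral_contDiff_smul_eq_zero ?_ ?_
        · exact (hGc.mono (Ioo_subset_Icc_self.trans hcdJ)).locallyIntegrableOn
            measurableSet_Ioo
        · intro η hη hηc hηs
          obtain ⟨δ, hδ, Φ, hΦ, hΦe⟩ := exists_variation hφ hη hηc hwt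
          have hz : (0 : ℝ) ∈ Ioo (-δ) δ := ⟨by linarith, hδ⟩
          have h0 : ∀ τ ∈ J, Φ (0, τ) = φ τ := fun τ _ => DiffC.ext fun x => by
            rw [hΦe 0 hz]; simp
          have hηout : ∀ τ, τ ∉ Ioo c d → η τ = 0 := fun τ hτ =>
            image_eq_zero_of_notMem_tsupport fun h => hτ (hηs h)
          have hfix : ∀ ε ∈ Ioo (-δ) δ, Φ (ε, c) = φ c ∧ Φ (ε, d) = φ d := by
            intro ε hε
            constructor <;> refine DiffC.ext fun x => ?_ <;> rw [hΦe ε hε, hηout] <;> simp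
          have hU := isOpen_strip (δ := δ) hJ
          have hh := slice_isSmoothCompact (rightField_isSmoothCompact hΦ hU (1, 0)) hδ
          -- The family moves the point `φ_τ(x) = y` along the line `y + ε η(τ) w(y)`, so the
          -- right-trivialized variation field is exactly `η w`.
          have hfield : ∀ τ ∈ J, ∀ y, rightField Φ (1, 0) ((0, τ), y) = η τ • w y := by
            intro τ hτ y
            have hp : ((0 : ℝ), τ) ∈ Ioo (-δ) δ ×ˢ J := ⟨hz, hτ⟩
            have h1 := rightField_evalMap hΦ hU (1, 0) hp (invMap Φ ((0, τ), y))
            rw [evalMap_invMap] at h1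
            rw [h1]
            have h2 := hasDerivAt_dP (f := evalMap Φ) hΦ.smooth hU (p := (0, τ)) (v := (1, 0))
              (t := 0) (by simpa using hp) (invMap Φ ((0, τ), y))
            simp only [Prod.smul_mk, smul_eq_mul, mul_one, mul_zero, Prod.mk_add_mk, zero_add,
              add_zero] at h2
            refine h2.unique ?_
            have hy : (φ τ).1 (invMap Φ ((0, τ), y)) = y := by
              rw [← h0 τ hτ]
              exact evalMap_invMap Φ (0, τ) y
            have h3 : HasDerivAt (fun ε : ℝ => y + (ε * η τ) • w y) (η τ • w y) 0 := by
              have := (((hasDerivAt_id (0 : ℝ)).mul_const (η τ)).smul_const (w y)).const_add y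
              rw [one_mul] at this
              exact this
            refine h3.congr_of_eventuallyEq ?_
            filter_upwards [Ioo_mem_nhds hz.1 hz.2] with ε hε
            have := hΦe ε hε τ (invMap Φ ((0, τ), y))
            rw [hy] at this
            exact this
          have hvar := first_variation s hJ hφ hΦ hδ h0 hcd hcdJ hfix hu hh
          have hzero := hvar.unique (hgeo c d hcd hcdJ δ hδ Φ hΦ h0 hfix)
          have hcongr : ∫ τ in c..d, pairSum (defect s hJ hu τ) (hh.fam τ) =
              ∫ τ in c..d, η τ * G τ := by
            refine intervalIntegral.integral_congr fun τ hτ => ?_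
            rw [uIcc_of_le hcd.le] at hτ
            refine pairSum_single _ _ ρ k _ fun i x => ?_
            rw [hh.fam_apply (hcdJ hτ), hfield τ (hcdJ hτ)]
          rw [hcongr, neg_eq_zero, intervalIntegral.integral_of_le hcd.le] at hzero
          rw [← hzero]
          refine (setIntegral_eq_integral_of_forall_compl_eq_zero fun τ hτ => ?_).symm
          rw [hηout τ fun h => hτ (Ioo_subset_Ioc_self h), zero_smul]
      have hts : t ∈ Ioo c d := by constructor <;> simp only [c, d] <;> linarith
      -- Continuity of `G` improves vanishing almost everywhere to vanishing at every time, in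
      -- particular at `t`.
      have heq : EqOn G 0 (Ioo c d) := by
        refine Measure.eqOn_open_of_ae_eq (μ := volume) ?_ isOpen_Ioo
          (hGc.mono (Ioo_subset_Icc_self.trans hcdJ)) continuousOn_const
        rw [EventuallyEq, ae_restrict_iff' measurableSet_Ioo]
        exact hae
      exact heq hts
    intro t ht k x
    have hc : Continuous (defect s hJ hu t k) := (defect s hJ hu t k).continuous
    have hae := ae_eq_zero_of_integral_contDiff_smul_eq_zero (μ := (volume : Measure (E n)))
      (hc.locallyIntegrable) (fun ρ hρ hρc => key t ht k ρ hρ hρc)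
    have := (hc.ae_eq_iff_eq (μ := volume) continuous_const (g := fun _ => (0 : ℝ))).mp hae
    exact congrFun this x
  · intro hdef
    refine ⟨hφ, fun c d hcd hcdJ δ hδ Φ hΦ h0 hfix => ?_⟩
    have hh := slice_isSmoothCompact (rightField_isSmoothCompact hΦ (isOpen_strip hJ) (1, 0)) hδ
    have hvar := first_variation s hJ hφ hΦ hδ h0 hcd hcdJ hfix hu hh
    have hzero : ∫ t in c..d, pairSum (defect s hJ hu t) (hh.fam t) = 0 := by
      rw [intervalIntegral.integral_congr (g := fun _ => 0), intervalIntegral.integral_zero]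
      intro t ht
      rw [uIcc_of_le hcd.le] at ht
      unfold pairSum
      refine Finset.sum_eq_zero fun k _ => ?_
      simp [hdef t (hcdJ ht)]
    rw [hzero, neg_zero] at hvar
    exact hvar

end Geodesic

/-! ### The modified Bessel function `K_ν` -/

/-- The integrand `τ^(ν-1) exp (-τ - r²/(4τ))` in the heat kernel representation of `K_ν`. -/
def heatIntegrand (ν r τ : ℝ) : ℝ := τ ^ (ν - 1) * Real.exp (-(τ + r ^ 2 / (4 * τ)))

theorem measurable_heatIntegrand (ν r : ℝ) : Measurable (heatIntegrand ν r) := by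
  unfold heatIntegrand; fun_prop

/-- The possible singularity at `τ = 0` is absorbed by `exp (-x) ≤ k! / xᵏ` with `x = r²/(4τ)`: for
`k > -ν` this leaves a convergent Gamma integral of exponent `ν + k`. -/
theorem integrableOn_heatIntegrand (ν : ℝ) {r : ℝ} (hr : 0 < r) :
    IntegrableOn (heatIntegrand ν r) (Ioi 0) := by
  obtain ⟨k, hk⟩ := exists_nat_gt (-ν)
  have h1 := (Real.GammaIntegral_convergent (s := ν + k) (by linarith)).const_mul
    (k.factorial * (4 / r ^ 2) ^ k)
  refine Integrable.mono' h1 (measurable_heatIntegrand ν r).aestronglyMeasurable ?_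
  rw [ae_restrict_iff' measurableSet_Ioi]
  refine Eventually.of_forall fun τ (hτ : 0 < τ) => ?_
  set x := r ^ 2 / (4 * τ) with hx
  have hx0 : 0 < x := by positivity
  have h2 : Real.exp (-x) ≤ k.factorial / x ^ k := by
    rw [Real.exp_neg, inv_eq_one_div, div_le_div_iff₀ (Real.exp_pos _) (by positivity), one_mul]
    have := Real.pow_div_factorial_le_exp x hx0.le k
    rwa [div_le_iff₀ (by positivity), mul_comm] at this
  have h3 : (k.factorial : ℝ) / x ^ k = k.factorial * (4 / r ^ 2) ^ k * τ ^ k := by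
    rw [mul_assoc, ← mul_pow, div_eq_mul_inv, ← inv_pow]
    congr 2
    rw [hx]; field_simp
  unfold heatIntegrand
  rw [Real.norm_eq_abs, abs_of_nonneg (by positivity), neg_add, Real.exp_add]
  calc τ ^ (ν - 1) * (Real.exp (-τ) * Real.exp (-x))
      ≤ τ ^ (ν - 1) * (Real.exp (-τ) * (k.factorial * (4 / r ^ 2) ^ k * τ ^ k)) := by
        rw [← h3]; gcongr
    _ = _ := by
        rw [show ν + k - 1 = (ν - 1) + k by ring, Real.rpow_add hτ, Real.rpow_natCast]
        ring

theorem half_mul_exp_image {a : ℝ} (ha : 0 < a) : (fun t => a * Real.exp t) '' univ = Ioi 0 := by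
  ext y
  simp only [image_univ, mem_range, mem_Ioi]
  constructor
  · rintro ⟨t, rfl⟩; positivity
  · intro hy
    refine ⟨Real.log (y / a), ?_⟩
    rw [Real.exp_log (by positivity)]
    field_simp

/-- The substitution `τ = (r/2) eᵗ` symmetrizes the exponent, since then `τ + r²/(4τ) = r cosh t`.
-/
theorem heatIntegrand_subst (ν : ℝ) {r : ℝ} (hr : 0 < r) (t : ℝ) :
    |r / 2 * Real.exp t| • heatIntegrand ν r (r / 2 * Real.exp t) =
      (r / 2) ^ ν * Real.exp (ν * t - r * Real.cosh t) := by
  set τ := r / 2 * Real.exp t with hτ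
  have hτ0 : 0 < τ := by positivity
  have h1 : τ * τ ^ (ν - 1) = τ ^ ν := by
    rw [Real.rpow_sub_one hτ0.ne']; field_simp
  have h2 : τ ^ ν = (r / 2) ^ ν * Real.exp (ν * t) := by
    rw [hτ, Real.mul_rpow (by positivity) (Real.exp_pos t).le, ← Real.exp_mul, mul_comm t]
  have h3 : τ + r ^ 2 / (4 * τ) = r * Real.cosh t := by
    rw [hτ, Real.cosh_eq, Real.exp_neg]
    have := Real.exp_pos t
    field_simp
    ring
  unfold heatIntegrand
  rw [abs_of_pos hτ0, smul_eq_mul, ← mul_assoc, h1, h2, h3, sub_eq_add_neg, Real.exp_add, mul_assoc]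

theorem integrable_exp_cosh (ν : ℝ) {r : ℝ} (hr : 0 < r) :
    Integrable fun t => Real.exp (ν * t - r * Real.cosh t) := by
  have ha : 0 < r / 2 := by positivity
  have h := (integrableOn_image_iff_integrableOn_abs_deriv_smul MeasurableSet.univ
    (f := fun t => r / 2 * Real.exp t) (f' := fun t => r / 2 * Real.exp t)
    (fun t _ => ((Real.hasDerivAt_exp t).const_mul (r / 2)).hasDerivWithinAt)
    (fun a _ b _ hab => Real.exp_injective (mul_left_cancel₀ ha.ne' hab))
    (heatIntegrand ν r)).mp (by
      rw [half_mul_exp_image ha]; exact integrableOn_heatIntegrand ν hr)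
  rw [integrableOn_univ] at h
  simp_rw [heatIntegrand_subst ν hr] at h
  have h2 := h.const_mul (((r / 2) ^ ν)⁻¹)
  refine h2.congr (Eventually.of_forall fun t => ?_)
  have : (r / 2) ^ ν ≠ 0 := by positivity
  simp only
  field_simp

/-- The heat kernel representation of `K_ν`. -/
theorem integral_heatIntegrand (ν : ℝ) {r : ℝ} (hr : 0 < r) :
    ∫ τ in Ioi (0 : ℝ), heatIntegrand ν r τ = 2 * (r / 2) ^ ν * besselK ν r := by
  have ha : 0 < r / 2 := by positivity
  have h := integral_image_eq_integral_abs_deriv_smul MeasurableSet.univ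
    (f := fun t => r / 2 * Real.exp t) (f' := fun t => r / 2 * Real.exp t)
    (fun t _ => ((Real.hasDerivAt_exp t).const_mul (r / 2)).hasDerivWithinAt)
    (fun a _ b _ hab => Real.exp_injective (mul_left_cancel₀ ha.ne' hab))
    (heatIntegrand ν r)
  rw [half_mul_exp_image ha, setIntegral_univ] at h
  simp_rw [heatIntegrand_subst ν hr] at h
  rw [h, integral_const_mul, mul_comm 2, mul_assoc]
  congr 1
  have hi := integrable_exp_cosh ν hr
  -- Averaging over `t ↦ -t` turns `exp (νt)` into `cosh (νt)`, and the even integrand folds onto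
  -- the half line.
  have hneg : ∫ t, Real.exp (ν * t - r * Real.cosh t) =
      ∫ t, Real.exp (-ν * t - r * Real.cosh t) := by
    rw [← integral_neg_eq_self]
    simp
  have hsum : ∫ t, Real.exp (ν * t - r * Real.cosh t) =
      ∫ t : ℝ, Real.exp (-(r * Real.cosh |t|)) * Real.cosh (ν * |t|) := by
    have h2 : (∫ t, Real.exp (ν * t - r * Real.cosh t)) + ∫ t, Real.exp (ν * t - r * Real.cosh t) =
        2 * ∫ t : ℝ, Real.exp (-(r * Real.cosh |t|)) * Real.cosh (ν * |t|) := by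
      conv_lhs => arg 2; rw [hneg]
      rw [← integral_add hi (integrable_exp_cosh (-ν) hr), ← integral_const_mul]
      congr 1
      ext t
      have e : Real.cosh (ν * |t|) = Real.cosh (ν * t) := by
        rcases abs_choice t with h | h <;> rw [h]
        rw [mul_neg, Real.cosh_neg]
      rw [e, Real.cosh_abs, Real.cosh_eq (ν * t), sub_eq_add_neg, sub_eq_add_neg, Real.exp_add,
        Real.exp_add, neg_mul]
      ring
    linarith
  rw [hsum, integral_comp_abs (f := fun t => Real.exp (-(r * Real.cosh t)) * Real.cosh (ν * t))]
  rfl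

/-! ### Basset's integral -/

theorem hasDerivAt_sin_mul_gaussian (τ t : ℝ) :
    HasDerivAt (fun t => Real.sin t * Real.exp (-(τ * t ^ 2)))
      (Real.cos t * Real.exp (-(τ * t ^ 2)) - Real.sin t * (2 * τ * t * Real.exp (-(τ * t ^ 2)))) t := by
  have h1 : HasDerivAt (fun t : ℝ => -(τ * t ^ 2)) (-(τ * (2 * t))) t := by
    simpa using ((hasDerivAt_pow 2 t).const_mul τ).fun_neg
  have h2 := (Real.hasDerivAt_sin t).fun_mul h1.exp
  exact h2.congr_deriv (by ring)

/-- Integration by parts with the primitive `sin t` leaves a boundary term of size at most `exp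
(-τR²)` and a remainder of size at most `∫ 2τt exp (-τt²) = 1 - exp (-τR²)`. The sum does not depend
on `τ` or `R`, which is what dominates the limit in Basset's formula. -/
theorem abs_integral_cos_gaussian_le {τ R : ℝ} (hτ : 0 < τ) (hR : 0 ≤ R) :
    |∫ t in (0 : ℝ)..R, Real.cos t * Real.exp (-(τ * t ^ 2))| ≤ 1 := by
  have hF := intervalIntegral.integral_eq_sub_of_hasDerivAt (a := 0) (b := R)
    (fun t _ => hasDerivAt_sin_mul_gaussian τ t) (Continuous.intervalIntegrable (by fun_prop) _ _)
  have hG := intervalIntegral.integral_eq_sub_of_hasDerivAt (a := 0) (b := R)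
    (f := fun t => -Real.exp (-(τ * t ^ 2))) (f' := fun t => 2 * τ * t * Real.exp (-(τ * t ^ 2)))
    (fun t _ => by
      have h1 : HasDerivAt (fun t : ℝ => -(τ * t ^ 2)) (-(τ * (2 * t))) t := by
        simpa using ((hasDerivAt_pow 2 t).const_mul τ).fun_neg
      exact h1.exp.fun_neg.congr_deriv (by ring)) (Continuous.intervalIntegrable (by fun_prop) _ _)
  rw [intervalIntegral.integral_sub (Continuous.intervalIntegrable (by fun_prop) _ _)
    (Continuous.intervalIntegrable (by fun_prop) _ _)] at hF
  have hb : |∫ t in (0 : ℝ)..R, Real.sin t * (2 * τ * t * Real.exp (-(τ * t ^ 2)))| ≤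
      ∫ t in (0 : ℝ)..R, 2 * τ * t * Real.exp (-(τ * t ^ 2)) := by
    have hgi : IntervalIntegrable (fun t => 2 * τ * t * Real.exp (-(τ * t ^ 2))) volume 0 R :=
      Continuous.intervalIntegrable (by fun_prop) _ _
    rw [← Real.norm_eq_abs]
    refine intervalIntegral.norm_integral_le_of_norm_le hR (ae_of_all _ fun t ht => ?_) hgi
    have ht0 : 0 ≤ 2 * τ * t * Real.exp (-(τ * t ^ 2)) := by
      have := ht.1.le; positivity
    rw [norm_mul, Real.norm_eq_abs, Real.norm_eq_abs, abs_of_nonneg ht0]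
    exact mul_le_of_le_one_left ht0 (Real.abs_sin_le_one t)
  have hs : |Real.sin R * Real.exp (-(τ * R ^ 2))| ≤ Real.exp (-(τ * R ^ 2)) := by
    rw [abs_mul, abs_of_pos (Real.exp_pos _)]
    exact mul_le_of_le_one_left (Real.exp_pos _).le (Real.abs_sin_le_one R)
  simp only [Real.sin_zero, zero_mul, sub_zero, ne_eq, OfNat.ofNat_ne_zero, not_false_eq_true,
    zero_pow, mul_zero, neg_zero, Real.exp_zero] at hF hG
  rw [abs_le] at *
  constructor <;> linarith [hb.1, hb.2, hs.1, hs.2]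

theorem integral_cos_gaussian {τ : ℝ} (hτ : 0 < τ) :
    ∫ t in Ioi (0 : ℝ), Real.cos t * Real.exp (-(τ * t ^ 2)) =
      1 / 2 * √(Real.pi / τ) * Real.exp (-(1 / (4 * τ))) := by
  have h1 := fourierIntegral_gaussian (b := (τ : ℂ)) (by simpa using hτ) 1
  have h2 : ∫ x : ℝ, Real.cos x * Real.exp (-(τ * x ^ 2)) =
      √(Real.pi / τ) * Real.exp (-(1 / (4 * τ))) := by
    have h3 := congrArg Complex.re h1
    rw [← Complex.reCLM_apply, ← ContinuousLinearMap.integral_comp_comm] at h3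
    · convert h3 using 1
      · congr 1
        ext x
        rw [Complex.reCLM_apply, mul_one, ← Complex.ofReal_pow, ← Complex.ofReal_neg,
          ← Complex.ofReal_mul, ← Complex.ofReal_exp, Complex.re_mul_ofReal, mul_comm Complex.I,
          Complex.exp_ofReal_mul_I_re, neg_mul]
      · rw [show ((Real.pi : ℂ) / τ) ^ (1 / 2 : ℂ) = ((√(Real.pi / τ) : ℝ) : ℂ) by
          rw [Real.sqrt_eq_rpow, Complex.ofReal_cpow (by positivity)]; simp]
        rw [show (-1 ^ 2 / (4 * (τ : ℂ))) = ((-(1 / (4 * τ)) : ℝ) : ℂ) by push_cast; ring,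
          ← Complex.ofReal_exp, ← Complex.ofReal_mul, Complex.ofReal_re]
    · have := GaussianFourier.integrable_cexp_neg_mul_sq_norm_add (V := ℝ) (b := (τ : ℂ))
        (by simpa using hτ) Complex.I 1
      refine this.congr (Eventually.of_forall fun x => ?_)
      simp only
      rw [mul_one, Complex.exp_add, mul_comm]
      simp [Real.norm_eq_abs, ← Complex.ofReal_pow, sq_abs]
  have h4 := integral_comp_abs (f := fun t => Real.cos t * Real.exp (-(τ * t ^ 2)))
  simp only [Real.cos_abs, sq_abs] at h4
  rw [h2] at h4
  linarith

theorem integrableOn_cos_gaussian {τ : ℝ} (hτ : 0 < τ) :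
    IntegrableOn (fun t => Real.cos t * Real.exp (-(τ * t ^ 2))) (Ioi 0) := by
  refine Integrable.integrableOn ?_
  refine (integrable_exp_neg_mul_sq hτ).mono' (by fun_prop) (ae_of_all _ fun t => ?_)
  rw [norm_mul, Real.norm_eq_abs, Real.norm_eq_abs, abs_of_pos (Real.exp_pos _), neg_mul]
  exact mul_le_of_le_one_left (Real.exp_pos _).le (Real.abs_cos_le_one t)

theorem integrableOn_rpow_mul_exp {a b : ℝ} (ha : 0 < a) (hb : 0 < b) :
    IntegrableOn (fun τ => τ ^ (a - 1) * Real.exp (-(b * τ))) (Ioi 0) := by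
  have h := integrableOn_rpow_mul_exp_neg_mul_rpow (p := 1) (s := a - 1) (b := b) (by linarith)
    one_pos hb
  simpa using h

/-- Rescaling `τ` by `r²` turns the integrand into a multiple of `heatIntegrand`; the factor
`√(π/τ)` removes the extra `1/2` in the exponent. -/
theorem integral_cos_gaussian_heat (ν : ℝ) {r : ℝ} (hr : 0 < r) :
    ∫ τ in Ioi (0 : ℝ), τ ^ (ν + 1 / 2 - 1) * Real.exp (-(r ^ 2 * τ)) *
      (1 / 2 * √(Real.pi / τ) * Real.exp (-(1 / (4 * τ)))) =
      √Real.pi * (r ^ 2) ^ (-ν) * (r / 2) ^ ν * besselK ν r := by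
  have hr2 : 0 < r ^ 2 := by positivity
  have h1 := integral_comp_mul_left_Ioi (heatIntegrand ν r) 0 hr2
  rw [mul_zero, integral_heatIntegrand ν hr] at h1
  have h2 : ∀ τ ∈ Ioi (0 : ℝ), τ ^ (ν + 1 / 2 - 1) * Real.exp (-(r ^ 2 * τ)) *
      (1 / 2 * √(Real.pi / τ) * Real.exp (-(1 / (4 * τ)))) =
      (1 / 2 * √Real.pi * (r ^ 2) ^ (1 - ν)) * heatIntegrand ν r (r ^ 2 * τ) := by
    intro τ (hτ : 0 < τ)
    unfold heatIntegrand
    have e1 : r ^ 2 * τ + r ^ 2 / (4 * (r ^ 2 * τ)) = r ^ 2 * τ + 1 / (4 * τ) := by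
      field_simp
    have e2 : (r ^ 2) ^ (1 - ν) * (r ^ 2 * τ) ^ (ν - 1) = τ ^ (ν - 1) := by
      rw [Real.mul_rpow hr2.le hτ.le, ← mul_assoc, ← Real.rpow_add hr2]
      simp
    have e3 : τ ^ (ν + 1 / 2 - 1) * √(Real.pi / τ) = √Real.pi * τ ^ (ν - 1) := by
      rw [Real.sqrt_div' _ hτ.le, Real.sqrt_eq_rpow τ, show ν + 1 / 2 - 1 = (ν - 1) + 1 / 2 by ring,
        Real.rpow_add hτ]
      field_simp
    rw [e1, neg_add, Real.exp_add, ← e2] at *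
    calc _ = 1 / 2 * (τ ^ (ν + 1 / 2 - 1) * √(Real.pi / τ)) *
          (Real.exp (-(r ^ 2 * τ)) * Real.exp (-(1 / (4 * τ)))) := by ring
      _ = _ := by rw [e3]; ring
  rw [setIntegral_congr_fun measurableSet_Ioi h2, integral_const_mul, h1, smul_eq_mul,
    sub_eq_add_neg, Real.rpow_add hr2, Real.rpow_one]
  field_simp

/-- Basset's integral for `K_ν`. -/
theorem tendsto_basset {ν r : ℝ} (hν : -(1 / 2) < ν) (hr : 0 < r) :
    Tendsto (fun R : ℝ => Real.Gamma (ν + 1 / 2) * (2 * r) ^ ν / √Real.pi *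
        ∫ t in (0 : ℝ)..R, Real.cos t / (t ^ 2 + r ^ 2) ^ (ν + 1 / 2)) atTop
      (𝓝 (besselK ν r)) := by
  set a := ν + 1 / 2 with ha
  have ha0 : 0 < a := by linarith
  have hr2 : 0 < r ^ 2 := by positivity
  let f : ℝ → ℝ → ℝ := fun t τ => Real.cos t * (τ ^ (a - 1) * Real.exp (-((t ^ 2 + r ^ 2) * τ)))
  have hgamma := integrableOn_rpow_mul_exp ha0 hr2
  have hint : ∀ R : ℝ, Integrable (Function.uncurry f)
      ((volume.restrict (Ioc 0 R)).prod (volume.restrict (Ioi 0))) := by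
    intro R
    have h1 : Integrable (fun _ : ℝ => (1 : ℝ)) (volume.restrict (Ioc 0 R)) :=
      integrable_const _
    refine (h1.mul_prod hgamma).mono' ?_ ?_
    · apply Measurable.aestronglyMeasurable
      simp only [f, Function.uncurry_def]
      fun_prop
    · rw [Measure.prod_restrict, ae_restrict_iff' (measurableSet_Ioc.prod measurableSet_Ioi)]
      refine ae_of_all _ fun p hp => ?_
      have hτ : 0 < p.2 := hp.2
      simp only [f, Function.uncurry_def, one_mul]
      rw [norm_mul, Real.norm_eq_abs, Real.norm_eq_abs,
        abs_of_nonneg (a := p.2 ^ (a - 1) * _) (by positivity)]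
      refine (mul_le_of_le_one_left (by positivity) (Real.abs_cos_le_one _)).trans ?_
      gcongr
      nlinarith [sq_nonneg p.1]
  have hfac : ∀ R τ : ℝ, ∫ t in Ioc 0 R, f t τ = τ ^ (a - 1) * Real.exp (-(r ^ 2 * τ)) *
      ∫ t in Ioc 0 R, Real.cos t * Real.exp (-(τ * t ^ 2)) := by
    intro R τ
    rw [← integral_const_mul]
    congr 1
    ext t
    simp only [f]
    rw [show -((t ^ 2 + r ^ 2) * τ) = -(r ^ 2 * τ) + -(τ * t ^ 2) by ring, Real.exp_add]
    ring
  -- `Γ(a) (t² + r²)^(-a)` is the integral of `τ^(a-1) exp (-(t² + r²)τ)` over `τ > 0`; on a bounded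
  -- range of `t` Fubini applies.
  have hswap : ∀ R : ℝ, 0 ≤ R → Real.Gamma a * ∫ t in (0 : ℝ)..R,
      Real.cos t / (t ^ 2 + r ^ 2) ^ a = ∫ τ in Ioi (0 : ℝ), τ ^ (a - 1) * Real.exp (-(r ^ 2 * τ)) *
        ∫ t in Ioc 0 R, Real.cos t * Real.exp (-(τ * t ^ 2)) := by
    intro R hR
    have h := integral_integral_swap (hint R)
    simp_rw [hfac R] at h
    rw [← h, intervalIntegral.integral_of_le hR, ← integral_const_mul]
    congr 1
    ext t
    have ht : 0 < t ^ 2 + r ^ 2 := by positivity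
    simp only [f]
    rw [integral_const_mul, Real.integral_rpow_mul_exp_neg_mul_Ioi ha0 ht, one_div,
      Real.inv_rpow ht.le]
    ring
  -- For `ν ≤ 0` the original integral converges only conditionally. After the exchange the inner
  -- integral is bounded by `1`, so the Gamma density is an integrable majorant.
  have hlim : Tendsto (fun R : ℝ => ∫ τ in Ioi (0 : ℝ), τ ^ (a - 1) * Real.exp (-(r ^ 2 * τ)) *
        ∫ t in Ioc 0 R, Real.cos t * Real.exp (-(τ * t ^ 2))) atTop
      (𝓝 (∫ τ in Ioi (0 : ℝ), τ ^ (a - 1) * Real.exp (-(r ^ 2 * τ)) *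
        (1 / 2 * √(Real.pi / τ) * Real.exp (-(1 / (4 * τ)))))) := by
    refine tendsto_integral_filter_of_dominated_convergence _ ?_ ?_ hgamma ?_
    · refine Eventually.of_forall fun R => ?_
      have h := (hint R).integral_prod_right.aestronglyMeasurable
      simp only [Function.uncurry_def] at h
      simp_rw [hfac R] at h
      exact h
    · filter_upwards [eventually_ge_atTop 0] with R hR
      rw [ae_restrict_iff' measurableSet_Ioi]
      refine ae_of_all _ fun τ (hτ : 0 < τ) => ?_
      have h1 := abs_integral_cos_gaussian_le hτ hR
      rw [intervalIntegral.integral_of_le hR] at h1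
      rw [norm_mul, Real.norm_eq_abs, Real.norm_eq_abs,
        abs_of_nonneg (a := τ ^ (a - 1) * _) (by positivity)]
      exact mul_le_of_le_one_right (by positivity) h1
    · rw [ae_restrict_iff' measurableSet_Ioi]
      refine ae_of_all _ fun τ (hτ : 0 < τ) => Tendsto.const_mul _ ?_
      rw [← integral_cos_gaussian hτ]
      refine (intervalIntegral_tendsto_integral_Ioi 0 (integrableOn_cos_gaussian hτ)
        tendsto_id).congr' ?_
      filter_upwards [eventually_ge_atTop 0] with R hR
      rw [intervalIntegral.integral_of_le (by exact hR)]
      rfl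
  rw [ha, integral_cos_gaussian_heat ν hr, ← ha] at hlim
  have hc := hlim.const_mul ((2 * r) ^ ν / √Real.pi)
  have hval : (2 * r) ^ ν / √Real.pi * (√Real.pi * (r ^ 2) ^ (-ν) * (r / 2) ^ ν * besselK ν r) =
      besselK ν r := by
    have hpi : √Real.pi ≠ 0 := by positivity
    have e : (2 * r) ^ ν * (r / 2) ^ ν * (r ^ 2) ^ (-ν) = 1 := by
      rw [← Real.mul_rpow (by positivity) (by positivity),
        show 2 * r * (r / 2) = r ^ 2 by ring, ← Real.rpow_add hr2]
      simp
    calc _ = ((2 * r) ^ ν * (r / 2) ^ ν * (r ^ 2) ^ (-ν)) * besselK ν r := by field_simp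
      _ = _ := by rw [e, one_mul]
  rw [hval] at hc
  refine hc.congr' ?_
  filter_upwards [eventually_ge_atTop 0] with R hR
  rw [← hswap R hR]
  ring

/-! ### The Bessel kernel -/

/-- The reflected translate `y ↦ m (x - y)`, as a complex-valued function. -/
def reflTranslate {n : ℕ} (m : 𝓢(E n, ℝ)) (x y : E n) : ℂ := (m (x - y) : ℂ)

theorem continuous_reflTranslate {n : ℕ} (m : 𝓢(E n, ℝ)) (x : E n) :
    Continuous (reflTranslate m x) := by
  unfold reflTranslate
  have := m.continuous
  fun_prop

theorem integrable_reflTranslate {n : ℕ} (m : 𝓢(E n, ℝ)) (x : E n) :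
    Integrable (reflTranslate m x) :=
  (m.integrable (μ := volume)).comp_sub_left x |>.ofReal

theorem exists_norm_reflTranslate_le {n : ℕ} (m : 𝓢(E n, ℝ)) (x : E n) :
    ∃ C, ∀ y, ‖reflTranslate m x y‖ ≤ C := by
  obtain ⟨C, hC⟩ := m.decay 0 0
  refine ⟨C, fun y => ?_⟩
  have := hC.2 (x - y)
  simpa [reflTranslate] using this

theorem fourier_reflTranslate {n : ℕ} (m : 𝓢(E n, ℝ)) (x ξ : E n) :
    𝓕 (reflTranslate m x) ξ =
      Complex.exp (↑(-2 * Real.pi * inner ℝ x ξ) * Complex.I) * 𝓕 (toC m : E n → ℂ) (-ξ) := by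
  rw [Real.fourier_eq', Real.fourier_eq', ← integral_const_mul,
    ← integral_sub_left_eq_self (fun v => Complex.exp _ * _) volume x]
  congr 1
  ext v
  simp only [reflTranslate, toC_apply, smul_eq_mul, inner_neg_right, inner_sub_left]
  rw [← mul_assoc, ← Complex.exp_add]
  congr 2
  push_cast
  ring

theorem integrable_fourier_reflTranslate {n : ℕ} (m : 𝓢(E n, ℝ)) (x : E n) :
    Integrable (𝓕 (reflTranslate m x)) := by
  have h : Integrable fun ξ => 𝓕 (toC m : E n → ℂ) (-ξ) := by
    rw [← SchwartzMap.fourier_coe]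
    exact ((𝓕 (toC m)).integrable (μ := volume)).comp_neg
  have h2 := h.bdd_mul (f := fun ξ => Complex.exp (↑(-2 * Real.pi * inner ℝ x ξ) * Complex.I))
    (c := 1) (Continuous.aestronglyMeasurable (by fun_prop))
    (ae_of_all _ fun ξ => (Complex.norm_exp_ofReal_mul_I _).le)
  exact h2.congr (ae_of_all _ fun ξ => (fourier_reflTranslate m x ξ).symm)

/-- Integrating a kernel against `reflTranslate m x` is convolving with `m` at the point `x`; this
is the form of that pairing on the Fourier side. -/
theorem integral_mul_fourier_reflTranslate {n : ℕ} (m : 𝓢(E n, ℝ)) (x : E n) {g : E n → ℂ}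
    (hg : ∀ ξ, g (-ξ) = g ξ) :
    ∫ ξ, g ξ * 𝓕 (reflTranslate m x) ξ = 𝓕⁻ (fun ξ => g ξ * 𝓕 (toC m : E n → ℂ) ξ) x := by
  rw [Real.fourierInv_eq', ← integral_neg_eq_self]
  congr 1
  ext ξ
  rw [fourier_reflTranslate, hg, neg_neg, smul_eq_mul, real_inner_comm, inner_neg_left]
  simp only [mul_neg, neg_mul, neg_neg]
  ring

theorem integral_symbol_mul_fourier_reflTranslate {n : ℕ} (s : ℝ) (m : 𝓢(E n, ℝ)) (x : E n) :
    ∫ ξ, (symbol n s ξ : ℂ) * 𝓕 (reflTranslate m x) ξ = (op s m x : ℂ) := by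
  rw [integral_mul_fourier_reflTranslate m x (fun ξ => by rw [symbol_neg_arg]), op_ofReal]
  rfl

theorem integral_fourier_mul_eq {n : ℕ} {f g : E n → ℂ} (hf : Integrable f) (hg : Integrable g) :
    ∫ y, 𝓕 f y * g y = ∫ ξ, f ξ * 𝓕 g ξ := by
  have h := VectorFourier.integral_fourierIntegral_smul_eq_flip (L := innerₗ (E n))
    Real.continuous_fourierChar continuous_inner hf hg
  simp only [smul_eq_mul, flip_innerₗ] at h
  exact h

/-! ### Heat kernels and the `K`-kernel -/

/-- The heat kernel `(4πτ)^(-n/2) exp (-|y|² / 4τ)`. -/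
def heatKernel (n : ℕ) (τ : ℝ) (y : E n) : ℝ :=
  (4 * Real.pi * τ) ^ (-((n : ℝ) / 2)) * Real.exp (-(‖y‖ ^ 2 / (4 * τ)))

theorem measurable_heatKernel (n : ℕ) : Measurable (Function.uncurry (heatKernel n)) := by
  unfold heatKernel Function.uncurry
  fun_prop

theorem heatKernel_nonneg (n : ℕ) {τ : ℝ} (hτ : 0 < τ) (y : E n) : 0 ≤ heatKernel n τ y := by
  unfold heatKernel; positivity

theorem integrable_gaussian (n : ℕ) {b : ℝ} (hb : 0 < b) :
    Integrable fun y : E n => Real.exp (-(b * ‖y‖ ^ 2)) := by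
  have h := GaussianFourier.integrable_cexp_neg_mul_sq_norm_add (V := E n) (b := (b : ℂ))
    (by simpa using hb) 0 0
  have h2 := h.re
  refine h2.congr (ae_of_all _ fun y => ?_)
  simp only [zero_mul, add_zero, RCLike.re_to_complex]
  rw [show -(b : ℂ) * (‖y‖ : ℂ) ^ 2 = ((-(b * ‖y‖ ^ 2) : ℝ) : ℂ) by push_cast; ring,
    ← Complex.ofReal_exp, Complex.ofReal_re]

theorem integrable_heatKernel (n : ℕ) {τ : ℝ} (hτ : 0 < τ) : Integrable (heatKernel n τ) := by
  have h := (integrable_gaussian n (b := 1 / (4 * τ)) (by positivity)).const_mul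
    ((4 * Real.pi * τ) ^ (-((n : ℝ) / 2)))
  refine h.congr (ae_of_all _ fun y => ?_)
  simp only [heatKernel]
  congr 3
  ring

theorem integral_heatKernel (n : ℕ) {τ : ℝ} (hτ : 0 < τ) : ∫ y, heatKernel n τ y = 1 := by
  have h := GaussianFourier.integral_rexp_neg_mul_sq_norm (V := E n) (b := 1 / (4 * τ))
    (by positivity)
  simp only [heatKernel]
  rw [integral_const_mul]
  have e : ∀ y : E n, Real.exp (-(‖y‖ ^ 2 / (4 * τ))) = Real.exp (-(1 / (4 * τ)) * ‖y‖ ^ 2) := by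
    intro y; congr 1; ring
  simp only [e]
  rw [h, finrank_euclideanSpace_fin, show Real.pi / (1 / (4 * τ)) = 4 * Real.pi * τ by field_simp,
    ← Real.rpow_add (by positivity)]
  simp

theorem fourier_gaussian_eq_heatKernel (n : ℕ) {τ : ℝ} (hτ : 0 < τ) (y : E n) :
    𝓕 (fun ξ : E n => Complex.exp (-((4 * Real.pi ^ 2 * τ : ℝ) : ℂ) * (‖ξ‖ : ℂ) ^ 2)) y =
      (heatKernel n τ y : ℂ) := by
  have hpi := Real.pi_pos
  rw [fourier_gaussian_innerProductSpace (by rw [Complex.ofReal_re]; positivity),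
    finrank_euclideanSpace_fin, heatKernel]
  have h1 : (Real.pi : ℂ) / ((4 * Real.pi ^ 2 * τ : ℝ) : ℂ) = (((4 * Real.pi * τ)⁻¹ : ℝ) : ℂ) := by
    rw [← Complex.ofReal_div]
    congr 1
    field_simp
  have h2 : -(Real.pi : ℂ) ^ 2 * (‖y‖ : ℂ) ^ 2 / ((4 * Real.pi ^ 2 * τ : ℝ) : ℂ) =
      ((-(‖y‖ ^ 2 / (4 * τ)) : ℝ) : ℂ) := by
    have : (-Real.pi ^ 2 * ‖y‖ ^ 2 / (4 * Real.pi ^ 2 * τ)) = -(‖y‖ ^ 2 / (4 * τ)) := by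
      field_simp
    rw [← this]; push_cast; ring
  rw [h1, h2, ← Complex.ofReal_exp, Complex.ofReal_mul, Real.rpow_neg (by positivity),
    ← Real.inv_rpow (by positivity), Complex.ofReal_cpow (by positivity)]
  push_cast
  rfl

/-- The factor `τ^(-n/2)` of the heat kernel lowers the Gamma exponent from `s` to `s - n/2`, the
order of the Bessel function. -/
theorem kernelK_eq_integral (n : ℕ) (s : ℝ) {y : E n} (hy : y ≠ 0) :
    kernelK n s y = ∫ τ in Ioi (0 : ℝ),
      (Real.Gamma s)⁻¹ * (τ ^ (s - 1) * Real.exp (-τ)) * heatKernel n τ y := by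
  have hr : 0 < ‖y‖ := norm_pos_iff.mpr hy
  have hpi := Real.pi_pos
  have h := integral_heatIntegrand (s - n / 2) hr
  have e : ∀ τ ∈ Ioi (0 : ℝ), (Real.Gamma s)⁻¹ * (τ ^ (s - 1) * Real.exp (-τ)) * heatKernel n τ y =
      (Real.Gamma s)⁻¹ * (4 * Real.pi) ^ (-((n : ℝ) / 2)) * heatIntegrand (s - n / 2) ‖y‖ τ := by
    intro τ hτ
    have hτ0 : 0 < τ := hτ
    rw [heatKernel, heatIntegrand, Real.mul_rpow (by positivity) hτ0.le,
      show s - (n : ℝ) / 2 - 1 = (s - 1) + -((n : ℝ) / 2) by ring, Real.rpow_add hτ0, neg_add,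
      Real.exp_add]
    ring
  rw [setIntegral_congr_fun measurableSet_Ioi e, integral_const_mul, h, kernelK]
  rw [Real.div_rpow hr.le (by norm_num), show (4 : ℝ) * Real.pi = 2 * (2 * Real.pi) by ring,
    Real.mul_rpow (by norm_num : (0:ℝ) ≤ 2) (by positivity : 0 ≤ 2 * Real.pi),
    show (2 : ℝ) ^ (1 - s) = 2 * 2 ^ (-((n : ℝ) / 2)) / 2 ^ (s - (n : ℝ) / 2) by
      rw [eq_div_iff (by positivity), ← Real.rpow_add two_pos]
      have := Real.rpow_add (two_pos (α := ℝ)) 1 (-((n : ℝ) / 2))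
      rw [Real.rpow_one] at this
      rw [← this]
      congr 1; ring]
  ring

/-- Heat kernels are nonnegative of mass one, so the `L¹` norm reduces to a Gamma integral, which
converges for `s > 0`. -/
theorem integrable_gamma_heatKernel (n : ℕ) {s : ℝ} (hs : 0 < s) :
    Integrable (fun p : ℝ × E n =>
      (Real.Gamma s)⁻¹ * (p.1 ^ (s - 1) * Real.exp (-p.1)) * heatKernel n p.1 p.2)
      ((volume.restrict (Ioi 0)).prod volume) := by
  have hm := measurable_heatKernel n
  have hG : 0 < Real.Gamma s := Real.Gamma_pos_of_pos hs
  rw [integrable_prod_iff (Measurable.aestronglyMeasurable (by unfold Function.uncurry at hm; fun_prop))]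
  constructor
  · rw [ae_restrict_iff' measurableSet_Ioi]
    exact ae_of_all _ fun τ hτ => (integrable_heatKernel n hτ).const_mul
      ((Real.Gamma s)⁻¹ * (τ ^ (s - 1) * Real.exp (-τ)))
  · have h := (integrableOn_rpow_mul_exp hs one_pos).const_mul (Real.Gamma s)⁻¹
    refine h.congr ?_
    rw [EventuallyEq, ae_restrict_iff' measurableSet_Ioi]
    refine ae_of_all _ fun τ hτ => ?_
    have hτ0 : 0 < τ := hτ
    have : ∀ y : E n, ‖(Real.Gamma s)⁻¹ * (τ ^ (s - 1) * Real.exp (-τ)) * heatKernel n τ y‖ =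
        (Real.Gamma s)⁻¹ * (τ ^ (s - 1) * Real.exp (-τ)) * heatKernel n τ y := fun y => by
      rw [Real.norm_eq_abs, abs_of_nonneg]
      have := heatKernel_nonneg n hτ0 y
      positivity
    simp only [this]
    rw [integral_const_mul, integral_heatKernel n hτ0, one_mul, mul_one]

theorem integral_gamma_gaussian {n : ℕ} {s : ℝ} (hs : 0 < s) (ξ : E n) :
    ∫ τ in Ioi (0 : ℝ), (Real.Gamma s)⁻¹ * (τ ^ (s - 1) * Real.exp (-τ)) *
      Real.exp (-(4 * Real.pi ^ 2 * τ * ‖ξ‖ ^ 2)) = symbol n (-s) ξ := by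
  have hb : 0 < 1 + (2 * Real.pi * ‖ξ‖) ^ 2 := by positivity
  have h := Real.integral_rpow_mul_exp_neg_mul_Ioi hs hb
  have e : ∀ τ : ℝ, (Real.Gamma s)⁻¹ * (τ ^ (s - 1) * Real.exp (-τ)) *
      Real.exp (-(4 * Real.pi ^ 2 * τ * ‖ξ‖ ^ 2)) =
      (Real.Gamma s)⁻¹ * (τ ^ (s - 1) * Real.exp (-((1 + (2 * Real.pi * ‖ξ‖) ^ 2) * τ))) := by
    intro τ
    rw [mul_assoc, mul_assoc, ← Real.exp_add]
    congr 3
    ring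
  simp only [e]
  rw [integral_const_mul, h, symbol, Real.rpow_neg hb.le, one_div, Real.inv_rpow hb.le]
  field_simp [(Real.Gamma_pos_of_pos hs).ne']

/-- The kernel is a superposition of heat kernels. Fubini reduces the convolution to a single `τ`,
where the Fourier transform is moved from the Gaussian onto the reflected translate; a second
exchange and the Gamma integral reassemble the symbol of `A_{-s}`. -/
theorem kernelK_convolution {n : ℕ} (hn : 1 ≤ n) {s : ℝ} (hs : 0 < s) (m : 𝓢(E n, ℝ)) (x : E n) :
    ConvolutionExistsAt (kernelK n s) m x (ContinuousLinearMap.mul ℝ ℝ) volume ∧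
    (kernelK n s ⋆[ContinuousLinearMap.mul ℝ ℝ, volume] m) x = op (-s) m x := by
  have : Nonempty (Fin n) := ⟨⟨0, hn⟩⟩
  obtain ⟨C, hC⟩ := exists_norm_reflTranslate_le m x
  set c : ℝ → ℝ := fun τ => (Real.Gamma s)⁻¹ * (τ ^ (s - 1) * Real.exp (-τ)) with hc
  have hcm : Measurable c := by fun_prop
  have hci : IntegrableOn c (Ioi 0) := by
    simpa [IntegrableOn, hc] using (integrableOn_rpow_mul_exp hs one_pos).const_mul (Real.Gamma s)⁻¹
  -- The integral formula for the kernel is available off the origin, which is a null set because `n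
  -- ≥ 1`.
  have hne : ∀ᵐ y : E n, y ≠ 0 := by
    rw [ae_iff]; simp
  have hF : Integrable (fun p : ℝ × E n =>
      ((c p.1 * heatKernel n p.1 p.2 : ℝ) : ℂ) * reflTranslate m x p.2)
      ((volume.restrict (Ioi 0)).prod volume) := by
    have h := (integrable_gamma_heatKernel n hs).ofReal (𝕜 := ℂ)
    refine h.mul_bdd (c := C) ?_ (ae_of_all _ fun p => hC p.2)
    exact ((continuous_reflTranslate m x).comp continuous_snd).aestronglyMeasurable
  have hK : ∀ᵐ y : E n, ∫ τ in Ioi (0 : ℝ), ((c τ * heatKernel n τ y : ℝ) : ℂ) * reflTranslate m x y =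
      ((kernelK n s y * m (x - y) : ℝ) : ℂ) := by
    filter_upwards [hne] with y hy
    rw [integral_mul_const, integral_complex_ofReal, kernelK_eq_integral n s hy]
    simp [hc, reflTranslate]
  have hI := hF.integral_prod_right.congr hK
  refine ⟨?_, ?_⟩
  · have := hI.re
    simpa [ConvolutionExistsAt] using this
  · apply Complex.ofReal_injective
    rw [← integral_symbol_mul_fourier_reflTranslate]
    have e1 : (((kernelK n s ⋆[ContinuousLinearMap.mul ℝ ℝ, volume] m) x : ℝ) : ℂ) =
        ∫ y, ∫ τ in Ioi (0 : ℝ), ((c τ * heatKernel n τ y : ℝ) : ℂ) * reflTranslate m x y := by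
      rw [integral_congr_ae hK, integral_complex_ofReal, convolution_def]
      simp
    rw [e1, ← integral_integral_swap (f := fun (τ : ℝ) (y : E n) =>
      ((c τ * heatKernel n τ y : ℝ) : ℂ) * reflTranslate m x y) hF]
    have e2 : ∀ τ ∈ Ioi (0 : ℝ),
        ∫ y, ((c τ * heatKernel n τ y : ℝ) : ℂ) * reflTranslate m x y =
        ∫ ξ : E n, (c τ : ℂ) * ((Real.exp (-(4 * Real.pi ^ 2 * τ * ‖ξ‖ ^ 2)) : ℝ) : ℂ) *
          𝓕 (reflTranslate m x) ξ := by
      intro τ hτ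
      have hτ0 : 0 < τ := hτ
      have hg := (integrable_gaussian n (b := 4 * Real.pi ^ 2 * τ)
        (by have := Real.pi_pos; positivity)).ofReal (𝕜 := ℂ)
      have h := integral_fourier_mul_eq hg (integrable_reflTranslate m x)
      have e3 : ∀ y : E n, 𝓕 (fun ξ : E n =>
          (RCLike.ofReal (Real.exp (-(4 * Real.pi ^ 2 * τ * ‖ξ‖ ^ 2))) : ℂ)) y =
          (heatKernel n τ y : ℂ) := by
        intro y
        rw [← fourier_gaussian_eq_heatKernel n hτ0 y]
        refine congrArg (fun f : E n → ℂ => 𝓕 f y) ?_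
        funext ξ
        simp
      simp only [e3] at h
      calc _ = (c τ : ℂ) * ∫ y, (heatKernel n τ y : ℂ) * reflTranslate m x y := by
            rw [← integral_const_mul]; congr 1; funext y; push_cast; ring
        _ = _ := by
            rw [h, ← integral_const_mul]; congr 1; funext y; rw [mul_assoc (c τ : ℂ)]; rfl
    rw [setIntegral_congr_fun measurableSet_Ioi e2]
    have hF2 : Integrable (fun p : ℝ × E n =>
        (c p.1 : ℂ) * ((Real.exp (-(4 * Real.pi ^ 2 * p.1 * ‖p.2‖ ^ 2)) : ℝ) : ℂ) *
          𝓕 (reflTranslate m x) p.2) ((volume.restrict (Ioi 0)).prod volume) := by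
      have h := (hci.ofReal (𝕜 := ℂ)).mul_prod (integrable_fourier_reflTranslate m x)
      have hm : Measurable fun p : ℝ × E n =>
          ((Real.exp (-(4 * Real.pi ^ 2 * p.1 * ‖p.2‖ ^ 2)) : ℝ) : ℂ) := by fun_prop
      have h0 : ∀ᵐ p ∂((volume.restrict (Ioi (0 : ℝ))).prod (volume : Measure (E n))),
          p.1 ∈ Ioi (0 : ℝ) :=
        Measure.quasiMeasurePreserving_fst.ae (ae_restrict_mem measurableSet_Ioi)
      have h2 := Integrable.mul_bdd (c := 1) h hm.aestronglyMeasurable (by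
        filter_upwards [h0] with p hp
        have hp0 : 0 < p.1 := hp
        rw [Complex.norm_real, Real.norm_eq_abs, abs_of_pos (Real.exp_pos _),
          Real.exp_le_one_iff, neg_nonpos]
        positivity)
      exact h2.congr (ae_of_all _ fun p => mul_right_comm _ _ _)
    rw [integral_integral_swap hF2]
    congr 1
    ext ξ
    rw [integral_mul_const, ← integral_gamma_gaussian hs ξ]
    congr 1
    rw [← integral_complex_ofReal]
    simp [hc]

/-! ### Bessel functions of the first kind -/

/-- Since `cosh t - sinh t = exp (-t) ≤ 1`, integrability follows from that of the `cosh` integrand.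
-/
theorem exp_neg_sinh_le {α z t : ℝ} (hz : 0 ≤ z) (ht : 0 ≤ t) :
    Real.exp (-(z * Real.sinh t) - α * t) ≤
      Real.exp z * Real.exp (-α * t - z * Real.cosh t) := by
  rw [← Real.exp_add, Real.exp_le_exp]
  have h1 : Real.cosh t - Real.sinh t = Real.exp (-t) := Real.cosh_sub_sinh t
  have h2 : Real.exp (-t) ≤ 1 := Real.exp_le_one_iff.mpr (by linarith)
  nlinarith

theorem sinh_le_exp {t : ℝ} : Real.sinh t ≤ Real.exp t := by
  rw [Real.sinh_eq]
  have h1 := Real.exp_pos t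
  have h2 := Real.exp_pos (-t)
  linarith

theorem integrableOn_exp_neg_sinh (α : ℝ) {z : ℝ} (hz : 0 < z) :
    IntegrableOn (fun t => Real.exp (-(z * Real.sinh t) - α * t)) (Ioi 0) := by
  have h := ((integrable_exp_cosh (-α) hz).const_mul (Real.exp z)).integrableOn (s := Ioi 0)
  refine Integrable.mono' h (Continuous.aestronglyMeasurable (by fun_prop)) ?_
  rw [ae_restrict_iff' measurableSet_Ioi]
  refine ae_of_all _ fun t ht => ?_
  rw [Real.norm_eq_abs, abs_of_pos (Real.exp_pos _)]
  exact exp_neg_sinh_le hz.le (le_of_lt ht)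

theorem integrableOn_sinh_mul_exp_neg_sinh (α : ℝ) {z : ℝ} (hz : 0 < z) :
    IntegrableOn (fun t => Real.sinh t * Real.exp (-(z * Real.sinh t) - α * t)) (Ioi 0) := by
  refine Integrable.mono' (integrableOn_exp_neg_sinh (α - 1) hz)
    (Continuous.aestronglyMeasurable (by fun_prop)) ?_
  rw [ae_restrict_iff' measurableSet_Ioi]
  refine ae_of_all _ fun t ht => ?_
  have ht0 : 0 ≤ Real.sinh t := Real.sinh_nonneg_iff.mpr (le_of_lt ht)
  rw [Real.norm_eq_abs, abs_of_nonneg (by positivity),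
    show -(z * Real.sinh t) - (α - 1) * t = t + (-(z * Real.sinh t) - α * t) by ring, Real.exp_add]
  exact mul_le_mul_of_nonneg_right sinh_le_exp (Real.exp_pos _).le

theorem hasDerivAt_integral_exp_neg_sinh (α : ℝ) {z : ℝ} (hz : 0 < z) :
    HasDerivAt (fun z => ∫ t in Ioi (0 : ℝ), Real.exp (-(z * Real.sinh t) - α * t))
      (-∫ t in Ioi (0 : ℝ), Real.sinh t * Real.exp (-(z * Real.sinh t) - α * t)) z := by
  rw [← integral_neg]
  refine (hasDerivAt_integral_of_dominated_loc_of_deriv_le (s := Ioi (z / 2))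
    (F := fun z t => Real.exp (-(z * Real.sinh t) - α * t))
    (F' := fun z t => -(Real.sinh t * Real.exp (-(z * Real.sinh t) - α * t)))
    (bound := fun t => Real.sinh t * Real.exp (-(z / 2 * Real.sinh t) - α * t))
    (Ioi_mem_nhds (by linarith)) ?_ (integrableOn_exp_neg_sinh α hz)
    (Continuous.aestronglyMeasurable (by fun_prop)) ?_
    (integrableOn_sinh_mul_exp_neg_sinh α (by linarith)) ?_).2
  · exact Eventually.of_forall fun _ => Continuous.aestronglyMeasurable (by fun_prop)
  · rw [ae_restrict_iff' measurableSet_Ioi]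
    refine ae_of_all _ fun t ht w hw => ?_
    have ht0 : 0 ≤ Real.sinh t := Real.sinh_nonneg_iff.mpr (le_of_lt ht)
    have hw' : z / 2 < w := hw
    rw [norm_neg, Real.norm_eq_abs, abs_of_nonneg (by positivity)]
    gcongr
  · refine ae_of_all _ fun t w _ => ?_
    have h : HasDerivAt (fun w : ℝ => -(w * Real.sinh t) - α * t) (-(1 * Real.sinh t)) w :=
      (((hasDerivAt_id w).mul_const (Real.sinh t)).fun_neg).sub_const _
    exact h.exp.congr_deriv (by ring)

theorem hasDerivAt_integral_cos (α z : ℝ) :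
    HasDerivAt (fun z => ∫ t in (0 : ℝ)..Real.pi, Real.cos (α * t - z * Real.sin t))
      (∫ t in (0 : ℝ)..Real.pi, Real.sin t * Real.sin (α * t - z * Real.sin t)) z := by
  refine (intervalIntegral.hasDerivAt_integral_of_dominated_loc_of_deriv_le (s := univ)
    (F := fun z t => Real.cos (α * t - z * Real.sin t))
    (F' := fun z t => Real.sin t * Real.sin (α * t - z * Real.sin t))
    (bound := fun t => 1) univ_mem ?_
    (Continuous.intervalIntegrable (by fun_prop) _ _)
    (Continuous.aestronglyMeasurable (by fun_prop)) ?_ (by simp) ?_).2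
  · exact Eventually.of_forall fun _ => Continuous.aestronglyMeasurable (by fun_prop)
  · refine ae_of_all _ fun t _ w _ => ?_
    rw [norm_mul, Real.norm_eq_abs, Real.norm_eq_abs]
    exact mul_le_one₀ (Real.abs_sin_le_one _) (abs_nonneg _) (Real.abs_sin_le_one _)
  · refine ae_of_all _ fun t _ w _ => ?_
    have h : HasDerivAt (fun w : ℝ => α * t - w * Real.sin t) (-(1 * Real.sin t)) w :=
      ((hasDerivAt_id w).mul_const (Real.sin t)).const_sub _
    exact h.cos.congr_deriv (by ring)

/-- The integrand is an exact derivative. In `besselJ` the boundary value `sin (απ)` is cancelled by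
the boundary value `1` of `integral_exp_sinh_deriv`, which enters with the factor `sin (απ)`; this
makes the recurrences hold for non-integer orders. -/
theorem integral_cos_deriv (α z : ℝ) :
    ∫ t in (0 : ℝ)..Real.pi, (α - z * Real.cos t) * Real.cos (α * t - z * Real.sin t) =
      Real.sin (α * Real.pi) := by
  have h := intervalIntegral.integral_eq_sub_of_hasDerivAt (a := 0) (b := Real.pi)
    (f := fun t => Real.sin (α * t - z * Real.sin t))
    (f' := fun t => (α - z * Real.cos t) * Real.cos (α * t - z * Real.sin t))
    (fun t _ => by
      have h : HasDerivAt (fun t : ℝ => α * t - z * Real.sin t) (α * 1 - z * Real.cos t) t :=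
        ((hasDerivAt_id t).const_mul α).fun_sub ((Real.hasDerivAt_sin t).const_mul z)
      exact h.sin.congr_deriv (by ring)) (Continuous.intervalIntegrable (by fun_prop) _ _)
  rw [h]; simp

theorem integrableOn_cosh_mul_exp_neg_sinh (α : ℝ) {z : ℝ} (hz : 0 < z) :
    IntegrableOn (fun t => (z * Real.cosh t + α) * Real.exp (-(z * Real.sinh t) - α * t))
      (Ioi 0) := by
  have h1 := (integrableOn_sinh_mul_exp_neg_sinh α hz).const_mul z
  have h2 := (integrableOn_exp_neg_sinh (α + 1) hz).const_mul z
  have h3 := (integrableOn_exp_neg_sinh α hz).const_mul α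
  refine ((h1.add h2).add h3).congr (ae_of_all _ fun t => ?_)
  simp only [Pi.add_apply]
  rw [show -(z * Real.sinh t) - (α + 1) * t = -t + (-(z * Real.sinh t) - α * t) by ring,
    Real.exp_add (-t), ← Real.cosh_sub_sinh]
  ring

theorem integral_exp_sinh_deriv (α : ℝ) {z : ℝ} (hz : 0 < z) :
    ∫ t in Ioi (0 : ℝ), (z * Real.cosh t + α) * Real.exp (-(z * Real.sinh t) - α * t) = 1 := by
  have hd : ∀ t ∈ Ioi (0 : ℝ), HasDerivAt (fun t => -Real.exp (-(z * Real.sinh t) - α * t))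
      ((z * Real.cosh t + α) * Real.exp (-(z * Real.sinh t) - α * t)) t := fun t _ => by
    have h : HasDerivAt (fun t : ℝ => -(z * Real.sinh t) - α * t)
        (-(z * Real.cosh t) - α * 1) t :=
      (((Real.hasDerivAt_sinh t).const_mul z).fun_neg).fun_sub ((hasDerivAt_id t).const_mul α)
    exact h.exp.fun_neg.congr_deriv (by ring)
  have h := integral_Ioi_of_hasDerivAt_of_tendsto (a := 0)
    (Continuous.continuousWithinAt (by fun_prop)) hd (integrableOn_cosh_mul_exp_neg_sinh α hz)
    (tendsto_zero_of_hasDerivAt_of_integrableOn_Ioi hd (integrableOn_cosh_mul_exp_neg_sinh α hz)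
      (integrableOn_exp_neg_sinh α hz).neg)
  rw [h]; simp

/-- The integrals of order `α + 1` are expanded by the addition formula for the cosine and by `exp
(-t) = cosh t - sinh t`. The terms with `cos t` and `cosh t` are then eliminated by the two exact
derivatives. -/
theorem hasDerivAt_besselJ (α : ℝ) {z : ℝ} (hz : 0 < z) :
    HasDerivAt (besselJ α) (α / z * besselJ α z - besselJ (α + 1) z) z := by
  have h := ((hasDerivAt_integral_cos α z).const_mul (1 / Real.pi)).fun_sub
    ((hasDerivAt_integral_exp_neg_sinh α hz).const_mul (Real.sin (α * Real.pi) / Real.pi))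
  refine h.congr_deriv ?_
  have h1 := integral_exp_sinh_deriv α hz
  have e1 : ∫ t in (0 : ℝ)..Real.pi, Real.cos ((α + 1) * t - z * Real.sin t) =
      1 / z * (α * ∫ t in (0 : ℝ)..Real.pi, Real.cos (α * t - z * Real.sin t)) -
      (∫ t in (0 : ℝ)..Real.pi, Real.sin t * Real.sin (α * t - z * Real.sin t)) -
      1 / z * Real.sin (α * Real.pi) := by
    rw [← integral_cos_deriv α z, ← intervalIntegral.integral_const_mul,
      ← intervalIntegral.integral_const_mul, ← intervalIntegral.integral_const_mul,
      ← intervalIntegral.integral_sub, ← intervalIntegral.integral_sub]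
    · refine intervalIntegral.integral_congr fun t _ => ?_
      rw [show (α + 1) * t - z * Real.sin t = (α * t - z * Real.sin t) + t by ring, Real.cos_add]
      field_simp
      ring
    all_goals exact Continuous.intervalIntegrable (by fun_prop) _ _
  have e2 : ∫ t in Ioi (0 : ℝ), Real.exp (-(z * Real.sinh t) - (α + 1) * t) =
      1 / z - (∫ t in Ioi (0 : ℝ), Real.sinh t * Real.exp (-(z * Real.sinh t) - α * t)) -
      α / z * ∫ t in Ioi (0 : ℝ), Real.exp (-(z * Real.sinh t) - α * t) := by
    rw [show 1 / z = ∫ t in Ioi (0 : ℝ), 1 / z * ((z * Real.cosh t + α) *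
      Real.exp (-(z * Real.sinh t) - α * t)) by rw [integral_const_mul, h1, mul_one],
      ← integral_const_mul, ← integral_sub, ← integral_sub]
    · refine integral_congr_ae (ae_of_all _ fun t => ?_)
      simp only
      rw [show -(z * Real.sinh t) - (α + 1) * t = -t + (-(z * Real.sinh t) - α * t) by ring,
        Real.exp_add (-t), ← Real.cosh_sub_sinh]
      field_simp
      ring
    · exact ((integrableOn_cosh_mul_exp_neg_sinh α hz).const_mul _).sub
        (integrableOn_sinh_mul_exp_neg_sinh α hz)
    · exact (integrableOn_exp_neg_sinh α hz).const_mul _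
    · exact (integrableOn_cosh_mul_exp_neg_sinh α hz).const_mul _
    · exact integrableOn_sinh_mul_exp_neg_sinh α hz
  unfold besselJ
  rw [e1, e2, add_mul, one_mul, Real.sin_add_pi]
  have key : ∀ C S A B σ p : ℝ, p ≠ 0 → 1 / p * S - σ / p * -B =
      α / z * (1 / p * C - σ / p * A) -
      (1 / p * (1 / z * (α * C) - S - 1 / z * σ) - -σ / p * (1 / z - B - α / z * A)) := by
    intro C S A B σ p hp
    field_simp
    ring
  exact key _ _ _ _ _ _ Real.pi_ne_zero

theorem hasDerivAt_besselJ' (α : ℝ) {z : ℝ} (hz : 0 < z) :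
    HasDerivAt (besselJ α) (besselJ (α - 1) z - α / z * besselJ α z) z := by
  have h := ((hasDerivAt_integral_cos α z).const_mul (1 / Real.pi)).fun_sub
    ((hasDerivAt_integral_exp_neg_sinh α hz).const_mul (Real.sin (α * Real.pi) / Real.pi))
  refine h.congr_deriv ?_
  have h1 := integral_exp_sinh_deriv α hz
  have e1 : ∫ t in (0 : ℝ)..Real.pi, Real.cos ((α - 1) * t - z * Real.sin t) =
      1 / z * (α * ∫ t in (0 : ℝ)..Real.pi, Real.cos (α * t - z * Real.sin t)) +
      (∫ t in (0 : ℝ)..Real.pi, Real.sin t * Real.sin (α * t - z * Real.sin t)) -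
      1 / z * Real.sin (α * Real.pi) := by
    rw [← integral_cos_deriv α z, ← intervalIntegral.integral_const_mul,
      ← intervalIntegral.integral_const_mul, ← intervalIntegral.integral_const_mul,
      ← intervalIntegral.integral_add, ← intervalIntegral.integral_sub]
    · refine intervalIntegral.integral_congr fun t _ => ?_
      rw [show (α - 1) * t - z * Real.sin t = (α * t - z * Real.sin t) - t by ring, Real.cos_sub]
      field_simp
      ring
    all_goals exact Continuous.intervalIntegrable (by fun_prop) _ _
  have e2 : ∫ t in Ioi (0 : ℝ), Real.exp (-(z * Real.sinh t) - (α - 1) * t) =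
      1 / z + (∫ t in Ioi (0 : ℝ), Real.sinh t * Real.exp (-(z * Real.sinh t) - α * t)) -
      α / z * ∫ t in Ioi (0 : ℝ), Real.exp (-(z * Real.sinh t) - α * t) := by
    rw [show 1 / z = ∫ t in Ioi (0 : ℝ), 1 / z * ((z * Real.cosh t + α) *
      Real.exp (-(z * Real.sinh t) - α * t)) by rw [integral_const_mul, h1, mul_one],
      ← integral_const_mul, ← integral_add, ← integral_sub]
    · refine integral_congr_ae (ae_of_all _ fun t => ?_)
      simp only
      rw [show -(z * Real.sinh t) - (α - 1) * t = t + (-(z * Real.sinh t) - α * t) by ring,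
        Real.exp_add t, ← Real.cosh_add_sinh]
      field_simp
      ring
    · exact ((integrableOn_cosh_mul_exp_neg_sinh α hz).const_mul _).add
        (integrableOn_sinh_mul_exp_neg_sinh α hz)
    · exact (integrableOn_exp_neg_sinh α hz).const_mul _
    · exact (integrableOn_cosh_mul_exp_neg_sinh α hz).const_mul _
    · exact integrableOn_sinh_mul_exp_neg_sinh α hz
  unfold besselJ
  rw [e1, e2, sub_mul, one_mul, Real.sin_sub_pi]
  have key : ∀ C S A B σ p : ℝ, p ≠ 0 → 1 / p * S - σ / p * -B =
      1 / p * (1 / z * (α * C) + S - 1 / z * σ) - -σ / p * (1 / z + B - α / z * A) -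
      α / z * (1 / p * C - σ / p * A) := by
    intro C S A B σ p hp
    field_simp
    ring
  exact key _ _ _ _ _ _ Real.pi_ne_zero

/-! ### Bessel functions of order `±1/2` -/

theorem hasDerivAt_sqrt_mul_besselJ_neg_half {z : ℝ} (hz : 0 < z) :
    HasDerivAt (fun z => √z * besselJ (-(1 / 2)) z) (-(√z * besselJ (1 / 2) z)) z := by
  have h := (Real.hasDerivAt_sqrt hz.ne').fun_mul (hasDerivAt_besselJ (-(1 / 2)) hz)
  refine h.congr_deriv ?_
  rw [show (-(1 / 2) : ℝ) + 1 = 1 / 2 by norm_num]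
  have h2 : z = √z * √z := (Real.mul_self_sqrt hz.le).symm
  have h3 : √z ≠ 0 := (Real.sqrt_pos.mpr hz).ne'
  have h4 : -(1 / 2) / z = -(1 / 2) / (√z * √z) := by rw [← h2]
  rw [h4]
  field_simp
  ring

theorem hasDerivAt_sqrt_mul_besselJ_half {z : ℝ} (hz : 0 < z) :
    HasDerivAt (fun z => √z * besselJ (1 / 2) z) (√z * besselJ (-(1 / 2)) z) z := by
  have h := (Real.hasDerivAt_sqrt hz.ne').fun_mul (hasDerivAt_besselJ' (1 / 2) hz)
  refine h.congr_deriv ?_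
  rw [show (1 / 2 : ℝ) - 1 = -(1 / 2) by norm_num]
  have h2 : z = √z * √z := (Real.mul_self_sqrt hz.le).symm
  have h3 : √z ≠ 0 := (Real.sqrt_pos.mpr hz).ne'
  have h4 : 1 / 2 / z = 1 / 2 / (√z * √z) := by rw [← h2]
  rw [h4]
  field_simp
  ring

theorem abs_integral_cos_le (α z : ℝ) :
    |∫ t in (0 : ℝ)..Real.pi, Real.cos (α * t - z * Real.sin t)| ≤ Real.pi := by
  have h := intervalIntegral.norm_integral_le_of_norm_le_const (a := 0) (b := Real.pi) (C := 1)
    (f := fun t => Real.cos (α * t - z * Real.sin t)) fun t _ => Real.abs_cos_le_one _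
  simpa [abs_of_pos Real.pi_pos] using h

theorem abs_besselJ_half_le {z : ℝ} (hz : 0 < z) : |besselJ (1 / 2) z| ≤ 2 := by
  have hpi := Real.pi_gt_three
  have h1 : ∫ t in Ioi (0 : ℝ), Real.exp (-(z * Real.sinh t) - 1 / 2 * t) ≤ 2 := by
    have h2 : ∫ t in Ioi (0 : ℝ), Real.exp (-(1 / 2) * t) = 2 := by
      rw [integral_exp_mul_Ioi (by norm_num)]; norm_num
    refine le_of_le_of_eq ?_ h2
    refine setIntegral_mono_on (integrableOn_exp_neg_sinh _ hz)
      (integrableOn_exp_mul_Ioi (by norm_num) 0) measurableSet_Ioi fun t ht => ?_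
    have ht0 : 0 ≤ Real.sinh t := Real.sinh_nonneg_iff.mpr (le_of_lt ht)
    rw [Real.exp_le_exp]
    nlinarith
  have h0 : 0 ≤ ∫ t in Ioi (0 : ℝ), Real.exp (-(z * Real.sinh t) - 1 / 2 * t) :=
    integral_nonneg fun t => (Real.exp_pos _).le
  have h3 := abs_integral_cos_le (1 / 2) z
  unfold besselJ
  have e : Real.sin (1 / 2 * Real.pi) = 1 := by
    rw [show 1 / 2 * Real.pi = Real.pi / 2 by ring, Real.sin_pi_div_two]
  rw [e]
  set A := ∫ t in (0 : ℝ)..Real.pi, Real.cos (1 / 2 * t - z * Real.sin t)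
  set B := ∫ t in Ioi (0 : ℝ), Real.exp (-(z * Real.sinh t) - 1 / 2 * t)
  rw [show 1 / Real.pi * A - 1 / Real.pi * B = (A - B) / Real.pi by ring, abs_div,
    abs_of_pos Real.pi_pos, div_le_iff₀ Real.pi_pos, abs_le]
  rw [abs_le] at h3
  constructor <;> linarith

/-- Substitute `u = √z exp (t/2)`, so that `u² = z exp t`. -/
theorem integral_exp_half_mul_exp {z : ℝ} (hz : 0 < z) :
    ∫ t in Ioi (0 : ℝ), √z * Real.exp (t / 2) * Real.exp (-(z * Real.exp t / 2)) =
      2 * ∫ u in Ioi √z, Real.exp (-(1 / 2) * u ^ 2) := by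
  have hz2 : 0 < √z := Real.sqrt_pos.mpr hz
  have hg : Integrable (fun u : ℝ => 2 * Real.exp (-(1 / 2) * u ^ 2)) :=
    (integrable_exp_neg_mul_sq (by norm_num : (0 : ℝ) < 1 / 2)).const_mul 2
  have e : ∀ t : ℝ, ((fun u : ℝ => 2 * Real.exp (-(1 / 2) * u ^ 2)) ∘
      fun t => √z * Real.exp (t / 2)) t * (√z * Real.exp (t / 2) * (1 / 2)) =
      √z * Real.exp (t / 2) * Real.exp (-(z * Real.exp t / 2)) := by
    intro t
    have h1 : (√z * Real.exp (t / 2)) ^ 2 = z * Real.exp t := by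
      rw [mul_pow, Real.sq_sqrt hz.le, ← Real.exp_nat_mul]
      congr 2
      push_cast
      ring
    simp only [Function.comp_apply, h1]
    rw [show -(1 / 2) * (z * Real.exp t) = -(z * Real.exp t / 2) by ring]
    ring
  have hint : IntegrableOn (fun t => √z * Real.exp (t / 2) * Real.exp (-(z * Real.exp t / 2)))
      (Ici 0) := by
    rw [integrableOn_Ici_iff_integrableOn_Ioi]
    refine Integrable.mono' ((integrableOn_exp_neg_sinh (-(1 / 2)) hz).const_mul √z)
      (Continuous.aestronglyMeasurable (by fun_prop)) ?_
    rw [ae_restrict_iff' measurableSet_Ioi]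
    refine ae_of_all _ fun t ht => ?_
    rw [Real.norm_eq_abs, abs_of_nonneg (by positivity), mul_assoc, ← Real.exp_add, Real.sinh_eq]
    have := Real.exp_pos (-t)
    gcongr
    nlinarith
  have h := integral_comp_mul_deriv_Ioi (f := fun t => √z * Real.exp (t / 2))
    (f' := fun t => √z * Real.exp (t / 2) * (1 / 2))
    (g := fun u => 2 * Real.exp (-(1 / 2) * u ^ 2)) (a := 0)
    (Continuous.continuousOn (by fun_prop))
    ((Real.tendsto_exp_atTop.comp (tendsto_id.atTop_div_const two_pos)).const_mul_atTop hz2)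
    (fun t _ => by
      have h : HasDerivAt (fun t : ℝ => t / 2) (1 / 2) t := (hasDerivAt_id t).div_const 2
      exact ((h.exp.const_mul √z).congr_deriv (by ring)).hasDerivWithinAt)
    (Continuous.continuousOn (by fun_prop)) hg.integrableOn (by simpa only [e] using hint)
  simp only [e] at h
  rw [h, integral_const_mul]
  simp

/-- Replacing `sinh t` by `exp t / 2` changes the integrand by a factor between `1` and `exp (z/2)`.
The modified integral is a Gaussian tail over `(√z, ∞)`, so the claim follows by squeezing. -/
theorem tendsto_sqrt_mul_integral :
    Tendsto (fun z => √z * ∫ t in Ioi (0 : ℝ), Real.exp (-(z * Real.sinh t) - -(1 / 2) * t))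
      (𝓝[>] 0) (𝓝 √(2 * Real.pi)) := by
  have hg : IntegrableOn (fun u : ℝ => Real.exp (-(1 / 2) * u ^ 2)) (Ioi 0) :=
    (integrable_exp_neg_mul_sq (by norm_num : (0 : ℝ) < 1 / 2)).integrableOn
  have hG : ∫ u in Ioi (0 : ℝ), Real.exp (-(1 / 2) * u ^ 2) = √(2 * Real.pi) / 2 := by
    rw [integral_gaussian_Ioi]; congr 2; ring
  have hlow : ∀ z : ℝ, 0 < z → √(2 * Real.pi) - 2 * √z ≤
      2 * ∫ u in Ioi √z, Real.exp (-(1 / 2) * u ^ 2) := by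
    intro z hz
    have h := intervalIntegral.integral_Ioi_sub_Ioi hg (Real.sqrt_nonneg z)
    have h2 := intervalIntegral.norm_integral_le_of_norm_le_const (a := 0) (b := √z) (C := 1)
      (f := fun u => Real.exp (-(1 / 2) * u ^ 2)) fun t _ => by
        rw [Real.norm_eq_abs, abs_of_pos (Real.exp_pos _), Real.exp_le_one_iff]
        nlinarith [sq_nonneg t]
    rw [sub_zero, abs_of_nonneg (Real.sqrt_nonneg z), one_mul, Real.norm_eq_abs, ← h, hG] at h2
    have := le_of_abs_le h2
    linarith
  have hupp : ∀ z : ℝ, 0 < z → 2 * ∫ u in Ioi √z, Real.exp (-(1 / 2) * u ^ 2) ≤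
      √(2 * Real.pi) := by
    intro z hz
    have h := setIntegral_mono_set (t := Ioi 0) (s := Ioi √z) hg
      (ae_of_all _ fun u => (Real.exp_pos _).le)
      (LE.le.eventuallyLE (Ioi_subset_Ioi (Real.sqrt_nonneg z)))
    rw [hG] at h
    linarith
  have hI : ∀ z : ℝ, 0 < z → ∀ t : ℝ, 0 < t →
      √z * Real.exp (t / 2) * Real.exp (-(z * Real.exp t / 2)) ≤
        √z * Real.exp (-(z * Real.sinh t) - -(1 / 2) * t) := by
    intro z hz t ht
    rw [mul_assoc, ← Real.exp_add, Real.sinh_eq]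
    have := Real.exp_pos (-t)
    gcongr
    nlinarith
  have hI2 : ∀ z : ℝ, 0 < z → ∀ t : ℝ, 0 < t →
      √z * Real.exp (-(z * Real.sinh t) - -(1 / 2) * t) ≤ Real.exp (z / 2) *
      (√z * Real.exp (t / 2) * Real.exp (-(z * Real.exp t / 2))) := by
    intro z hz t ht
    rw [show Real.exp (z / 2) * (√z * Real.exp (t / 2) * Real.exp (-(z * Real.exp t / 2))) =
      √z * (Real.exp (z / 2) * (Real.exp (t / 2) * Real.exp (-(z * Real.exp t / 2)))) by ring,
      ← Real.exp_add, ← Real.exp_add, Real.sinh_eq]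
    have : Real.exp (-t) ≤ 1 := Real.exp_le_one_iff.mpr (by linarith)
    gcongr
    nlinarith
  have hi1 : ∀ z : ℝ, 0 < z → IntegrableOn (fun t =>
      √z * Real.exp (-(z * Real.sinh t) - -(1 / 2) * t)) (Ioi 0) := fun z hz =>
    (integrableOn_exp_neg_sinh _ hz).const_mul _
  have hi2 : ∀ z : ℝ, 0 < z → IntegrableOn (fun t =>
      √z * Real.exp (t / 2) * Real.exp (-(z * Real.exp t / 2))) (Ioi 0) := fun z hz => by
    refine Integrable.mono' (hi1 z hz) (Continuous.aestronglyMeasurable (by fun_prop)) ?_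
    rw [ae_restrict_iff' measurableSet_Ioi]
    refine ae_of_all _ fun t ht => ?_
    rw [Real.norm_eq_abs, abs_of_nonneg (by positivity)]
    exact hI z hz t ht
  refine tendsto_of_tendsto_of_tendsto_of_le_of_le' (g := fun z => √(2 * Real.pi) - 2 * √z)
    (h := fun z => Real.exp (z / 2) * √(2 * Real.pi)) ?_ ?_ ?_ ?_
  · have : Continuous fun z : ℝ => √(2 * Real.pi) - 2 * √z := by fun_prop
    have h := (this.tendsto 0).mono_left (nhdsWithin_le_nhds (s := Ioi 0))
    simpa using h
  · have : Continuous fun z : ℝ => Real.exp (z / 2) * √(2 * Real.pi) := by fun_prop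
    have h := (this.tendsto 0).mono_left (nhdsWithin_le_nhds (s := Ioi 0))
    simpa using h
  · filter_upwards [self_mem_nhdsWithin] with z hz
    refine (hlow z hz).trans ?_
    rw [← integral_exp_half_mul_exp hz, ← integral_const_mul]
    exact setIntegral_mono_on (hi2 z hz) (hi1 z hz) measurableSet_Ioi (hI z hz)
  · filter_upwards [self_mem_nhdsWithin] with z hz
    refine le_trans ?_ (mul_le_mul_of_nonneg_left (hupp z hz) (Real.exp_pos _).le)
    rw [← integral_exp_half_mul_exp hz, ← integral_const_mul, ← integral_const_mul]
    exact setIntegral_mono_on (hi1 z hz) ((hi2 z hz).const_mul _) measurableSet_Ioi (hI2 z hz)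

theorem tendsto_sqrt_mul_of_bounded {f : ℝ → ℝ} {C : ℝ} (hf : ∀ z, 0 < z → |f z| ≤ C) :
    Tendsto (fun z => √z * f z) (𝓝[>] 0) (𝓝 0) := by
  have h1 : Tendsto (fun z : ℝ => √z) (𝓝[>] 0) (𝓝 0) := by
    have h := (Real.continuous_sqrt.tendsto 0).mono_left (nhdsWithin_le_nhds (s := Ioi 0))
    simpa using h
  refine Tendsto.zero_mul_isBoundedUnder_le h1 ⟨C, ?_⟩
  rw [eventually_map]
  filter_upwards [self_mem_nhdsWithin] with z hz
  exact hf z hz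

/-- Multiplied by `√z`, the two functions satisfy `C' = -S` and `S' = C`, so `C cos + S sin` and `C
sin - S cos` are constant. Their values are the limits at `0`. -/
theorem besselJ_half_formulas :
    (∀ z, 0 < z → √z * besselJ (-(1 / 2)) z = √(2 / Real.pi) * Real.cos z) ∧
    ∀ z, 0 < z → √z * besselJ (1 / 2) z = √(2 / Real.pi) * Real.sin z := by
  set C := fun z => √z * besselJ (-(1 / 2)) z with hC
  set S := fun z => √z * besselJ (1 / 2) z with hS
  have hC' : ∀ z, 0 < z → HasDerivAt C (-S z) z := fun z hz =>
    hasDerivAt_sqrt_mul_besselJ_neg_half hz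
  have hS' : ∀ z, 0 < z → HasDerivAt S (C z) z := fun z hz => hasDerivAt_sqrt_mul_besselJ_half hz
  have hSlim : Tendsto S (𝓝[>] 0) (𝓝 0) :=
    tendsto_sqrt_mul_of_bounded fun z hz => abs_besselJ_half_le hz
  have hClim : Tendsto C (𝓝[>] 0) (𝓝 √(2 / Real.pi)) := by
    have h1 := tendsto_sqrt_mul_of_bounded
      (f := fun z => 1 / Real.pi * ∫ t in (0 : ℝ)..Real.pi, Real.cos (-(1 / 2) * t - z * Real.sin t))
      (C := 1) fun z _ => by
        rw [abs_mul, abs_of_pos (by have := Real.pi_pos; positivity), one_div,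
          inv_mul_le_iff₀ Real.pi_pos, mul_one]
        exact abs_integral_cos_le _ z
    have h2 := h1.add (tendsto_sqrt_mul_integral.const_mul (1 / Real.pi))
    have e : 0 + 1 / Real.pi * √(2 * Real.pi) = √(2 / Real.pi) := by
      rw [Real.sqrt_div (by norm_num), Real.sqrt_mul (by norm_num)]
      have h3 : √Real.pi ≠ 0 := (Real.sqrt_pos.mpr Real.pi_pos).ne'
      have h4 : 1 / Real.pi = 1 / (√Real.pi * √Real.pi) := by
        rw [Real.mul_self_sqrt Real.pi_pos.le]
      rw [h4]
      field_simp
      ring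
    rw [e] at h2
    refine h2.congr fun z => ?_
    simp only [hC, besselJ]
    have e : Real.sin (-(1 / 2) * Real.pi) = -1 := by
      rw [show -(1 / 2) * Real.pi = -(Real.pi / 2) by ring, Real.sin_neg, Real.sin_pi_div_two]
    rw [e]
    ring
  have hsin : Tendsto Real.sin (𝓝[>] 0) (𝓝 0) := by
    have h := (Real.continuous_sin.tendsto 0).mono_left (nhdsWithin_le_nhds (s := Ioi 0))
    simpa using h
  have hcos : Tendsto Real.cos (𝓝[>] 0) (𝓝 1) := by
    have h := (Real.continuous_cos.tendsto 0).mono_left (nhdsWithin_le_nhds (s := Ioi 0))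
    simpa using h
  have hconst : ∀ F : ℝ → ℝ, (∀ z, 0 < z → HasDerivAt F 0 z) → ∀ l, Tendsto F (𝓝[>] 0) (𝓝 l) →
      ∀ z, 0 < z → F z = l := by
    intro F hF l hl z hz
    obtain ⟨a, ha⟩ := isOpen_Ioi.exists_is_const_of_deriv_eq_zero
      isPreconnected_Ioi (fun z hz => (hF z hz).differentiableAt.differentiableWithinAt)
      (fun z hz => (hF z hz).deriv)
    have h2 : Tendsto F (𝓝[>] 0) (𝓝 a) := by
      refine tendsto_const_nhds.congr' ?_
      filter_upwards [self_mem_nhdsWithin] with w hw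
      exact (ha w hw).symm
    rw [ha z hz]
    exact tendsto_nhds_unique h2 hl
  have h1 := hconst (fun z => C z * Real.cos z + S z * Real.sin z) (fun z hz =>
    (((hC' z hz).fun_mul (Real.hasDerivAt_cos z)).fun_add
      ((hS' z hz).fun_mul (Real.hasDerivAt_sin z))).congr_deriv (by ring)) _
    ((hClim.mul hcos).add (hSlim.mul hsin))
  have h2 := hconst (fun z => C z * Real.sin z - S z * Real.cos z) (fun z hz =>
    (((hC' z hz).fun_mul (Real.hasDerivAt_sin z)).fun_sub
      ((hS' z hz).fun_mul (Real.hasDerivAt_cos z))).congr_deriv (by ring)) _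
    ((hClim.mul hsin).sub (hSlim.mul hcos))
  simp only [mul_one, mul_zero, add_zero, sub_zero] at h1 h2
  constructor
  · intro z hz
    linear_combination Real.cos z * h1 z hz + Real.sin z * h2 z hz - C z * Real.sin_sq_add_cos_sq z
  · intro z hz
    linear_combination Real.sin z * h1 z hz - Real.cos z * h2 z hz - S z * Real.sin_sq_add_cos_sq z

/-! ### Poisson's integral -/

/-- Poisson's integral `∫_0^π cos (z cos θ) sinᵖ θ dθ`. -/
def poisson (p : ℕ) (z : ℝ) : ℝ :=
  ∫ θ in (0 : ℝ)..Real.pi, Real.cos (z * Real.cos θ) * Real.sin θ ^ p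

/-- Differentiation under the integral is followed by an integration by parts with the function `sin
(z cos θ) sin^(p+1) θ`, which vanishes at both ends; this raises the power of the sine by two. -/
theorem hasDerivAt_poisson (p : ℕ) (z : ℝ) :
    HasDerivAt (poisson p) (-(z / (p + 1) * poisson (p + 2) z)) z := by
  have h := (intervalIntegral.hasDerivAt_integral_of_dominated_loc_of_deriv_le (s := univ)
    (μ := volume) (a := 0) (b := Real.pi)
    (F := fun z θ => Real.cos (z * Real.cos θ) * Real.sin θ ^ p) (x₀ := z)
    (F' := fun z θ => -(Real.cos θ * Real.sin (z * Real.cos θ) * Real.sin θ ^ p))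
    (bound := fun t => 1) univ_mem
    (Eventually.of_forall fun _ => Continuous.aestronglyMeasurable (by fun_prop))
    (Continuous.intervalIntegrable (by fun_prop) _ _)
    (Continuous.aestronglyMeasurable (by fun_prop))
    (ae_of_all _ fun t _ w _ => by
      rw [norm_neg, norm_mul, norm_mul, norm_pow]
      exact mul_le_one₀ (mul_le_one₀ (Real.abs_cos_le_one _) (norm_nonneg _)
        (Real.abs_sin_le_one _)) (by positivity)
        (pow_le_one₀ (norm_nonneg _) (Real.abs_sin_le_one _)))
    (by simp)
    (ae_of_all _ fun t _ w _ => by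
      have h : HasDerivAt (fun w : ℝ => w * Real.cos t) (1 * Real.cos t) w :=
        (hasDerivAt_id w).mul_const (Real.cos t)
      exact (h.cos.mul_const _).congr_deriv (by ring))).2
  refine h.congr_deriv ?_
  have hp : (p : ℝ) + 1 ≠ 0 := by positivity
  have h2 := intervalIntegral.integral_eq_sub_of_hasDerivAt (a := 0) (b := Real.pi)
    (f := fun θ => Real.sin (z * Real.cos θ) * Real.sin θ ^ (p + 1))
    (f' := fun θ => (p + 1) * (Real.cos θ * Real.sin (z * Real.cos θ) * Real.sin θ ^ p) -
      z * (Real.cos (z * Real.cos θ) * Real.sin θ ^ (p + 2)))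
    (fun θ _ => by
      have h := ((Real.hasDerivAt_cos θ).const_mul z).sin.fun_mul
        ((Real.hasDerivAt_sin θ).fun_pow (p + 1))
      exact h.congr_deriv (by push_cast; ring))
    (Continuous.intervalIntegrable (by fun_prop) _ _)
  rw [intervalIntegral.integral_sub (Continuous.intervalIntegrable (by fun_prop) _ _)
    (Continuous.intervalIntegrable (by fun_prop) _ _), intervalIntegral.integral_const_mul,
    intervalIntegral.integral_const_mul] at h2
  simp only [Real.sin_pi, Real.sin_zero, zero_pow (Nat.succ_ne_zero p), mul_zero, sub_zero] at h2
  rw [intervalIntegral.integral_neg, neg_inj, div_mul_eq_mul_div, eq_div_iff hp]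
  unfold poisson
  linarith

/-- The integrand `cos (z sin t)` has period `π`, so a shift by `π/2` replaces the sine by the
cosine. -/
theorem besselJ_zero_eq_poisson (z : ℝ) : Real.pi * besselJ 0 z = poisson 0 z := by
  have hper : Function.Periodic (fun t => Real.cos (z * Real.sin t)) Real.pi := by
    intro t
    simp [Real.sin_add_pi]
  have h := hper.intervalIntegral_add_eq (Real.pi / 2) 0
  have h2 := intervalIntegral.integral_comp_add_right (a := 0) (b := Real.pi)
    (fun t => Real.cos (z * Real.sin t)) (Real.pi / 2)
  simp only [Real.sin_add_pi_div_two, zero_add] at h2 h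
  rw [add_comm Real.pi, h] at h2
  unfold besselJ poisson
  simp only [zero_mul, Real.sin_zero, zero_div, sub_zero, zero_sub, Real.cos_neg, pow_zero, mul_one]
  rw [h2]
  field_simp [Real.pi_ne_zero]

theorem poisson_one {z : ℝ} (hz : 0 < z) : poisson 1 z = 2 * Real.sin z / z := by
  have h2 := intervalIntegral.integral_eq_sub_of_hasDerivAt (a := 0) (b := Real.pi)
    (f := fun θ => -(Real.sin (z * Real.cos θ) / z))
    (f' := fun θ => Real.cos (z * Real.cos θ) * Real.sin θ ^ 1)
    (fun θ _ => by
      have h := (((Real.hasDerivAt_cos θ).const_mul z).sin.div_const z).fun_neg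
      exact h.congr_deriv (by field_simp))
    (Continuous.intervalIntegrable (by fun_prop) _ _)
  unfold poisson
  rw [h2]
  simp
  ring

/-- Differentiating the identity for `p` gives the one for `p + 2`: on the left by
`hasDerivAt_poisson`, on the right by the recurrence for `J`, where the terms from the power of `z`
cancel. The steps of two need the cases `p = 0` and `p = 1`. -/
theorem poisson_eq (p : ℕ) : ∀ z : ℝ, 0 < z → poisson p z =
    √Real.pi * Real.Gamma (((p : ℝ) + 1) / 2) * 2 ^ ((p : ℝ) / 2) *
      (z ^ (-((p : ℝ) / 2)) * besselJ ((p : ℝ) / 2) z) := by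
  induction p using Nat.twoStepInduction with
  | zero =>
    intro z hz
    rw [← besselJ_zero_eq_poisson]
    have : √Real.pi * Real.Gamma (1 / 2) = Real.pi := by
      rw [Real.Gamma_one_half_eq, Real.mul_self_sqrt Real.pi_pos.le]
    simp only [Nat.cast_zero, zero_div, zero_add, neg_zero, Real.rpow_zero, one_mul, mul_one, this]
  | one =>
    intro z hz
    have h := besselJ_half_formulas.2 z hz
    rw [poisson_one hz]
    have hz2 : 0 < √z := Real.sqrt_pos.mpr hz
    have e1 : besselJ (1 / 2) z = √(2 / Real.pi) * Real.sin z / √z := by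
      rw [← h]; field_simp
    have e2 : z ^ (-(1 / 2) : ℝ) = 1 / √z := by
      rw [Real.rpow_neg hz.le, ← Real.sqrt_eq_rpow, one_div]
    have e3 : √(2 / Real.pi) = √2 / √Real.pi := Real.sqrt_div (by norm_num) _
    have h3 : √Real.pi ≠ 0 := (Real.sqrt_pos.mpr Real.pi_pos).ne'
    simp only [Nat.cast_one]
    rw [e1, e2, e3, ← Real.sqrt_eq_rpow, show ((1 : ℝ) + 1) / 2 = 1 by norm_num, Real.Gamma_one]
    have h4 : √z ^ 2 = z := Real.sq_sqrt hz.le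
    have h5 : √2 ^ 2 = (2 : ℝ) := Real.sq_sqrt (by norm_num)
    field_simp
    rw [h4, h5]
    ring
  | more p ih _ =>
    intro z hz
    set a := (p : ℝ) / 2 with ha
    have h1 := hasDerivAt_poisson p z
    have h2 := ((Real.hasDerivAt_rpow_const (p := -a) (Or.inl hz.ne')).fun_mul
      (hasDerivAt_besselJ a hz)).const_mul (√Real.pi * Real.Gamma (((p : ℝ) + 1) / 2) * 2 ^ a)
    have h3 := h1.unique (h2.congr_of_eventuallyEq (by
      filter_upwards [Ioi_mem_nhds hz] with w hw
      exact ih w hw))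
    have hp : (p : ℝ) + 1 ≠ 0 := by positivity
    have e1 : ((p + 1 + 1 : ℕ) : ℝ) / 2 = a + 1 := by push_cast; rw [ha]; ring
    have e2 : (((p + 1 + 1 : ℕ) : ℝ) + 1) / 2 = ((p : ℝ) + 1) / 2 + 1 := by push_cast; ring
    rw [e1, e2, Real.Gamma_add_one (by positivity), Real.rpow_add_one (by norm_num), neg_add,
      ← sub_eq_add_neg, Real.rpow_sub_one hz.ne']
    rw [Real.rpow_sub_one hz.ne'] at h3
    change poisson (p + 2) z = _
    field_simp at h3 ⊢
    refine mul_left_cancel₀ hz.ne' ?_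
    linear_combination (-1) * h3

/-! ### Fourier integrals of radial functions -/

theorem integrableOn_of_bounded_support {X : Type*} [MeasurableSpace X] {μ : Measure X}
    {f : X → ℝ} (hf : Measurable f) {S T : Set X} (hS : MeasurableSet S) (hμ : μ S ≠ ⊤)
    (hT : MeasurableSet T) {C : ℝ} (hC : ∀ x ∈ S, |f x| ≤ C) (h0 : ∀ x ∈ T, x ∉ S → f x = 0) :
    IntegrableOn f T μ := by
  have hi : Integrable (S.indicator fun _ => C) μ :=
    (integrable_indicator_iff hS).mpr (integrableOn_const hμ)
  refine Integrable.mono' hi.integrableOn hf.aestronglyMeasurable ?_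
  rw [ae_restrict_iff' hT]
  refine ae_of_all _ fun x hx => ?_
  by_cases h : x ∈ S
  · rw [indicator_of_mem h]; exact hC x h
  · rw [indicator_of_notMem h, h0 x hx h, norm_zero]

theorem integral_split (N : ℕ) (F : ℝ → ℝ → ℝ) :
    ∫ ξ : E (N + 1), F (ξ 0) ‖ξ‖ = ∫ p : ℝ × E N, F p.1 √(p.1 ^ 2 + ‖p.2‖ ^ 2) := by
  let e : E (N + 1) ≃ᵐ ℝ × E N := (MeasurableEquiv.toLp 2 (Fin (N + 1) → ℝ)).symm.trans
    ((MeasurableEquiv.piFinSuccAbove (fun _ => ℝ) 0).trans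
      (MeasurableEquiv.prodCongr (MeasurableEquiv.refl ℝ) (MeasurableEquiv.toLp 2 (Fin N → ℝ))))
  have he : MeasurePreserving e volume volume :=
    (EuclideanSpace.volume_preserving_symm_measurableEquiv_toLp (Fin (N + 1))).trans
      ((volume_preserving_piFinSuccAbove (fun _ => ℝ) 0).trans
        ((MeasurePreserving.id volume).prod (PiLp.volume_preserving_toLp (Fin N))))
  rw [← he.integral_comp']
  congr 1
  ext ξ
  have h1 : (e ξ).1 = ξ 0 := rfl
  have h2 : ∀ i, (e ξ).2 i = ξ i.succ := fun i => rfl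
  have h3 : ‖ξ‖ = √((e ξ).1 ^ 2 + ‖(e ξ).2‖ ^ 2) := by
    rw [EuclideanSpace.norm_eq, EuclideanSpace.norm_eq, Real.sq_sqrt (by positivity),
      Fin.sum_univ_succ, h1]
    simp [h2]
  rw [← h3, h1]

theorem le_sqrt_add_sq_of_norm {N : ℕ} (p : ℝ × E N) : ‖p‖ ≤ √(p.1 ^ 2 + ‖p.2‖ ^ 2) := by
  refine Real.le_sqrt_of_sq_le ?_
  rcases le_total ‖p.1‖ ‖p.2‖ with h | h
  · rw [Prod.norm_def, max_eq_right h]; nlinarith [sq_nonneg p.1]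
  · rw [Prod.norm_def, max_eq_left h, Real.norm_eq_abs, sq_abs]; nlinarith [sq_nonneg ‖p.2‖]

/-- For a fixed first coordinate the other `N` variables enter through their norm `y` alone. Polar
coordinates in the half plane of `(ξ₀, y)` turn `y^(N-1)` and the Jacobian into `r^N sin^(N-1) θ`.
-/
theorem integral_radial_cos_poisson {N : ℕ} (hN : 1 ≤ N) (κ : ℝ) {G : ℝ → ℝ} (hG : Measurable G)
    {C ρ : ℝ} (hC : ∀ r, |G r| ≤ C) (h0 : ∀ r, ρ < r → G r = 0) :
    ∫ ξ : E (N + 1), Real.cos (κ * ξ 0) * G ‖ξ‖ =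
      N * volume.real (Metric.ball (0 : E N) 1) *
        ∫ r in Ioi (0 : ℝ), r ^ N * G r * poisson (N - 1) (κ * r) := by
  have hNe : Nonempty (Fin N) := ⟨⟨0, hN⟩⟩
  have hC0 : 0 ≤ C := (abs_nonneg _).trans (hC 0)
  have hb : ∀ x r : ℝ, |Real.cos x * G r| ≤ C := fun x r => by
    rw [abs_mul]
    exact (mul_le_of_le_one_left (abs_nonneg _) (Real.abs_cos_le_one x)).trans (hC r)
  rw [integral_split N fun a r => Real.cos (κ * a) * G r]
  have hi1 : Integrable fun p : ℝ × E N => Real.cos (κ * p.1) * G √(p.1 ^ 2 + ‖p.2‖ ^ 2) := by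
    rw [← integrableOn_univ]
    refine integrableOn_of_bounded_support (S := Metric.closedBall 0 ρ) (C := C) (by fun_prop)
      measurableSet_closedBall measure_closedBall_lt_top.ne MeasurableSet.univ
      (fun p _ => hb _ _) fun p _ hp => ?_
    rw [mem_closedBall_zero_iff, not_le] at hp
    rw [h0 _ (hp.trans_le (le_sqrt_add_sq_of_norm p)), mul_zero]
  rw [Measure.volume_eq_prod, integral_prod _ hi1]
  have h1 : ∀ a : ℝ, ∫ η : E N, Real.cos (κ * a) * G √(a ^ 2 + ‖η‖ ^ 2) =
      N * volume.real (Metric.ball (0 : E N) 1) *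
        ∫ y in Ioi (0 : ℝ), y ^ (N - 1) * (Real.cos (κ * a) * G √(a ^ 2 + y ^ 2)) := by
    intro a
    rw [integral_fun_norm_addHaar volume fun y => Real.cos (κ * a) * G √(a ^ 2 + y ^ 2),
      finrank_euclideanSpace_fin]
    simp [mul_assoc]
  simp only [h1]
  rw [integral_const_mul]
  congr 1
  -- Extending by zero to `y ≤ 0` allows polar coordinates on the whole plane; the angles in `(-π,
  -- 0]` then contribute nothing.
  set H : ℝ × ℝ → ℝ := fun p =>
    (Ioi 0).indicator (fun y => y ^ (N - 1) * (Real.cos (κ * p.1) * G √(p.1 ^ 2 + y ^ 2))) p.2 with hH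
  have hHm : Measurable H := by
    have : H = (univ ×ˢ Ioi (0 : ℝ)).indicator
        fun p => p.2 ^ (N - 1) * (Real.cos (κ * p.1) * G √(p.1 ^ 2 + p.2 ^ 2)) := by
      ext p
      by_cases hp : 0 < p.2 <;> simp [hH, indicator, hp]
    rw [this]
    exact Measurable.indicator (by fun_prop) (MeasurableSet.univ.prod measurableSet_Ioi)
  have hH0 : ∀ p : ℝ × ℝ, ρ < √(p.1 ^ 2 + p.2 ^ 2) → H p = 0 := fun p hp => by
    simp [hH, indicator, h0 _ hp]
  have hHb : ∀ p : ℝ × ℝ, |p.2| ≤ ρ → |H p| ≤ ρ ^ (N - 1) * C := fun p hp => by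
    have hρ : 0 ≤ ρ := (abs_nonneg _).trans hp
    by_cases h : 0 < p.2
    · simp only [hH, indicator_of_mem (mem_Ioi.mpr h)]
      rw [abs_mul, abs_pow]
      exact mul_le_mul (pow_le_pow_left₀ (abs_nonneg _) hp _) (hb _ _) (abs_nonneg _)
        (by positivity)
    · simp only [hH, indicator_of_notMem (show p.2 ∉ Ioi (0 : ℝ) from h), abs_zero]
      positivity
  have hHi : Integrable H := by
    rw [← integrableOn_univ]
    refine integrableOn_of_bounded_support (S := Metric.closedBall 0 ρ) hHm
      measurableSet_closedBall measure_closedBall_lt_top.ne MeasurableSet.univ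
      (fun p hp => hHb p ?_) fun p _ hp => hH0 p ?_
    · rw [mem_closedBall_zero_iff] at hp
      exact (norm_snd_le p).trans hp
    · rw [mem_closedBall_zero_iff, not_le] at hp
      refine hp.trans_le (Real.le_sqrt_of_sq_le ?_)
      rcases le_total ‖p.1‖ ‖p.2‖ with h | h
      · rw [Prod.norm_def, max_eq_right h, Real.norm_eq_abs, sq_abs]; nlinarith [sq_nonneg p.1]
      · rw [Prod.norm_def, max_eq_left h, Real.norm_eq_abs, sq_abs]; nlinarith [sq_nonneg p.2]
  have h2 : ∫ a : ℝ, ∫ y in Ioi (0 : ℝ), y ^ (N - 1) * (Real.cos (κ * a) * G √(a ^ 2 + y ^ 2)) =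
      ∫ p : ℝ × ℝ, H p := by
    rw [Measure.volume_eq_prod, integral_prod _ hHi]
    congr 1
    ext a
    exact (integral_indicator measurableSet_Ioi).symm
  rw [h2, ← integral_comp_polarCoord_symm, polarCoord_target, Measure.volume_eq_prod,
    setIntegral_prod]
  · refine setIntegral_congr_fun measurableSet_Ioi fun r hr => ?_
    have hr0 : 0 < r := hr
    have hpi := Real.pi_pos
    simp only [polarCoord_symm_apply, smul_eq_mul]
    rw [setIntegral_eq_of_subset_of_forall_sdiff_eq_zero (s := Ioo 0 Real.pi) measurableSet_Ioo
      (Ioo_subset_Ioo_left (by linarith))]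
    · rw [poisson, intervalIntegral.integral_of_le hpi.le, integral_Ioc_eq_integral_Ioo,
        ← integral_const_mul]
      refine setIntegral_congr_fun measurableSet_Ioo fun θ hθ => ?_
      have hs : 0 < Real.sin θ := Real.sin_pos_of_pos_of_lt_pi hθ.1 hθ.2
      have h3 : √((r * Real.cos θ) ^ 2 + (r * Real.sin θ) ^ 2) = r := by
        rw [show (r * Real.cos θ) ^ 2 + (r * Real.sin θ) ^ 2 = r ^ 2 by
          linear_combination r ^ 2 * Real.sin_sq_add_cos_sq θ, Real.sqrt_sq hr0.le]
      obtain ⟨k, rfl⟩ := Nat.exists_eq_add_of_le' hN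
      simp only [hH, indicator_of_mem (mem_Ioi.mpr (mul_pos hr0 hs)), h3, add_tsub_cancel_right]
      rw [← mul_assoc κ]
      ring
    · intro θ hθ
      have h4 : θ ≤ 0 := by
        by_contra h
        exact hθ.2 ⟨not_le.mp h, hθ.1.2⟩
      have hs : Real.sin θ ≤ 0 := Real.sin_nonpos_of_nonpos_of_neg_pi_le h4 hθ.1.1.le
      have h5 : r * Real.sin θ ∉ Ioi (0 : ℝ) := by
        rw [mem_Ioi, not_lt]
        exact mul_nonpos_of_nonneg_of_nonpos hr0.le hs
      simp only [hH, indicator_of_notMem h5, mul_zero]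
  · have hcont : Continuous fun p : ℝ × ℝ => (p.1 * Real.cos p.2, p.1 * Real.sin p.2) := by fun_prop
    simp only [polarCoord_symm_apply, smul_eq_mul]
    refine integrableOn_of_bounded_support (S := Icc 0 ρ ×ˢ Icc (-Real.pi) Real.pi)
      (C := ρ * (ρ ^ (N - 1) * C)) (f := fun p => p.1 * H (p.1 * Real.cos p.2, p.1 * Real.sin p.2))
      (measurable_fst.mul (hHm.comp hcont.measurable)) (measurableSet_Icc.prod measurableSet_Icc)
      (isCompact_Icc.prod isCompact_Icc).measure_lt_top.ne
      (measurableSet_Ioi.prod measurableSet_Ioo) ?_ ?_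
    · rintro ⟨r, θ⟩ ⟨hr, hθ⟩
      rw [abs_mul, abs_of_nonneg hr.1]
      refine mul_le_mul hr.2 (hHb _ ?_) (abs_nonneg _) (hr.1.trans hr.2)
      simp only
      rw [abs_mul, abs_of_nonneg hr.1]
      exact (mul_le_of_le_one_right hr.1 (Real.abs_sin_le_one θ)).trans hr.2
    · rintro ⟨r, θ⟩ ⟨hr, hθ⟩ hS
      have hr0 : 0 < r := hr
      rw [hH0, mul_zero]
      have h3 : √((r * Real.cos θ) ^ 2 + (r * Real.sin θ) ^ 2) = r := by
        rw [show (r * Real.cos θ) ^ 2 + (r * Real.sin θ) ^ 2 = r ^ 2 by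
          linear_combination r ^ 2 * Real.sin_sq_add_cos_sq θ, Real.sqrt_sq hr0.le]
      simp only [h3]
      by_contra h
      exact hS ⟨⟨hr0.le, not_lt.mp h⟩, ⟨hθ.1.le, hθ.2.le⟩⟩

/-- For `N ≥ 1` Poisson's integral is expressed through `J`. For `N = 0` there are no transverse
variables, and `J_{-1/2}` is an explicit cosine. -/
theorem integral_radial_cos (N : ℕ) {κ : ℝ} (hκ : 0 < κ) {G : ℝ → ℝ} (hG : Measurable G)
    {C ρ : ℝ} (hC : ∀ r, |G r| ≤ C) (h0 : ∀ r, ρ < r → G r = 0) :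
    ∫ ξ : E (N + 1), Real.cos (κ * ξ 0) * G ‖ξ‖ =
      (2 * Real.pi) ^ (((N + 1 : ℕ) : ℝ) / 2) * κ ^ (1 - ((N + 1 : ℕ) : ℝ) / 2) *
        ∫ r in Ioi (0 : ℝ), besselJ (((N + 1 : ℕ) : ℝ) / 2 - 1) (κ * r) *
          (r ^ (((N + 1 : ℕ) : ℝ) / 2) * G r) := by
  have hpi := Real.pi_pos
  rcases Nat.eq_zero_or_pos N with rfl | hN
  · have h1 : ∀ ξ : E (0 + 1), Real.cos (κ * ξ 0) * G ‖ξ‖ = Real.cos (κ * ‖ξ‖) * G ‖ξ‖ := by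
      intro ξ
      have : ‖ξ‖ = |ξ 0| := by
        rw [EuclideanSpace.norm_eq]; simp [Real.sqrt_sq_eq_abs]
      rw [this]
      congr 1
      rw [← Real.cos_abs (κ * ξ 0), abs_mul, abs_of_pos hκ]
    have hv : volume.real (Metric.ball (0 : E (0 + 1)) 1) = 2 := by
      rw [Measure.real, EuclideanSpace.volume_ball]
      have h2 : 0 < √Real.pi := Real.sqrt_pos.mpr hpi
      simp only [zero_add, ENNReal.ofReal_one, one_mul, Fintype.card_fin, Nat.cast_one, pow_one]
      rw [Real.Gamma_add_one (by norm_num), Real.Gamma_one_half_eq,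
        ENNReal.toReal_ofReal (by positivity)]
      field_simp
    simp only [h1]
    rw [integral_fun_norm_addHaar volume fun y => Real.cos (κ * y) * G y, hv,
      finrank_euclideanSpace_fin, ← integral_const_mul]
    simp only [zero_add, one_smul, smul_eq_mul, Nat.cast_one, tsub_self, pow_zero, one_mul]
    rw [← integral_const_mul]
    refine setIntegral_congr_fun measurableSet_Ioi fun r hr => ?_
    have hr0 : 0 < r := hr
    have h := besselJ_half_formulas.1 (κ * r) (by positivity)
    rw [show (1 : ℝ) / 2 - 1 = -(1 / 2) by norm_num, show (1 : ℝ) - 1 / 2 = 1 / 2 by norm_num]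
    simp only [← Real.sqrt_eq_rpow]
    rw [Real.sqrt_mul hκ.le] at h
    have h2 : √(2 * Real.pi) * √(2 / Real.pi) = 2 := by
      rw [← Real.sqrt_mul (by positivity), show 2 * Real.pi * (2 / Real.pi) = 2 ^ 2 by field_simp,
        Real.sqrt_sq (by norm_num)]
    linear_combination (-√(2 * Real.pi) * G r) * h - Real.cos (κ * r) * G r * h2
  · have hNe : Nonempty (Fin N) := ⟨⟨0, hN⟩⟩
    have hN0 : (0 : ℝ) < N := by exact_mod_cast hN
    rw [integral_radial_cos_poisson hN κ hG hC h0, ← integral_const_mul, ← integral_const_mul]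
    refine setIntegral_congr_fun measurableSet_Ioi fun r hr => ?_
    have hr0 : 0 < r := hr
    -- The area of the unit sphere in dimension `N` cancels the Gamma factor of `poisson_eq`.
    have hv : N * volume.real (Metric.ball (0 : E N) 1) * Real.Gamma ((N : ℝ) / 2) =
        2 * Real.pi ^ ((N : ℝ) / 2) := by
      have hg : 0 < Real.Gamma ((N : ℝ) / 2) := Real.Gamma_pos_of_pos (by positivity)
      rw [Measure.real, EuclideanSpace.volume_ball, Real.Gamma_add_one (by positivity)]
      simp only [ENNReal.ofReal_one, one_pow, one_mul, Fintype.card_fin]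
      rw [ENNReal.toReal_ofReal (by positivity), Real.sqrt_eq_rpow, ← Real.rpow_natCast,
        ← Real.rpow_mul hpi.le, show (1 : ℝ) / 2 * N = N / 2 by ring]
      field_simp
    have e1 : (((N - 1 : ℕ) : ℝ) + 1) / 2 = (N : ℝ) / 2 := by
      rw [Nat.cast_sub hN]; simp
    set a := ((N - 1 : ℕ) : ℝ) / 2 with ha
    have e2 : ((N + 1 : ℕ) : ℝ) / 2 - 1 = a := by
      rw [ha, Nat.cast_sub hN]; push_cast; ring
    have e3 : ((N + 1 : ℕ) : ℝ) / 2 = (N : ℝ) / 2 + 1 / 2 := by push_cast; ring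
    have e4 : 1 - ((N + 1 : ℕ) : ℝ) / 2 = -a := by rw [← e2]; ring
    have e5 : r ^ (((N + 1 : ℕ) : ℝ) / 2) = r ^ N * r ^ (-a) := by
      rw [← Real.rpow_natCast, ← Real.rpow_add hr0, ← e2]; congr 1; push_cast; ring
    have e6 : (2 * Real.pi) ^ (((N + 1 : ℕ) : ℝ) / 2) = 2 * 2 ^ a * (Real.pi ^ ((N : ℝ) / 2) * √Real.pi) := by
      rw [Real.mul_rpow (by norm_num) hpi.le, e3, Real.rpow_add hpi, ← Real.sqrt_eq_rpow,
        ← e3, show ((N + 1 : ℕ) : ℝ) / 2 = a + 1 by rw [← e2]; ring, Real.rpow_add_one (by norm_num)]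
      ring
    rw [poisson_eq _ _ (mul_pos hκ hr0), e1, e2, e4, e5, e6, Real.mul_rpow hκ.le hr0.le]
    linear_combination (r ^ N * G r * √Real.pi * 2 ^ a * κ ^ (-a) * r ^ (-a) * besselJ a (κ * r)) * hv

/-! ### The truncated Hankel kernel -/

/-- The radial profile of the symbol of `A_{-s}`, truncated to the frequencies `2π|ξ| ≤ R`. -/
def cutProfile (s R r : ℝ) : ℝ :=
  if |2 * Real.pi * r| ≤ R then (1 + (2 * Real.pi * r) ^ 2) ^ (-s) else 0

theorem measurable_cutProfile (s R : ℝ) : Measurable (cutProfile s R) := by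
  unfold cutProfile
  refine Measurable.ite ?_ (by fun_prop) measurable_const
  exact measurableSet_le (by fun_prop) measurable_const

theorem abs_cutProfile_le (s R r : ℝ) : |cutProfile s R r| ≤ (1 + R ^ 2) ^ |s| := by
  unfold cutProfile
  split_ifs with h
  · have h1 : (2 * Real.pi * r) ^ 2 ≤ R ^ 2 := sq_le_sq.mpr (h.trans (le_abs_self R))
    have h2 : 1 ≤ 1 + (2 * Real.pi * r) ^ 2 := by nlinarith [sq_nonneg (2 * Real.pi * r)]
    rw [abs_of_nonneg (by positivity)]
    calc _ ≤ (1 + (2 * Real.pi * r) ^ 2) ^ |s| :=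
          Real.rpow_le_rpow_of_exponent_le h2 (neg_le_abs s)
      _ ≤ _ := Real.rpow_le_rpow (by positivity) (by linarith) (abs_nonneg s)
  · rw [abs_zero]; positivity

theorem cutProfile_eq_zero (s : ℝ) {R r : ℝ} (h : R / (2 * Real.pi) < r) :
    cutProfile s R r = 0 := by
  unfold cutProfile
  rw [if_neg]
  rw [div_lt_iff₀ (by have := Real.pi_pos; positivity)] at h
  rw [not_le]
  calc R < 2 * Real.pi * r := by linarith
    _ ≤ _ := le_abs_self _

theorem cutProfile_norm (n : ℕ) (s R : ℝ) (ξ : E n) :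
    cutProfile s R ‖ξ‖ = if 2 * Real.pi * ‖ξ‖ ≤ R then symbol n (-s) ξ else 0 := by
  unfold cutProfile symbol
  rw [abs_of_nonneg (by have := Real.pi_pos; positivity)]

theorem abs_cutProfile_norm_le (n : ℕ) (s R : ℝ) (ξ : E n) :
    |cutProfile s R ‖ξ‖| ≤ symbol n (-s) ξ := by
  have h := (symbol_pos n (-s) ξ).le
  rw [cutProfile_norm]
  split_ifs
  · rw [abs_of_nonneg h]
  · rwa [abs_zero]

theorem integrable_cutProfile_norm (n : ℕ) (s R : ℝ) :
    Integrable fun ξ : E n => cutProfile s R ‖ξ‖ := by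
  rw [← integrableOn_univ]
  refine integrableOn_of_bounded_support (S := Metric.closedBall 0 (R / (2 * Real.pi)))
    ((measurable_cutProfile s R).comp measurable_norm) measurableSet_closedBall
    measure_closedBall_lt_top.ne MeasurableSet.univ (fun p _ => abs_cutProfile_le s R _)
    fun p _ hp => ?_
  rw [mem_closedBall_zero_iff, not_le] at hp
  exact cutProfile_eq_zero s hp

/-! ### Convolution with the Fourier transform of the truncated symbol -/

theorem fourier_radial_eq {n : ℕ} {g : ℝ → ℝ} (hg : Integrable fun ξ : E n => g ‖ξ‖) (x : E n) :
    𝓕 (fun ξ : E n => (g ‖ξ‖ : ℂ)) x =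
      ((∫ ξ : E n, Real.cos (2 * Real.pi * inner ℝ ξ x) * g ‖ξ‖ : ℝ) : ℂ) := by
  have hc : starRingEnd ℂ (𝓕 (fun ξ : E n => (g ‖ξ‖ : ℂ)) x) = 𝓕 (fun ξ : E n => (g ‖ξ‖ : ℂ)) x := by
    rw [Real.fourier_eq', ← integral_conj, ← integral_neg_eq_self]
    congr 1
    ext v
    simp [← Complex.exp_conj, map_ofNat]
  rw [← Complex.conj_eq_iff_re.mp hc]
  congr 1
  rw [Real.fourier_eq']
  have hi : Integrable fun ξ : E n =>
      Complex.exp (↑(-2 * Real.pi * inner ℝ ξ x) * Complex.I) * (g ‖ξ‖ : ℂ) := by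
    refine (hg.ofReal (𝕜 := ℂ)).bdd_mul (c := 1)
      (Continuous.aestronglyMeasurable (by fun_prop))
      (ae_of_all _ fun ξ => (Complex.norm_exp_ofReal_mul_I _).le)
  have h := integral_re hi
  simp only [RCLike.re_to_complex] at h
  simp only [smul_eq_mul]
  rw [← h]
  congr 1
  ext ξ
  rw [Complex.re_mul_ofReal, Complex.exp_ofReal_mul_I_re, ← Real.cos_neg]
  congr 2
  ring

/-- The reflection exchanging `x` and `y` is an isometry, so it commutes with the Fourier transform
and preserves radial functions. -/
theorem fourier_radial_rotate {n : ℕ} (g : ℝ → ℂ) {x y : E n} (h : ‖x‖ = ‖y‖) :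
    𝓕 (fun ξ : E n => g ‖ξ‖) x = 𝓕 (fun ξ : E n => g ‖ξ‖) y := by
  have h1 := Real.fourier_comp_linearIsometry ((ℝ ∙ (x - y))ᗮ.reflection) (fun ξ : E n => g ‖ξ‖) x
  rw [Submodule.reflection_sub h] at h1
  rw [← h1]
  refine congrArg (fun f : E n → ℂ => 𝓕 f x) ?_
  funext ξ
  simp

/-- Rotating `x` onto the first axis makes `integral_radial_cos` applicable with `κ = 2π‖x‖`; the
scaling `q = 2πr` passes to the frequency variable of the unitary convention. -/
theorem kernelJ_eq_fourier {n : ℕ} (hn : 1 ≤ n) (s : ℝ) {R : ℝ} (hR : 0 < R) {x : E n}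
    (hx : x ≠ 0) : (kernelJ n s R x : ℂ) = 𝓕 (fun ξ : E n => (cutProfile s R ‖ξ‖ : ℂ)) x := by
  obtain ⟨N, rfl⟩ := Nat.exists_eq_add_of_le' hn
  have hr : 0 < ‖x‖ := norm_pos_iff.mpr hx
  have hpi := Real.pi_pos
  have h2pi : 0 < 2 * Real.pi := by positivity
  have hy : ‖x‖ = ‖EuclideanSpace.single (0 : Fin (N + 1)) ‖x‖‖ := by simp
  rw [fourier_radial_rotate (fun r => (cutProfile s R r : ℂ)) hy,
    fourier_radial_eq (integrable_cutProfile_norm _ s R)]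
  congr 1
  have e1 : ∀ ξ : E (N + 1), Real.cos (2 * Real.pi *
      inner ℝ ξ (EuclideanSpace.single (0 : Fin (N + 1)) ‖x‖)) * cutProfile s R ‖ξ‖ =
      Real.cos (2 * Real.pi * ‖x‖ * ξ 0) * cutProfile s R ‖ξ‖ := by
    intro ξ
    rw [EuclideanSpace.inner_single_right]
    simp [mul_assoc]
  simp only [e1]
  rw [integral_radial_cos N (mul_pos h2pi hr) (measurable_cutProfile s R) (abs_cutProfile_le s R)
    (fun r => cutProfile_eq_zero s), kernelJ]
  set b : ℝ := ((N + 1 : ℕ) : ℝ) / 2 with hb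
  set g : ℝ → ℝ := fun q => besselJ (b - 1) (q * ‖x‖) *
    (q ^ b * if |q| ≤ R then (1 + q ^ 2) ^ (-s) else 0) with hg
  have h1 := integral_comp_mul_left_Ioi g 0 h2pi
  rw [mul_zero, smul_eq_mul] at h1
  have h2 : ∫ q in Ioi (0 : ℝ), g q =
      ∫ q in (0 : ℝ)..R, besselJ (b - 1) (q * ‖x‖) * (q ^ b / (1 + q ^ 2) ^ s) := by
    rw [intervalIntegral.integral_of_le hR.le,
      setIntegral_eq_of_subset_of_forall_sdiff_eq_zero (s := Ioc 0 R) measurableSet_Ioi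
        Ioc_subset_Ioi_self]
    · refine setIntegral_congr_fun measurableSet_Ioc fun q hq => ?_
      simp only [hg]
      rw [if_pos (by rw [abs_of_pos hq.1]; exact hq.2), Real.rpow_neg (by positivity), div_eq_mul_inv]
    · intro q hq
      have hq0 : 0 < q := hq.1
      simp only [hg]
      rw [if_neg, mul_zero, mul_zero]
      rw [abs_of_pos hq0]
      exact fun h => hq.2 ⟨hq0, h⟩
  have h3 : ∫ r in Ioi (0 : ℝ), g (2 * Real.pi * r) = (2 * Real.pi) ^ b *
      ∫ r in Ioi (0 : ℝ), besselJ (b - 1) (2 * Real.pi * ‖x‖ * r) * (r ^ b * cutProfile s R r) := by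
    rw [← integral_const_mul]
    refine setIntegral_congr_fun measurableSet_Ioi fun r hr => ?_
    have hr0 : 0 < r := hr
    simp only [hg, cutProfile]
    rw [Real.mul_rpow h2pi.le hr0.le, mul_right_comm (2 * Real.pi) r ‖x‖]
    ring
  rw [h3, h2] at h1
  rw [Real.mul_rpow h2pi.le hr.le, Real.rpow_sub h2pi, Real.rpow_one, Real.rpow_neg h2pi.le]
  have hB : 0 < (2 * Real.pi) ^ b := by positivity
  set I1 := ∫ r in Ioi (0 : ℝ), besselJ (b - 1) (2 * Real.pi * ‖x‖ * r) * (r ^ b * cutProfile s R r)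
  set I2 := ∫ q in (0 : ℝ)..R, besselJ (b - 1) (q * ‖x‖) * (q ^ b / (1 + q ^ 2) ^ s)
  have h4 : I2 = 2 * Real.pi * ((2 * Real.pi) ^ b * I1) := by
    rw [h1, mul_inv_cancel_left₀ h2pi.ne']
  rw [h4]
  field_simp

theorem kernelJ_convolution {n : ℕ} (hn : 1 ≤ n) (s : ℝ) {R : ℝ} (hR : 0 < R) (m : 𝓢(E n, ℝ))
    (x : E n) :
    ConvolutionExistsAt (kernelJ n s R) m x (ContinuousLinearMap.mul ℝ ℝ) volume ∧
    (((kernelJ n s R ⋆[ContinuousLinearMap.mul ℝ ℝ, volume] m) x : ℝ) : ℂ) =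
      ∫ ξ : E n, (cutProfile s R ‖ξ‖ : ℂ) * 𝓕 (reflTranslate m x) ξ := by
  have : Nonempty (Fin n) := ⟨⟨0, hn⟩⟩
  have hne : ∀ᵐ y : E n, y ≠ 0 := by
    rw [ae_iff]; simp
  have hf : Integrable fun ξ : E n => (cutProfile s R ‖ξ‖ : ℂ) :=
    (integrable_cutProfile_norm n s R).ofReal
  have hK : ∀ᵐ y : E n, 𝓕 (fun ξ : E n => (cutProfile s R ‖ξ‖ : ℂ)) y * reflTranslate m x y =
      ((kernelJ n s R y * m (x - y) : ℝ) : ℂ) := by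
    filter_upwards [hne] with y hy
    rw [← kernelJ_eq_fourier hn s hR hy]
    simp [reflTranslate]
  have hI : Integrable fun y : E n =>
      𝓕 (fun ξ : E n => (cutProfile s R ‖ξ‖ : ℂ)) y * reflTranslate m x y := by
    refine (integrable_reflTranslate m x).bdd_mul
      (c := ∫ ξ : E n, ‖(cutProfile s R ‖ξ‖ : ℂ)‖) ?_ (ae_of_all _ fun y => ?_)
    · exact (VectorFourier.fourierIntegral_continuous Real.continuous_fourierChar
        (L := innerₗ (E n)) continuous_inner hf).aestronglyMeasurable
    · exact VectorFourier.norm_fourierIntegral_le_integral_norm _ _ _ _ _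
  constructor
  · have := (hI.congr hK).re
    simpa [ConvolutionExistsAt] using this
  · rw [← integral_fourier_mul_eq hf (integrable_reflTranslate m x), integral_congr_ae hK,
      integral_complex_ofReal, convolution_def]
    simp

/-- Up to a phase and a reflection this is the symbol times `𝓕 m`, a Schwartz function. -/
theorem integrable_symbol_mul_fourier_reflTranslate {n : ℕ} (s : ℝ) (m : 𝓢(E n, ℝ)) (x : E n) :
    Integrable fun ξ => (symbol n s ξ : ℂ) * 𝓕 (reflTranslate m x) ξ := by
  have h := ((SchwartzMap.smulLeftCLM ℂ (fun ξ : E n => ((symbol n s ξ : ℝ) : ℂ))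
    (𝓕 (toC m))).integrable (μ := volume)).comp_neg
  refine h.congr' ?_ (ae_of_all _ fun ξ => ?_)
  · exact ((symbolC_temperate n s).1.continuous.aestronglyMeasurable).mul
      (integrable_fourier_reflTranslate m x).aestronglyMeasurable
  · rw [SchwartzMap.smulLeftCLM_apply_apply (symbolC_temperate n s), SchwartzMap.fourier_coe,
      symbol_neg_arg, fourier_reflTranslate, norm_smul, norm_mul, norm_mul,
      Complex.norm_exp_ofReal_mul_I, one_mul]

/-- On the Fourier side the truncated symbols increase to the full one, and the full product with
the transform of the reflected translate is an integrable majorant. The argument holds for every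
`s`. -/
theorem tendsto_kernelJ_convolution {n : ℕ} (hn : 1 ≤ n) (s : ℝ) (m : 𝓢(E n, ℝ)) (x : E n) :
    Tendsto (fun R => (kernelJ n s R ⋆[ContinuousLinearMap.mul ℝ ℝ, volume] m) x) atTop
      (𝓝 (op (-s) m x)) := by
  have h : Tendsto (fun R => ∫ ξ : E n, (cutProfile s R ‖ξ‖ : ℂ) * 𝓕 (reflTranslate m x) ξ) atTop
      (𝓝 (∫ ξ : E n, (symbol n (-s) ξ : ℂ) * 𝓕 (reflTranslate m x) ξ)) := by
    refine tendsto_integral_filter_of_dominated_convergence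
      (fun ξ => ‖(symbol n (-s) ξ : ℂ) * 𝓕 (reflTranslate m x) ξ‖)
      (Eventually.of_forall fun R => ?_) (Eventually.of_forall fun R => ae_of_all _ fun ξ => ?_)
      (integrable_symbol_mul_fourier_reflTranslate (-s) m x).norm (ae_of_all _ fun ξ => ?_)
    · exact (integrable_cutProfile_norm n s R).ofReal.aestronglyMeasurable.mul
        (integrable_fourier_reflTranslate m x).aestronglyMeasurable
    · rw [norm_mul, norm_mul, Complex.norm_real, Complex.norm_real, Real.norm_eq_abs,
        Real.norm_eq_abs, abs_of_pos (symbol_pos n (-s) ξ)]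
      exact mul_le_mul_of_nonneg_right (abs_cutProfile_norm_le n s R ξ) (norm_nonneg _)
    · refine tendsto_const_nhds.congr' ?_
      filter_upwards [eventually_ge_atTop (2 * Real.pi * ‖ξ‖)] with R hR
      rw [cutProfile_norm, if_pos hR]
  rw [integral_symbol_mul_fourier_reflTranslate] at h
  have h2 := (Complex.continuous_re.tendsto _).comp h
  rw [Complex.ofReal_re] at h2
  refine h2.congr' ?_
  filter_upwards [eventually_gt_atTop 0] with R hR
  rw [Function.comp_apply, ← (kernelJ_convolution hn s hR m x).2, Complex.ofReal_re]

/-- In either range of `s` the kernel convolution has the value `A_{-s} m`, so both sides say `u =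
A_{-s} m`. The case distinction serves only to pick the kernel, and `n ≥ 1` makes `s` positive in
the first range. -/
theorem isKernelConvolution_iff {n : ℕ} (hn : 1 ≤ n) (s : ℝ) (u m : 𝓢(E n, ℝ)) :
    (m : E n → ℝ) = op s u ↔ IsKernelConvolution s u m := by
  have h1 : (m : E n → ℝ) = op s u ↔ (u : E n → ℝ) = op (-s) m := by
    rw [← opS_coe, ← opS_coe, DFunLike.coe_fn_eq, DFunLike.coe_fn_eq]
    exact opS_eq_iff s u m
  rw [h1]
  have hn1 : (1 : ℝ) ≤ n := by exact_mod_cast hn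
  constructor
  · intro h
    refine ⟨fun hs x => ?_, fun hs x => ⟨fun R hR => (kernelJ_convolution hn s hR m x).1, ?_⟩⟩
    · have h2 := kernelK_convolution hn (s := s) (by linarith) m x
      exact ⟨h2.1, by rw [h2.2, h]⟩
    · rw [h]
      exact tendsto_kernelJ_convolution hn s m x
  · intro h
    ext x
    rcases lt_or_ge (((n : ℝ) - 1) / 4) s with hs | hs
    · rw [(h.1 hs x).2, (kernelK_convolution hn (s := s) (by linarith) m x).2]
    · exact tendsto_nhds_unique (h.2 hs x).2 (tendsto_kernelJ_convolution hn s m x)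

theorem isKernelConvolution_velocity {n : ℕ} (hn : 1 ≤ n) (s : ℝ) {J : Set ℝ} (hJ : IsOpen J)
    {φ : ℝ → DiffC n} (hφ : IsSmoothFamily J φ) {t : ℝ} (ht : t ∈ J) (k : Fin n) :
    IsKernelConvolution s (fun x => velocity φ t x k) (momentum s φ t k) := by
  have hu := rightField_isSmoothCompact hφ hJ 1
  have h := (isKernelConvolution_iff hn s (hu.fam t k) (mom s hu t k)).mp (opS_coe s (hu.fam t k))
  rwa [fam_velocity hφ hJ hu ht k, ← momentum_eq_mom s hφ hJ hu ht k] at h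

end SobolevDiff

end

theorem mainTheorem6 (n : ℕ) (hn : 1 ≤ n) (s : ℝ) :
    (∀ k : ℝ, BijOn (SobolevDiff.opDist n s)
      {f | TemperedDistribution.MemSobolev (k + 2 * s) 2 f}
      {f | TemperedDistribution.MemSobolev k 2 f}) ∧
    (∀ (φ : SobolevDiff.DiffC n) (X Y : SobolevDiff.E n → SobolevDiff.E n),
      SobolevDiff.IsTestField X → SobolevDiff.IsTestField Y →
      SobolevDiff.metricG s φ X Y =
        ∑ k, ∫ x, SobolevDiff.op s (fun y => X (φ.1.symm y) k) x * Y (φ.1.symm x) k) ∧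
    (∀ J : Set ℝ, IsOpen J → J.OrdConnected → ∀ φ : ℝ → SobolevDiff.DiffC n,
      SobolevDiff.IsSmoothFamily J φ →
      (SobolevDiff.IsGeodesic s J φ ↔
        SobolevDiff.MomentumEquation J (SobolevDiff.velocity φ) (SobolevDiff.momentum s φ)) ∧
      ∀ t ∈ J, ∀ k : Fin n,
        SobolevDiff.IsKernelConvolution s (fun x => SobolevDiff.velocity φ t x k)
          (SobolevDiff.momentum s φ t k)) ∧
    (∀ u m : 𝓢(SobolevDiff.E n, ℝ),
      (m : SobolevDiff.E n → ℝ) = SobolevDiff.op s u ↔ SobolevDiff.IsKernelConvolution s u m) ∧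
    (∀ ν r : ℝ, -(1 / 2) < ν → 0 < r →
      Tendsto (fun R : ℝ => Real.Gamma (ν + 1 / 2) * (2 * r) ^ ν / √Real.pi *
          ∫ t in (0 : ℝ)..R, Real.cos t / (t ^ 2 + r ^ 2) ^ (ν + 1 / 2)) atTop
        (𝓝 (SobolevDiff.besselK ν r))) := by
  exact ⟨SobolevDiff.bijOn_opDist n s, fun φ X Y => SobolevDiff.metricG_eq s φ X Y,
    fun J hJ _ φ hφ => ⟨SobolevDiff.isGeodesic_iff_momentumEquation s hJ hφ, fun t ht k =>
      SobolevDiff.isKernelConvolution_velocity hn s hJ hφ ht k⟩,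
    SobolevDiff.isKernelConvolution_iff hn s, fun ν r => SobolevDiff.tendsto_basset⟩
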